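/- Let $K$ be a field of characteristic zero, $A=\bigoplus_{i\in\mathbb Z}A^i$ an associative, unital, graded commutative $K$-algebra, and $L=\bigoplus_{i\in\mathbb Z}L^i$ a graded $A$-module. Elements are homogeneous, $|x|$ is the degree of $x$, and exponents of $-1$ are products of degrees. $S_{k,l}$ is the set of $(k,l)$-unshuffles, and $\alpha(s,\xi)$ is the Koszul sign of $\xi_1,\dots,\xi_n\mapsto\xi_{s(1)},\dots,\xi_{s(n)}$. For $s\in S_{k,l}$ write $\xi'=(\xi_{s(1)},\dots,\xi_{s(k)})$, $\xi''=(\xi_{s(k+1)},\dots,\xi_{s(k+l)})$, and $|\xi'|,|\xi''|$ for the sums of their degrees. **Forms.** $\mathrm{Sym}_A(L,A)=\bigoplus_{l\ge0}\mathrm{Sym}^l_A(L,A)$, where $\mathrm{Sym}_A^l(L,A)$ consists of the (finite sums of homogeneous) graded symmetric, graded $A$-multilinear maps $L^{\times l}\to A$ (the $l$-forms). The product of a $k$-form $\omega$ and an $l$-form $\omega'$ is $$(\omega\omega')(\xi_1,\dots,\xi_{k+l})=\sum_{s\in S_{k,l}}\alpha(s,\xi)(-1)^{|\omega'||\xi'|}\,\omega(\xi')\,\omega'(\xi'').$$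 By a derivation of $\mathrm{Sym}_A(L,A)$ of degree $d$ we mean a finite sum of $K$-linear endomorphisms $D$, each of which, for some $r\in\mathbb Z$, maps $l$-forms of degree $e$ to $(l+r)$-forms of degree $d+e$ for all $l,e$, and satisfies $D(\omega\omega')=D(\omega)\omega'+(-1)^{d|\omega|}\omega D(\omega')$. The bracket is the graded commutator. **Multiderivations.** A multiderivation of $L$ of degree $d$ with $k$ entries is a pair $\mathbb X=(X,\sigma_{\mathbb X})$, where $X:L^{\times k}\to L$ is a graded symmetric $K$-multilinear map of degree $d$ and $\sigma_{\mathbb X}:L^{\times(k-1)}\to\mathrm{Der}\,A$ (the symbol; absent if $k=0$) is a graded symmetric, graded $A$-multilinear map of degree $d$, such that, with $\sigma_{\mathbb X}(\cdots|a):=\sigma_{\mathbb X}(\cdots)(a)$, $$X(\xi_1,\dots,\xi_{k-1},a\xi_k)=\sigma_{\mathbb X}(\xi_1,\dots,\xi_{k-1}|a)\,\xi_k+(-1)^{(d+|\xi_1|+\cdots+|\xi_{k-1}|)|a|}a\,X(\xi_1,\dots,\xi_k).$$ $\mathrm{Der}^kL$ is spanned by them, $\mathrm{Der}^0L=L$,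 and $\mathrm{Der}^\bullet L=\bigoplus_{k\ge0}\mathrm{Der}^kL$, graded by $d$. For a map $f$ with $k$ entries and a map $g:L^{\times l}\to L$ put $$(f\circ g)(\xi_1,\dots,\xi_{k+l-1})=\sum_{s\in S_{l,k-1}}\alpha(s,\xi)\,f(g(\xi'),\xi''),$$ and $f\circ g=0$ if $k=0$. For $\mathbb X$ with $k$ and $\mathbb Y$ with $l$ entries, $[\mathbb X,\mathbb Y]$ is the pair, with $k+l-1$ entries, $$\bigl(X\circ Y-(-1)^{|\mathbb X||\mathbb Y|}Y\circ X,\ \ \sigma_{\mathbb X}\circ Y-(-1)^{|\mathbb X||\mathbb Y|}\sigma_{\mathbb Y}\circ X+[\sigma_{\mathbb X},\sigma_{\mathbb Y}]\bigr),$$ $$[\sigma_{\mathbb X},\sigma_{\mathbb Y}](\xi_1,\dots,\xi_{k+l-2})=\sum_{s\in S_{k-1,l-1}}(-1)^{|\mathbb Y||\xi'|}\alpha(s,\xi)\,[\sigma_{\mathbb X}(\xi'),\sigma_{\mathbb Y}(\xi'')]$$ (with graded commutators of derivations of $A$ on the right; terms with an absent symbol are zero, and $[\mathbb X,\mathbb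 Y]=0$ if $k=l=0$). **Proposition.** With these brackets, $\mathrm{Der}^\bullet L$ and the derivations of $\mathrm{Sym}_A(L,A)$ are graded Lie algebras, and there is a morphism of graded Lie algebras $$\eta:\mathrm{Der}^\bullet L\longrightarrow\{\text{derivations of }\mathrm{Sym}_A(L,A)\},$$ given, for $\mathbb X$ with $k$ entries and an $l$-form $\omega$, by $$\eta(\mathbb X)(\omega)=\sigma_{\mathbb X}\circ\omega-(-1)^{|\mathbb X||\omega|}\omega\circ X,$$ $$(\sigma_{\mathbb X}\circ\omega)(\xi_1,\dots,\xi_{l+k-1})=\sum_{s\in S_{k-1,l}}(-1)^{|\omega||\xi'|}\alpha(s,\xi)\,\sigma_{\mathbb X}(\xi'\,|\,\omega(\xi'')).$$ It maps multiderivations with $k$ entries to derivations that take $l$-forms to $(l+k-1)$-forms, for all $l$. If $L$ is projective and finitely generated as an $A$-module, then $\eta$ is an isomorphism. -/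

import Mathlib

open scoped DirectSum

noncomputable section

namespace GradedMultider

/-! ### Signs and unshuffles -/

/-- The sign `(-1) ^ n`, as an element of the ground field. -/
def sgn (K : Type*) [Field K] (n : ℤ) : K := ((n.negOnePow : ℤ) : K)

/-- The `(k, l)`-unshuffles of `n` letters. The empty type unless `k + l = n`. The values on
`Sum.inl 0, …, Sum.inl (k - 1)` are `σ(1) < ⋯ < σ(k)` and the values on
`Sum.inr 0, …, Sum.inr (l - 1)` are `σ(k + 1) < ⋯ < σ(k + l)`. -/
abbrev Unshuffle (k l n : ℕ) : Type :=
  {σ : Fin k ⊕ Fin l ≃ Fin n //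
    StrictMono (fun a => σ (Sum.inl a)) ∧ StrictMono (fun b => σ (Sum.inr b))}

/-- The exponent of the Koszul sign `α(σ, ξ)` of an unshuffle, where `ν` gives the degrees of
`ξ_{σ(1)}, …, ξ_{σ(k + l)}`: every inversion of `σ` contributes the product of the degrees of
the two letters that are interchanged. (There are no inversions inside either block.) -/
def koszulExp {k l n : ℕ} (σ : Unshuffle k l n) (ν : Fin k ⊕ Fin l → ℤ) : ℤ :=
  ∑ a : Fin k, ∑ b : Fin l,
    if σ.1 (Sum.inr b) < σ.1 (Sum.inl a) then ν (Sum.inl a) * ν (Sum.inr b) else 0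

/-- The sum of the degrees of the first block. -/
def degL {k l : ℕ} (ν : Fin k ⊕ Fin l → ℤ) : ℤ := ∑ a : Fin k, ν (Sum.inl a)

/-- The sum of the degrees of the second block. -/
def degR {k l : ℕ} (ν : Fin k ⊕ Fin l → ℤ) : ℤ := ∑ b : Fin l, ν (Sum.inr b)

/-! ### Multilinear maps and signed sums over unshuffles -/

/-- `K`-multilinear maps `L^{× k} → M`. -/
abbrev Raw (K : Type*) [Field K] (L : Type*) [AddCommGroup L] [Module K L] (k : ℕ)
    (M : Type*) [AddCommGroup M] [Module K M] : Type _ :=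
  MultilinearMap K (fun _ : Fin k => L) M

section Operations

variable {K : Type*} [Field K] {L : Type*} [AddCommGroup L] [Module K L]
  (ℒ : ℤ → Submodule K L) [DirectSum.Decomposition ℒ]
  {M : Type*} [AddCommGroup M] [Module K M]
  {M₁ : Type*} [AddCommGroup M₁] [Module K M₁] {M₂ : Type*} [AddCommGroup M₂] [Module K M₂]

/-- The `K`-multilinear map `L^{× n} → M` whose value on homogeneous elements `ξ_i` is the sum of
`α(σ, ξ) (-1)^{c} T(ξ_{σ(1)}, …, ξ_{σ(k)}; ξ_{σ(k+1)}, …, ξ_{σ(k+l)})` over all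
`(k, l)`-unshuffles `σ`; the extra exponent `c` is a function of the degrees of the `ξ_{σ(i)}`.
See `shuffleSum_apply`. -/
def shuffleSum {k l : ℕ} (n : ℕ) (c : (Fin k ⊕ Fin l → ℤ) → ℤ) :
    MultilinearMap K (fun _ : Fin k ⊕ Fin l => L) M →ₗ[K] Raw K L n M :=
  LinearMap.comp
    (MultilinearMap.compLinearMapₗ
      (fun _ : Fin n => (DirectSum.decomposeLinearEquiv ℒ).toLinearMap)) <|
  LinearMap.comp
    (MultilinearMap.fromDirectSumEquiv (ι := Fin n) (κ := fun _ => ℤ) (M := fun _ j => ℒ j)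
      (R := K) (M' := M)).toLinearMap <|
  LinearMap.pi fun δ : Fin n → ℤ =>
    ∑ σ : Unshuffle k l n, sgn K (koszulExp σ (fun x => δ (σ.1 x)) + c (fun x => δ (σ.1 x))) •
      LinearMap.comp (MultilinearMap.compLinearMapₗ (fun i : Fin n => (ℒ (δ i)).subtype))
        (MultilinearMap.domDomCongrLinearEquiv K K L M σ.1).toLinearMap

theorem shuffleSum_apply {k l n : ℕ} (c : (Fin k ⊕ Fin l → ℤ) → ℤ)
    (T : MultilinearMap K (fun _ : Fin k ⊕ Fin l => L) M) (δ : Fin n → ℤ) (ξ : Fin n → L)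
    (hξ : ∀ i, ξ i ∈ ℒ (δ i)) :
    shuffleSum ℒ n c T ξ = ∑ σ : Unshuffle k l n,
      sgn K (koszulExp σ (fun x => δ (σ.1 x)) + c (fun x => δ (σ.1 x))) •
        T (fun x => ξ (σ.1 x)) := by
  have h : (fun i => DirectSum.decomposeLinearEquiv ℒ (ξ i)) =
      fun i => DirectSum.lof K ℤ (fun j => ℒ j) (δ i) ⟨ξ i, hξ i⟩ := by
    funext i
    exact DirectSum.decomposeLinearEquiv_apply_coe ℒ (δ i) ⟨ξ i, hξ i⟩
  simp only [shuffleSum, LinearMap.comp_apply, MultilinearMap.compLinearMapₗ_apply,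
    MultilinearMap.compLinearMap_apply, LinearEquiv.coe_coe]
  rw [h, MultilinearMap.fromDirectSumEquiv_lof]
  simp

/-- For a bilinear operation `B`, the map `(x; y) ↦ B (f x) (g y)`. -/
def pairing (B : M₁ →ₗ[K] M₂ →ₗ[K] M) {k l : ℕ} :
    Raw K L k M₁ →ₗ[K] Raw K L l M₂ →ₗ[K] MultilinearMap K (fun _ : Fin k ⊕ Fin l => L) M :=
  LinearMap.mk₂ K (fun f g => (TensorProduct.lift B).compMultilinearMap (f.domCoprod g))
    (by intros; ext; simp) (by intros; ext; simp) (by intros; ext; simp) (by intros; ext; simp)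

/-- The map `(x; y) ↦ f (g x, y)`. -/
def insertFirst {k l : ℕ} :
    Raw K L (k + 1) M →ₗ[K] Raw K L l L →ₗ[K] MultilinearMap K (fun _ : Fin l ⊕ Fin k => L) M :=
  LinearMap.mk₂ K (fun f g => MultilinearMap.uncurrySum (N := fun _ : Fin l ⊕ Fin k => L)
      (f.curryLeft.compMultilinearMap g))
    (by intros; ext; simp) (by intros; ext; simp) (by intros; ext; simp) (by intros; ext; simp)

/-- The Gerstenhaber-type composition `f ∘ g` of `f` with `k` entries and `g` with `l` entries:
`(f ∘ g)(ξ_1, …, ξ_n) = ∑_σ α(σ, ξ) f(g(ξ_{σ(1)}, …, ξ_{σ(l)}), ξ_{σ(l+1)}, …, ξ_{σ(n)})`, the sum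
being over the `(l, k - 1)`-unshuffles. It is zero if `k = 0` or `n ≠ k + l - 1`. -/
def insertion {l : ℕ} (n : ℕ) : {k : ℕ} → Raw K L k M →ₗ[K] Raw K L l L →ₗ[K] Raw K L n M
  | 0 => 0
  | _ + 1 => insertFirst.compr₂ (shuffleSum ℒ n fun _ => 0)

end Operations

/-! ### Graded algebras, graded maps and symmetric forms -/

section Forms

variable {K : Type*} [Field K] {A : Type*} [Ring A] [Algebra K A] (𝒜 : ℤ → Submodule K A)
  {L : Type*} [AddCommGroup L] [Module K L] [Module A L]
  (ℒ : ℤ → Submodule K L)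
  {M : Type*} [AddCommGroup M] [Module K M]

/-- Graded commutativity, `a b = (-1)^{|a| |b|} b a`. -/
class IsGradedCommutative : Prop where
  mul_comm' : ∀ (i j : ℤ) (a b : A), a ∈ 𝒜 i → b ∈ 𝒜 j → a * b = sgn K (i * j) • (b * a)

/-- `f` has degree `d`. -/
def HasDegree (ℳ : ℤ → Submodule K M) (d : ℤ) {k : ℕ} (f : Raw K L k M) : Prop :=
  ∀ (δ : Fin k → ℤ) (ξ : Fin k → L), (∀ i, ξ i ∈ ℒ (δ i)) → f ξ ∈ ℳ (d + ∑ i, δ i)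

/-- Graded symmetry: the interchange of two adjacent homogeneous arguments `ξ_i, ξ_{i+1}`
produces the sign `(-1)^{|ξ_i| |ξ_{i+1}|}`. -/
def IsGradedSymmetric {k : ℕ} (f : Raw K L k M) : Prop :=
  ∀ (δ : Fin k → ℤ) (ξ : Fin k → L), (∀ i, ξ i ∈ ℒ (δ i)) →
    ∀ i j : Fin k, (i : ℕ) + 1 = j →
      f (fun x => ξ (Equiv.swap i j x)) = sgn K (δ i * δ j) • f ξ

/-- Graded `A`-multilinearity of a map `f` of degree `d`:
`f(ξ_1, …, a ξ_i, …, ξ_k) = (-1)^{|a| (d + |ξ_1| + ⋯ + |ξ_{i-1}|)} a f(ξ_1, …, ξ_k)`. -/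
def IsGradedMultilinear [Module A M] (d : ℤ) {k : ℕ} (f : Raw K L k M) : Prop :=
  ∀ (δ : Fin k → ℤ) (ξ : Fin k → L), (∀ i, ξ i ∈ ℒ (δ i)) →
    ∀ (i : Fin k) (p : ℤ) (a : A), a ∈ 𝒜 p →
      f (Function.update ξ i (a • ξ i)) =
        sgn K (p * (d + ∑ j ∈ Finset.Iio i, δ j)) • a • f ξ

/-- The space of symmetric `k`-forms of degree `d`, i.e. of graded symmetric, graded
`A`-multilinear maps `L^{× k} → A` of degree `d`. -/
def symForms (k : ℕ) (d : ℤ) : Submodule K (Raw K L k A) where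
  carrier := {f | HasDegree ℒ 𝒜 d f ∧ IsGradedSymmetric ℒ f ∧ IsGradedMultilinear 𝒜 ℒ d f}
  zero_mem' := ⟨fun _ _ _ => by simp, fun _ _ _ _ _ _ => by simp,
    fun _ _ _ _ _ _ _ => by simp⟩
  add_mem' := fun hf hg =>
    ⟨fun δ ξ h => Submodule.add_mem _ (hf.1 δ ξ h) (hg.1 δ ξ h),
     fun δ ξ h i j hij => by simp [hf.2.1 δ ξ h i j hij, hg.2.1 δ ξ h i j hij],
     fun δ ξ h i p a ha => by
      simp [hf.2.2 δ ξ h i p a ha, hg.2.2 δ ξ h i p a ha, mul_add]⟩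
  smul_mem' := fun c f hf =>
    ⟨fun δ ξ h => Submodule.smul_mem _ c (hf.1 δ ξ h),
     fun δ ξ h i j hij => by simp [hf.2.1 δ ξ h i j hij, smul_comm c],
     fun δ ξ h i p a ha => by simp [hf.2.2 δ ξ h i p a ha, smul_comm c]⟩

/-- The product of forms, where the second factor has degree `e`:
`(ω ω')(ξ_1, …, ξ_n) = ∑_σ α(σ, ξ) (-1)^{e (|ξ_{σ(1)}| + ⋯ + |ξ_{σ(k)}|)}
  ω(ξ_{σ(1)}, …, ξ_{σ(k)}) ω'(ξ_{σ(k+1)}, …, ξ_{σ(k+l)})`. -/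
def formMul [DirectSum.Decomposition ℒ] {k l : ℕ} (n : ℕ) (e : ℤ) :
    Raw K L k A →ₗ[K] Raw K L l A →ₗ[K] Raw K L n A :=
  (pairing (LinearMap.mul K A)).compr₂ (shuffleSum ℒ n fun ν => e * degL ν)

end Forms

theorem sgn_add (K : Type*) [Field K] (m n : ℤ) : sgn K (m + n) = sgn K m * sgn K n := by
  simp [sgn, Int.negOnePow_add]

theorem sgn_congr (K : Type*) [Field K] {m n : ℤ} (h : Even (m - n)) : sgn K m = sgn K n := by
  simp only [sgn]
  rw [(Int.negOnePow_eq_iff m n).2 h]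

theorem swap_lt_swap_iff {n : ℕ} {i j : Fin n} (hij : (i : ℕ) + 1 = j) {x y : Fin n}
    (h₁ : ¬(x = i ∧ y = j)) (h₂ : ¬(x = j ∧ y = i)) :
    Equiv.swap i j x < Equiv.swap i j y ↔ x < y := by
  simp only [Equiv.swap_apply_def]
  simp only [Fin.ext_iff] at h₁ h₂
  split_ifs <;> simp only [Fin.ext_iff, Fin.lt_def] at * <;> omega

section Sums

variable {K : Type*} [Field K] {L : Type*} [AddCommGroup L] [Module K L]
  {M : Type*} [AddCommGroup M] [Module K M]

/-- Interchange of two consecutive letters that lie in different blocks of an unshuffle. -/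
def Unshuffle.trans {k l n : ℕ} (σ : Unshuffle k l n) {i j : Fin n} (hij : (i : ℕ) + 1 = j)
    (h : (σ.1.symm i).isLeft ≠ (σ.1.symm j).isLeft) : Unshuffle k l n :=
  ⟨σ.1.trans (Equiv.swap i j), by
    refine ⟨fun a b hab => ?_, fun a b hab => ?_⟩
    · refine (swap_lt_swap_iff hij ?_ ?_).2 (σ.2.1 hab)
      · rintro ⟨rfl, rfl⟩; simp at h
      · rintro ⟨rfl, rfl⟩; simp at h
    · refine (swap_lt_swap_iff hij ?_ ?_).2 (σ.2.2 hab)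
      · rintro ⟨rfl, rfl⟩; simp at h
      · rintro ⟨rfl, rfl⟩; simp at h⟩

theorem koszulExp_trans {k l n : ℕ} (σ : Unshuffle k l n) {i j : Fin n} (hij : (i : ℕ) + 1 = j)
    (h : (σ.1.symm i).isLeft ≠ (σ.1.symm j).isLeft) (ν : Fin k ⊕ Fin l → ℤ) :
    Even (koszulExp (σ.trans hij h) ν - koszulExp σ ν - ν (σ.1.symm i) * ν (σ.1.symm j)) := by
  obtain ⟨a₀, b₀, hab⟩ : ∃ a₀ b₀, (σ.1 (Sum.inl a₀) = i ∧ σ.1 (Sum.inr b₀) = j) ∨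
      (σ.1 (Sum.inl a₀) = j ∧ σ.1 (Sum.inr b₀) = i) := by
    rcases hi : σ.1.symm i with a | b <;> rcases hj : σ.1.symm j with a' | b'
    · simp [hi, hj] at h
    · exact ⟨a, b', Or.inl ⟨by rw [← hi]; simp, by rw [← hj]; simp⟩⟩
    · exact ⟨a', b, Or.inr ⟨by rw [← hj]; simp, by rw [← hi]; simp⟩⟩
    · simp [hi, hj] at h
  have key : koszulExp (σ.trans hij h) ν - koszulExp σ ν =
      (if Equiv.swap i j (σ.1 (Sum.inr b₀)) < Equiv.swap i j (σ.1 (Sum.inl a₀)) then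
        ν (Sum.inl a₀) * ν (Sum.inr b₀) else 0) -
      (if σ.1 (Sum.inr b₀) < σ.1 (Sum.inl a₀) then ν (Sum.inl a₀) * ν (Sum.inr b₀) else 0) := by
    have h0 : koszulExp (σ.trans hij h) ν = ∑ a : Fin k, ∑ b : Fin l,
        if Equiv.swap i j (σ.1 (Sum.inr b)) < Equiv.swap i j (σ.1 (Sum.inl a)) then
          ν (Sum.inl a) * ν (Sum.inr b) else 0 := rfl
    rw [h0, koszulExp]
    simp only [← Finset.sum_sub_distrib]
    have hz : ∀ a b, ¬(a = a₀ ∧ b = b₀) →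
        ((if Equiv.swap i j (σ.1 (Sum.inr b)) < Equiv.swap i j (σ.1 (Sum.inl a)) then
          ν (Sum.inl a) * ν (Sum.inr b) else 0) -
        (if σ.1 (Sum.inr b) < σ.1 (Sum.inl a) then ν (Sum.inl a) * ν (Sum.inr b) else 0)) = 0 := by
      intro a b h0
      rw [if_congr (swap_lt_swap_iff hij _ _) rfl rfl, sub_self]
      all_goals
        rintro ⟨h1, h2⟩
        rcases hab with ⟨h3, h4⟩ | ⟨h3, h4⟩
        all_goals first
          | exact h0 ⟨by simpa using σ.1.injective (h2.trans h3.symm),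
              by simpa using σ.1.injective (h1.trans h4.symm)⟩
          | exact absurd (σ.1.injective (h1.trans h3.symm)) (by simp)
    rw [Finset.sum_eq_single a₀
        (fun a _ ha => Finset.sum_eq_zero fun b _ => hz a b fun h => ha h.1) (by simp),
      Finset.sum_eq_single b₀ (fun b _ hb => hz a₀ b fun h => hb h.2) (by simp)]
  rw [key]
  rcases hab with ⟨rfl, rfl⟩ | ⟨rfl, rfl⟩
  · have h1 : σ.1 (Sum.inl a₀) < σ.1 (Sum.inr b₀) := by rw [Fin.lt_def]; omega
    simp [h1, not_lt.2 h1.le]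
  · have h1 : σ.1 (Sum.inr b₀) < σ.1 (Sum.inl a₀) := by rw [Fin.lt_def]; omega
    simp only [Equiv.swap_apply_left, Equiv.swap_apply_right, if_pos h1, if_neg (not_lt.2 h1.le),
      Equiv.symm_apply_apply]
    exact ⟨-(ν (Sum.inl a₀) * ν (Sum.inr b₀)), by ring⟩

theorem koszulExp_swap_inl {k l n : ℕ} (σ : Unshuffle k l n) {a a' : Fin k}
    (h : (σ.1 (Sum.inl a) : ℕ) + 1 = σ.1 (Sum.inl a')) (ν : Fin k ⊕ Fin l → ℤ) :
    koszulExp σ (fun x => ν (Equiv.swap (Sum.inl a) (Sum.inl a') x)) = koszulExp σ ν := by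
  have hs : ∀ c : Fin k, Equiv.swap (Sum.inl a) (Sum.inl a') (Sum.inl c : Fin k ⊕ Fin l) =
      Sum.inl (Equiv.swap a a' c) := fun c => by
    simp only [Equiv.swap_apply_def, Sum.inl.injEq]; split_ifs <;> rfl
  have hs' : ∀ c : Fin l, Equiv.swap (Sum.inl a) (Sum.inl a') (Sum.inr c : Fin k ⊕ Fin l) =
      Sum.inr c := fun c => Equiv.swap_apply_of_ne_of_ne (by simp) (by simp)
  simp only [koszulExp, hs, hs']
  refine Fintype.sum_equiv (Equiv.swap a a') _ _ fun c => Finset.sum_congr rfl fun b _ => ?_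
  refine if_congr ?_ rfl rfl
  have h1 : σ.1 (Sum.inr b) ≠ σ.1 (Sum.inl a) := by simp
  have h2 : σ.1 (Sum.inr b) ≠ σ.1 (Sum.inl a') := by simp
  simp only [Equiv.swap_apply_def]
  simp only [ne_eq, Fin.ext_iff] at h1 h2
  split_ifs <;> simp_all only [Fin.lt_def] <;> omega

theorem koszulExp_swap_inr {k l n : ℕ} (σ : Unshuffle k l n) {b b' : Fin l}
    (h : (σ.1 (Sum.inr b) : ℕ) + 1 = σ.1 (Sum.inr b')) (ν : Fin k ⊕ Fin l → ℤ) :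
    koszulExp σ (fun x => ν (Equiv.swap (Sum.inr b) (Sum.inr b') x)) = koszulExp σ ν := by
  have hs : ∀ c : Fin l, Equiv.swap (Sum.inr b) (Sum.inr b') (Sum.inr c : Fin k ⊕ Fin l) =
      Sum.inr (Equiv.swap b b' c) := fun c => by
    simp only [Equiv.swap_apply_def, Sum.inr.injEq]; split_ifs <;> rfl
  have hs' : ∀ c : Fin k, Equiv.swap (Sum.inr b) (Sum.inr b') (Sum.inl c : Fin k ⊕ Fin l) =
      Sum.inl c := fun c => Equiv.swap_apply_of_ne_of_ne (by simp) (by simp)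
  simp only [koszulExp, hs, hs']
  refine Finset.sum_congr rfl fun a _ => ?_
  refine Fintype.sum_equiv (Equiv.swap b b') _ _ fun c => ?_
  refine if_congr ?_ rfl rfl
  have h1 : σ.1 (Sum.inr b) ≠ σ.1 (Sum.inl a) := by simp
  have h2 : σ.1 (Sum.inr b') ≠ σ.1 (Sum.inl a) := by simp
  simp only [Equiv.swap_apply_def]
  simp only [ne_eq, Fin.ext_iff] at h1 h2
  split_ifs <;> simp_all only [Fin.lt_def] <;> omega

theorem succ_of_apply_succ {k n : ℕ} {f : Fin k → Fin n} (hf : StrictMono f) {a a' : Fin k}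
    (h : (f a : ℕ) + 1 = f a') : (a : ℕ) + 1 = a' := by
  have h1 : a < a' := hf.lt_iff_lt.1 (by rw [Fin.lt_def]; omega)
  by_contra hne
  have h2 : (a : ℕ) + 1 < a' := by rw [Fin.lt_def] at h1; omega
  let m : Fin k := ⟨a + 1, by omega⟩
  have h3 : f a < f m := hf (by rw [Fin.lt_def]; simp [m])
  have h4 : f m < f a' := hf (by rw [Fin.lt_def]; simp [m]; omega)
  rw [Fin.lt_def] at h3 h4
  omega

/-- A signed sum over unshuffles is graded symmetric if the summand is graded symmetric in both
blocks of variables. -/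
theorem isGradedSymmetric_shuffleSum (ℒ : ℤ → Submodule K L) [DirectSum.Decomposition ℒ]
    {k l : ℕ} (n : ℕ) (c : (Fin k ⊕ Fin l → ℤ) → ℤ)
    (T : MultilinearMap K (fun _ : Fin k ⊕ Fin l => L) M)
    (hcl : ∀ ν a a', c (fun x => ν (Equiv.swap (Sum.inl a) (Sum.inl a') x)) = c ν)
    (hcr : ∀ ν b b', c (fun x => ν (Equiv.swap (Sum.inr b) (Sum.inr b') x)) = c ν)
    (hTl : ∀ (ν : Fin k ⊕ Fin l → ℤ) (ξ : Fin k ⊕ Fin l → L), (∀ x, ξ x ∈ ℒ (ν x)) →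
      ∀ a a' : Fin k, (a : ℕ) + 1 = a' →
        T (fun x => ξ (Equiv.swap (Sum.inl a) (Sum.inl a') x)) =
          sgn K (ν (Sum.inl a) * ν (Sum.inl a')) • T ξ)
    (hTr : ∀ (ν : Fin k ⊕ Fin l → ℤ) (ξ : Fin k ⊕ Fin l → L), (∀ x, ξ x ∈ ℒ (ν x)) →
      ∀ b b' : Fin l, (b : ℕ) + 1 = b' →
        T (fun x => ξ (Equiv.swap (Sum.inr b) (Sum.inr b') x)) =
          sgn K (ν (Sum.inr b) * ν (Sum.inr b')) • T ξ) :
    IsGradedSymmetric ℒ (shuffleSum ℒ n c T) := by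
  intro δ ξ hξ i j hij
  rw [shuffleSum_apply ℒ c T δ ξ hξ,
    shuffleSum_apply ℒ c T (fun x => δ (Equiv.swap i j x)) (fun x => ξ (Equiv.swap i j x))
      (fun x => hξ _), Finset.smul_sum]
  classical
  let φ : Unshuffle k l n → Unshuffle k l n := fun σ =>
    if h : (σ.1.symm i).isLeft ≠ (σ.1.symm j).isLeft then σ.trans hij h else σ
  have hφ : Function.Involutive φ := by
    intro σ
    by_cases h : (σ.1.symm i).isLeft ≠ (σ.1.symm j).isLeft
    · have h' : ((σ.trans hij h).1.symm i).isLeft ≠ ((σ.trans hij h).1.symm j).isLeft := by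
        simpa [Unshuffle.trans] using h.symm
      simp only [φ, dif_pos h, dif_pos h']
      apply Subtype.ext
      ext x
      simp [Unshuffle.trans]
    · simp only [φ, dif_neg h]
  refine Fintype.sum_equiv hφ.toPerm _ _ fun σ => ?_
  change _ = sgn K (δ i * δ j) • sgn K (koszulExp (φ σ) (fun x => δ ((φ σ).1 x)) +
    c (fun x => δ ((φ σ).1 x))) • T (fun x => ξ ((φ σ).1 x))
  by_cases h : (σ.1.symm i).isLeft ≠ (σ.1.symm j).isLeft
  · have e1 : φ σ = σ.trans hij h := dif_pos h
    have e2 : ∀ x, (φ σ).1 x = Equiv.swap i j (σ.1 x) := fun x => by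
      rw [e1]; simp [Unshuffle.trans]
    simp only [e2]
    rw [smul_smul, ← sgn_add, e1]
    congr 1
    apply sgn_congr
    have := koszulExp_trans σ hij h (fun x => δ (Equiv.swap i j (σ.1 x)))
    simp only [Equiv.apply_symm_apply, Equiv.swap_apply_left, Equiv.swap_apply_right] at this
    obtain ⟨r, hr⟩ := this
    exact ⟨-r - δ i * δ j, by linear_combination -hr⟩
  · have e1 : φ σ = σ := dif_neg h
    rw [e1]
    rcases hi : σ.1.symm i with a | b <;> rcases hj : σ.1.symm j with a' | b'
    · have hi' : σ.1 (Sum.inl a) = i := by rw [← hi]; simp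
      have hj' : σ.1 (Sum.inl a') = j := by rw [← hj]; simp
      have e3 : ∀ x, Equiv.swap i j (σ.1 x) = σ.1 (Equiv.swap (Sum.inl a) (Sum.inl a') x) := by
        intro x; rw [← hi', ← hj']; exact (σ.1.injective.map_swap _ _ _).symm
      simp only [e3]
      have hs : (σ.1 (Sum.inl a) : ℕ) + 1 = σ.1 (Sum.inl a') := by rw [hi', hj']; exact hij
      rw [koszulExp_swap_inl σ hs (fun x => δ (σ.1 x)), hcl (fun x => δ (σ.1 x)),
        hTl (fun x => δ (σ.1 x)) (fun x => ξ (σ.1 x)) (fun x => hξ _) a a'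
          (succ_of_apply_succ σ.2.1 hs), hi', hj', smul_comm]
    · simp [hi, hj] at h
    · simp [hi, hj] at h
    · have hi' : σ.1 (Sum.inr b) = i := by rw [← hi]; simp
      have hj' : σ.1 (Sum.inr b') = j := by rw [← hj]; simp
      have e3 : ∀ x, Equiv.swap i j (σ.1 x) = σ.1 (Equiv.swap (Sum.inr b) (Sum.inr b') x) := by
        intro x; rw [← hi', ← hj']; exact (σ.1.injective.map_swap _ _ _).symm
      simp only [e3]
      have hs : (σ.1 (Sum.inr b) : ℕ) + 1 = σ.1 (Sum.inr b') := by rw [hi', hj']; exact hij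
      rw [koszulExp_swap_inr σ hs (fun x => δ (σ.1 x)), hcr (fun x => δ (σ.1 x)),
        hTr (fun x => δ (σ.1 x)) (fun x => ξ (σ.1 x)) (fun x => hξ _) b b'
          (succ_of_apply_succ σ.2.2 hs), hi', hj', smul_comm]

end Sums

theorem sum_Iio {n : ℕ} (i : Fin n) (f : Fin n → ℤ) :
    ∑ j ∈ Finset.Iio i, f j = ∑ j, if j < i then f j else 0 := by
  rw [← Finset.sum_filter]
  congr 1
  ext; simp

theorem koszulExp_add_inl {k l n : ℕ} (σ : Unshuffle k l n) (ν : Fin k ⊕ Fin l → ℤ) (x : Fin k)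
    (p : ℤ) : koszulExp σ (Function.update ν (Sum.inl x) (p + ν (Sum.inl x))) = koszulExp σ ν +
      p * ∑ b, if σ.1 (Sum.inr b) < σ.1 (Sum.inl x) then ν (Sum.inr b) else 0 := by
  have h : ∀ a, Function.update ν (Sum.inl x) (p + ν (Sum.inl x)) (Sum.inl a) =
      ν (Sum.inl a) + if a = x then p else 0 := fun a => by
    by_cases h : a = x
    · subst h; simp [add_comm]
    · simp [h]
  have h' : ∀ b, Function.update ν (Sum.inl x) (p + ν (Sum.inl x)) (Sum.inr b) = ν (Sum.inr b) :=
    fun b => by simp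
  simp only [koszulExp, h, h']
  rw [← sub_eq_iff_eq_add']
  simp only [← Finset.sum_sub_distrib]
  rw [Finset.sum_eq_single x _ (by simp), Finset.mul_sum]
  · refine Finset.sum_congr rfl fun b _ => ?_
    simp only [if_true]
    split_ifs <;> ring
  · intro a _ ha
    refine Finset.sum_eq_zero fun b _ => ?_
    simp [ha]

theorem koszulExp_add_inr {k l n : ℕ} (σ : Unshuffle k l n) (ν : Fin k ⊕ Fin l → ℤ) (x : Fin l)
    (p : ℤ) : koszulExp σ (Function.update ν (Sum.inr x) (p + ν (Sum.inr x))) = koszulExp σ ν +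
      p * ∑ a, if σ.1 (Sum.inr x) < σ.1 (Sum.inl a) then ν (Sum.inl a) else 0 := by
  have h : ∀ a, Function.update ν (Sum.inr x) (p + ν (Sum.inr x)) (Sum.inr a) =
      ν (Sum.inr a) + if a = x then p else 0 := fun a => by
    by_cases h : a = x
    · subst h; simp [add_comm]
    · simp [h]
  have h' : ∀ b, Function.update ν (Sum.inr x) (p + ν (Sum.inr x)) (Sum.inl b) = ν (Sum.inl b) :=
    fun b => by simp
  simp only [koszulExp, h, h']
  rw [← sub_eq_iff_eq_add']
  simp only [← Finset.sum_sub_distrib]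
  rw [Finset.mul_sum]
  refine Finset.sum_congr rfl fun a _ => ?_
  rw [Finset.sum_eq_single x _ (by simp)]
  · simp only [if_true]
    split_ifs <;> ring
  · intro b _ hb
    simp [hb]

theorem sum_Iio_inl {k l n : ℕ} (σ : Unshuffle k l n) (δ : Fin n → ℤ) (x : Fin k) :
    ∑ j ∈ Finset.Iio (σ.1 (Sum.inl x)), δ j = ∑ y ∈ Finset.Iio x, δ (σ.1 (Sum.inl y)) +
      ∑ b, if σ.1 (Sum.inr b) < σ.1 (Sum.inl x) then δ (σ.1 (Sum.inr b)) else 0 := by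
  rw [sum_Iio, sum_Iio, ← σ.1.sum_comp, Fintype.sum_sum_type]
  congr 1
  refine Finset.sum_congr rfl fun y _ => if_congr (σ.2.1.lt_iff_lt (a := y) (b := x)) rfl rfl

theorem sum_Iio_inr {k l n : ℕ} (σ : Unshuffle k l n) (δ : Fin n → ℤ) (x : Fin l) :
    ∑ j ∈ Finset.Iio (σ.1 (Sum.inr x)), δ j = ∑ y ∈ Finset.Iio x, δ (σ.1 (Sum.inr y)) +
      ∑ a, if σ.1 (Sum.inl a) < σ.1 (Sum.inr x) then δ (σ.1 (Sum.inl a)) else 0 := by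
  rw [sum_Iio, sum_Iio, ← σ.1.sum_comp, Fintype.sum_sum_type, add_comm]
  congr 1
  refine Finset.sum_congr rfl fun y _ => if_congr (σ.2.2.lt_iff_lt (a := y) (b := x)) rfl rfl

section FormsMulApply

variable {K : Type*} [Field K] {A : Type*} [Ring A] [Algebra K A]
  {L : Type*} [AddCommGroup L] [Module K L]
  (ℒ : ℤ → Submodule K L) [DirectSum.Decomposition ℒ]

theorem formMul_apply {k l n : ℕ} (e : ℤ) (ω : Raw K L k A) (ω' : Raw K L l A)
    (δ : Fin n → ℤ) (ξ : Fin n → L) (hξ : ∀ i, ξ i ∈ ℒ (δ i)) :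
    formMul ℒ n e ω ω' ξ = ∑ σ : Unshuffle k l n,
      sgn K (koszulExp σ (fun x => δ (σ.1 x)) + e * ∑ a : Fin k, δ (σ.1 (Sum.inl a))) •
        (ω (fun a => ξ (σ.1 (Sum.inl a))) * ω' (fun b => ξ (σ.1 (Sum.inr b)))) := by
  simp only [formMul, LinearMap.compr₂_apply]
  rw [shuffleSum_apply ℒ _ _ δ ξ hξ]
  rfl

end FormsMulApply

section FormsMul

variable {K : Type*} [Field K] {A : Type*} [Ring A] [Algebra K A] (𝒜 : ℤ → Submodule K A)
  [GradedAlgebra 𝒜] {L : Type*} [AddCommGroup L] [Module K L] [Module A L]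
  (ℒ : ℤ → Submodule K L) [DirectSum.Decomposition ℒ]

theorem formMul_mem [SetLike.GradedSMul 𝒜 ℒ] [hA : IsGradedCommutative 𝒜] {k l : ℕ} (n : ℕ)
    {d e : ℤ} {ω : Raw K L k A} {ω' : Raw K L l A} (hω : ω ∈ symForms 𝒜 ℒ k d)
    (hω' : ω' ∈ symForms 𝒜 ℒ l e) : formMul ℒ n e ω ω' ∈ symForms 𝒜 ℒ n (d + e) := by
  have hmul : formMul ℒ n e ω ω' =
      shuffleSum ℒ n (fun ν => e * degL ν) (pairing (LinearMap.mul K A) ω ω') := rfl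
  have hpair : ∀ z, pairing (LinearMap.mul K A) ω ω' z =
      ω (fun a => z (Sum.inl a)) * ω' (fun b => z (Sum.inr b)) := fun z => rfl
  refine ⟨fun δ ξ hξ => ?_, ?_, fun δ ξ hξ i p a ha => ?_⟩
  · rw [formMul_apply ℒ e ω ω' δ ξ hξ]
    refine Submodule.sum_mem _ fun σ _ => Submodule.smul_mem _ _ ?_
    have h := SetLike.mul_mem_graded (A := 𝒜)
      (hω.1 (fun a => δ (σ.1 (Sum.inl a))) (fun a => ξ (σ.1 (Sum.inl a))) fun _ => hξ _)
      (hω'.1 (fun b => δ (σ.1 (Sum.inr b))) (fun b => ξ (σ.1 (Sum.inr b))) fun _ => hξ _)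
    have hs : d + e + ∑ i, δ i = d + ∑ a, δ (σ.1 (Sum.inl a)) + (e + ∑ b, δ (σ.1 (Sum.inr b))) := by
      rw [← σ.1.sum_comp, Fintype.sum_sum_type]
      ring
    rw [hs]
    exact h
  · rw [hmul]
    refine isGradedSymmetric_shuffleSum ℒ n _ _ ?_ ?_ ?_ ?_
    · intro ν a a'
      have : ∀ c : Fin k, Equiv.swap (Sum.inl a) (Sum.inl a') (Sum.inl c : Fin k ⊕ Fin l) =
          Sum.inl (Equiv.swap a a' c) := fun c => (Sum.inl_injective.map_swap _ _ _).symm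
      simp only [degL, this]
      rw [Equiv.sum_comp (Equiv.swap a a') fun c => ν (Sum.inl c)]
    · intro ν b b'
      have : ∀ c : Fin k, Equiv.swap (Sum.inr b) (Sum.inr b') (Sum.inl c : Fin k ⊕ Fin l) =
          Sum.inl c := fun c => Equiv.swap_apply_of_ne_of_ne (by simp) (by simp)
      simp only [degL, this]
    · intro ν ξ hξ a a' haa'
      have h1 : ∀ c : Fin k, Equiv.swap (Sum.inl a) (Sum.inl a') (Sum.inl c : Fin k ⊕ Fin l) =
          Sum.inl (Equiv.swap a a' c) := fun c => (Sum.inl_injective.map_swap _ _ _).symm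
      have h2 : ∀ c : Fin l, Equiv.swap (Sum.inl a) (Sum.inl a') (Sum.inr c : Fin k ⊕ Fin l) =
          Sum.inr c := fun c => Equiv.swap_apply_of_ne_of_ne (by simp) (by simp)
      simp only [hpair, h1, h2]
      rw [hω.2.1 (fun c => ν (Sum.inl c)) (fun c => ξ (Sum.inl c)) (fun _ => hξ _) a a' haa',
        smul_mul_assoc]
    · intro ν ξ hξ b b' hbb'
      have h1 : ∀ c : Fin l, Equiv.swap (Sum.inr b) (Sum.inr b') (Sum.inr c : Fin k ⊕ Fin l) =
          Sum.inr (Equiv.swap b b' c) := fun c => (Sum.inr_injective.map_swap _ _ _).symm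
      have h2 : ∀ c : Fin k, Equiv.swap (Sum.inr b) (Sum.inr b') (Sum.inl c : Fin k ⊕ Fin l) =
          Sum.inl c := fun c => Equiv.swap_apply_of_ne_of_ne (by simp) (by simp)
      simp only [hpair, h1, h2]
      rw [hω'.2.1 (fun c => ν (Sum.inr c)) (fun c => ξ (Sum.inr c)) (fun _ => hξ _) b b' hbb',
        mul_smul_comm]
  · have hξ' : ∀ j, Function.update ξ i (a • ξ i) j ∈ ℒ (Function.update δ i (p + δ i) j) := by
      intro j
      by_cases h : j = i
      · subst h
        simpa using SetLike.GradedSMul.smul_mem ha (hξ j)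
      · simpa [h] using hξ j
    rw [formMul_apply ℒ e ω ω' _ _ hξ', formMul_apply ℒ e ω ω' δ ξ hξ, Finset.smul_sum,
      Finset.smul_sum]
    refine Finset.sum_congr rfl fun σ _ => ?_
    obtain ⟨x, rfl⟩ := σ.1.surjective i
    have hK := fun ν => sgn_congr K (m := ν) (n :=
      p * (d + e + ∑ j ∈ Finset.Iio (σ.1 x), δ j) +
      (koszulExp σ (fun x => δ (σ.1 x)) + e * ∑ a : Fin k, δ (σ.1 (Sum.inl a))))
    have hδ : (fun y => Function.update δ (σ.1 x) (p + δ (σ.1 x)) (σ.1 y)) =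
        Function.update (fun y => δ (σ.1 y)) x (p + δ (σ.1 x)) :=
      Function.update_comp_eq_of_injective δ σ.1.injective x _
    rcases x with x | x
    · have h1 : (fun y => Function.update ξ (σ.1 (Sum.inl x)) (a • ξ (σ.1 (Sum.inl x)))
          (σ.1 (Sum.inl y))) = Function.update (fun y => ξ (σ.1 (Sum.inl y))) x
            (a • ξ (σ.1 (Sum.inl x))) :=
        Function.update_comp_eq_of_injective ξ (σ.1.injective.comp Sum.inl_injective) x _
      have h2 : (fun y => Function.update ξ (σ.1 (Sum.inl x)) (a • ξ (σ.1 (Sum.inl x)))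
          (σ.1 (Sum.inr y))) = fun y => ξ (σ.1 (Sum.inr y)) := by
        funext y; simp
      have h3 : ∑ y : Fin k, Function.update δ (σ.1 (Sum.inl x)) (p + δ (σ.1 (Sum.inl x)))
          (σ.1 (Sum.inl y)) = p + ∑ y : Fin k, δ (σ.1 (Sum.inl y)) := by
        have : ∀ y, Function.update δ (σ.1 (Sum.inl x)) (p + δ (σ.1 (Sum.inl x)))
            (σ.1 (Sum.inl y)) = (if y = x then p else 0) + δ (σ.1 (Sum.inl y)) := fun y => by
          by_cases h : y = x
          · subst h; simp
          · simp [h]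
        simp [this, Finset.sum_add_distrib]
      have h4 := hω.2.2 (fun y => δ (σ.1 (Sum.inl y))) (fun y => ξ (σ.1 (Sum.inl y)))
        (fun _ => hξ _) x p a ha
      rw [hδ, h1, h2, h3, h4, koszulExp_add_inl]
      simp only [smul_eq_mul, smul_mul_assoc, mul_smul_comm, smul_smul, mul_assoc, ← sgn_add]
      congr 1
      apply hK
      rw [sum_Iio_inl]
      exact ⟨0, by ring⟩
    · have h1 : (fun y => Function.update ξ (σ.1 (Sum.inr x)) (a • ξ (σ.1 (Sum.inr x)))
          (σ.1 (Sum.inr y))) = Function.update (fun y => ξ (σ.1 (Sum.inr y))) x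
            (a • ξ (σ.1 (Sum.inr x))) :=
        Function.update_comp_eq_of_injective ξ (σ.1.injective.comp Sum.inr_injective) x _
      have h2 : (fun y => Function.update ξ (σ.1 (Sum.inr x)) (a • ξ (σ.1 (Sum.inr x)))
          (σ.1 (Sum.inl y))) = fun y => ξ (σ.1 (Sum.inl y)) := by
        funext y; simp
      have h3 : ∑ y : Fin k, Function.update δ (σ.1 (Sum.inr x)) (p + δ (σ.1 (Sum.inr x)))
          (σ.1 (Sum.inl y)) = ∑ y : Fin k, δ (σ.1 (Sum.inl y)) := by simp
      have h4 := hω'.2.2 (fun y => δ (σ.1 (Sum.inr y))) (fun y => ξ (σ.1 (Sum.inr y)))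
        (fun _ => hξ _) x p a ha
      have h5 := hA.mul_comm' _ p _ a (hω.1 (fun y => δ (σ.1 (Sum.inl y)))
        (fun y => ξ (σ.1 (Sum.inl y))) fun _ => hξ _) ha
      rw [hδ, h1, h2, h3, h4, koszulExp_add_inr]
      simp only [smul_eq_mul, mul_smul_comm, smul_smul, ← sgn_add]
      rw [← mul_assoc, h5]
      simp only [smul_mul_assoc, mul_assoc, smul_smul, ← sgn_add]
      congr 1
      apply hK
      have h6 : ∑ y : Fin k, δ (σ.1 (Sum.inl y)) =
          (∑ a, if σ.1 (Sum.inl a) < σ.1 (Sum.inr x) then δ (σ.1 (Sum.inl a)) else 0) +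
          ∑ a, if σ.1 (Sum.inr x) < σ.1 (Sum.inl a) then δ (σ.1 (Sum.inl a)) else 0 := by
        rw [← Finset.sum_add_distrib]
        refine Finset.sum_congr rfl fun y _ => ?_
        have : σ.1 (Sum.inl y) ≠ σ.1 (Sum.inr x) := by simp
        rcases lt_or_gt_of_ne this with h | h
        · simp [h, not_lt.2 h.le]
        · simp [h, not_lt.2 h.le]
      rw [sum_Iio_inr, h6]
      exact ⟨p * ∑ a, if σ.1 (Sum.inr x) < σ.1 (Sum.inl a) then δ (σ.1 (Sum.inl a)) else 0, by ring⟩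

end FormsMul

/-! ### The algebra of symmetric forms and its derivations -/

section SymAlgebra

variable {K : Type*} [Field K] {A : Type*} [Ring A] [Algebra K A] (𝒜 : ℤ → Submodule K A)
  {L : Type*} [AddCommGroup L] [Module K L] [Module A L] (ℒ : ℤ → Submodule K L)

/-- The bigraded space `Sym_A(L, A)` of symmetric forms, the direct sum over all `(l, e)` of the
spaces of `l`-forms of degree `e`. -/
def Sym : Type _ := ⨁ p : ℕ × ℤ, symForms 𝒜 ℒ p.1 p.2

instance : AddCommGroup (Sym 𝒜 ℒ) :=
  inferInstanceAs (AddCommGroup (⨁ p : ℕ × ℤ, symForms 𝒜 ℒ p.1 p.2))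

instance : Module K (Sym 𝒜 ℒ) :=
  inferInstanceAs (Module K (⨁ p : ℕ × ℤ, symForms 𝒜 ℒ p.1 p.2))

/-- The homogeneous element of `Sym_A(L, A)` given by an `l`-form of degree `e`. -/
def symOf (l : ℕ) (e : ℤ) : symForms 𝒜 ℒ l e →ₗ[K] Sym 𝒜 ℒ :=
  DirectSum.lof K (ℕ × ℤ) (fun p => symForms 𝒜 ℒ p.1 p.2) (l, e)

/-- The component of an element of `Sym_A(L, A)` that is an `l`-form of degree `e`. -/
def symComponent (l : ℕ) (e : ℤ) : Sym 𝒜 ℒ →ₗ[K] symForms 𝒜 ℒ l e :=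
  DirectSum.component K (ℕ × ℤ) (fun p => symForms 𝒜 ℒ p.1 p.2) (l, e)

/-- The linear map out of `Sym_A(L, A)` with given restrictions to the homogeneous parts. -/
def symLift {V : Type*} [AddCommGroup V] [Module K V]
    (φ : ∀ (l : ℕ) (e : ℤ), symForms 𝒜 ℒ l e →ₗ[K] V) : Sym 𝒜 ℒ →ₗ[K] V :=
  DirectSum.toModule K (ℕ × ℤ) V fun p => φ p.1 p.2

theorem symLift_symOf {V : Type*} [AddCommGroup V] [Module K V]
    (φ : ∀ (l : ℕ) (e : ℤ), symForms 𝒜 ℒ l e →ₗ[K] V) (l : ℕ) (e : ℤ) (ω : symForms 𝒜 ℒ l e) :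
    symLift 𝒜 ℒ φ (symOf 𝒜 ℒ l e ω) = φ l e ω :=
  DirectSum.toModule_lof (φ := fun p : ℕ × ℤ => φ p.1 p.2) K (l, e) ω

/-- The product of `Sym_A(L, A)`. -/
def symMul [GradedAlgebra 𝒜] [DirectSum.Decomposition ℒ]
    [SetLike.GradedSMul 𝒜 ℒ] [IsGradedCommutative 𝒜] :
    Sym 𝒜 ℒ →ₗ[K] Sym 𝒜 ℒ →ₗ[K] Sym 𝒜 ℒ :=
  symLift 𝒜 ℒ fun k d => LinearMap.flip <| symLift 𝒜 ℒ fun l e => LinearMap.flip <|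
    LinearMap.mk₂ K
      (fun ω ω' => symOf 𝒜 ℒ (k + l) (d + e)
        ⟨formMul ℒ (k + l) e ω.1 ω'.1, formMul_mem 𝒜 ℒ (k + l) ω.2 ω'.2⟩)
      (fun ω₁ ω₂ ω' => by rw [← map_add]; congr 1; ext; simp)
      (fun c ω ω' => by rw [← map_smul]; congr 1; ext; simp)
      (fun ω ω₁ ω₂ => by rw [← map_add]; congr 1; ext; simp)
      (fun c ω ω' => by rw [← map_smul]; congr 1; ext; simp)

theorem symMul_symOf [GradedAlgebra 𝒜] [DirectSum.Decomposition ℒ]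
    [SetLike.GradedSMul 𝒜 ℒ] [IsGradedCommutative 𝒜] {k l : ℕ} {d e : ℤ}
    (ω : symForms 𝒜 ℒ k d) (ω' : symForms 𝒜 ℒ l e) :
    symMul 𝒜 ℒ (symOf 𝒜 ℒ k d ω) (symOf 𝒜 ℒ l e ω') = symOf 𝒜 ℒ (k + l) (d + e)
      ⟨formMul ℒ (k + l) e ω.1 ω'.1, formMul_mem 𝒜 ℒ (k + l) ω.2 ω'.2⟩ := by
  simp only [symMul, symLift_symOf, LinearMap.flip_apply, LinearMap.mk₂_apply]

/-- The subspace of `Sym_A(L, A)` of `m`-forms of degree `e`, zero if the integer `m` is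
negative. -/
def symPart (m e : ℤ) : Submodule K (Sym 𝒜 ℒ) where
  carrier := {θ | ∀ (l : ℕ) (e' : ℤ), ¬((l : ℤ) = m ∧ e' = e) → symComponent 𝒜 ℒ l e' θ = 0}
  zero_mem' := fun _ _ _ => map_zero _
  add_mem' := fun hx hy l e' h => by rw [map_add, hx l e' h, hy l e' h, add_zero]
  smul_mem' := fun c x hx l e' h => by rw [map_smul, hx l e' h, smul_zero]

variable [GradedAlgebra 𝒜] [DirectSum.Decomposition ℒ]
  [SetLike.GradedSMul 𝒜 ℒ] [IsGradedCommutative 𝒜]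

/-- The derivations of `Sym_A(L, A)` of degree `d` that take `l`-forms to `(l + r)`-forms:
`D(ω ω') = D(ω) ω' + (-1)^{d |ω|} ω D(ω')`. -/
def symDerHom (r d : ℤ) : Submodule K (Module.End K (Sym 𝒜 ℒ)) where
  carrier := {D |
    (∀ (l : ℕ) (e : ℤ) (ω : symForms 𝒜 ℒ l e),
      D (symOf 𝒜 ℒ l e ω) ∈ symPart 𝒜 ℒ (l + r) (d + e)) ∧
    ∀ (l : ℕ) (e : ℤ) (ω : symForms 𝒜 ℒ l e) (θ : Sym 𝒜 ℒ),
      D (symMul 𝒜 ℒ (symOf 𝒜 ℒ l e ω) θ) = symMul 𝒜 ℒ (D (symOf 𝒜 ℒ l e ω)) θ +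
        sgn K (d * e) • symMul 𝒜 ℒ (symOf 𝒜 ℒ l e ω) (D θ)}
  zero_mem' := ⟨fun _ _ _ => Submodule.zero_mem _, fun _ _ _ _ => by simp⟩
  add_mem' := fun hx hy =>
    ⟨fun l e ω => Submodule.add_mem _ (hx.1 l e ω) (hy.1 l e ω),
     fun l e ω θ => by
      simp only [LinearMap.add_apply, hx.2 l e ω θ, hy.2 l e ω θ, map_add, smul_add]
      abel⟩
  smul_mem' := fun c x hx =>
    ⟨fun l e ω => Submodule.smul_mem _ c (hx.1 l e ω),
     fun l e ω θ => by
      simp only [LinearMap.smul_apply, hx.2 l e ω θ, map_smul, smul_add]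
      rw [smul_comm c]⟩

/-- The derivations of `Sym_A(L, A)` of degree `d`: sums of finitely many derivations of degree
`d` each of which shifts the number of entries of forms by a fixed integer. -/
def symDer (d : ℤ) : Submodule K (Module.End K (Sym 𝒜 ℒ)) := ⨆ r : ℤ, symDerHom 𝒜 ℒ r d

end SymAlgebra

/-- The graded commutator of endomorphisms of degrees `d` and `e`. -/
def gradedCommutator {K : Type*} [Field K] {V : Type*} [AddCommGroup V] [Module K V] (d e : ℤ) :
    Module.End K V →ₗ[K] Module.End K V →ₗ[K] Module.End K V :=
  LinearMap.mul K (Module.End K V) - sgn K (d * e) • (LinearMap.mul K (Module.End K V)).flip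

/-! ### Multiderivations -/

section Multiderivations

variable {K : Type*} [Field K] {A : Type*} [Ring A] [Algebra K A] (𝒜 : ℤ → Submodule K A)
  {L : Type*} [AddCommGroup L] [Module K L] [Module A L] (ℒ : ℤ → Submodule K L)

/-- The derivations of the graded algebra `A` of degree `d`. -/
def algDer (d : ℤ) : Submodule K (A →ₗ[K] A) where
  carrier := {D | (∀ (i : ℤ) (a : A), a ∈ 𝒜 i → D a ∈ 𝒜 (d + i)) ∧
    ∀ (i : ℤ) (a b : A), a ∈ 𝒜 i → D (a * b) = D a * b + sgn K (d * i) • (a * D b)}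
  zero_mem' := ⟨fun _ _ _ => Submodule.zero_mem _, fun _ _ _ _ => by simp⟩
  add_mem' := fun hx hy =>
    ⟨fun i a ha => Submodule.add_mem _ (hx.1 i a ha) (hy.1 i a ha),
     fun i a b ha => by
      simp only [LinearMap.add_apply, hx.2 i a b ha, hy.2 i a b ha, add_mul, mul_add, smul_add]
      abel⟩
  smul_mem' := fun c x hx =>
    ⟨fun i a ha => Submodule.smul_mem _ c (hx.1 i a ha),
     fun i a b ha => by
      simp only [LinearMap.smul_apply, hx.2 i a b ha, smul_add, smul_mul_assoc, mul_smul_comm]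
      rw [smul_comm c]⟩

variable (K A L) in
/-- Pairs `(X, σ)` of a `K`-multilinear map `X : L^{× k} → L` and a `K`-multilinear map
`σ : L^{× (k - 1)} → End_K A`. (For `k = 0` the second entry carries no information and is
required to be zero below.) -/
abbrev RawPair (k : ℕ) : Type _ := Raw K L k L × Raw K L (k - 1) (A →ₗ[K] A)

/-- `(X, σ)` is a multiderivation of `L` with `k` entries, of degree `d`. -/
structure IsMultiderivation (k : ℕ) (d : ℤ) (X : RawPair K A L k) : Prop where
  hasDegree : HasDegree ℒ ℒ d X.1
  symmetric : IsGradedSymmetric ℒ X.1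
  symbol_zero : k = 0 → X.2 = 0
  /-- the symbol takes values in the derivations of `A`, and has degree `d` -/
  symbol_der : ∀ (δ : Fin (k - 1) → ℤ) (ξ : Fin (k - 1) → L), (∀ i, ξ i ∈ ℒ (δ i)) →
    X.2 ξ ∈ algDer 𝒜 (d + ∑ i, δ i)
  symbol_symmetric : IsGradedSymmetric ℒ X.2
  symbol_multilinear : IsGradedMultilinear 𝒜 ℒ d X.2
  /-- `X(ξ_1, …, ξ_{k-1}, a ξ_k) = σ(ξ_1, …, ξ_{k-1} | a) ξ_k +
  (-1)^{(d + |ξ_1| + ⋯ + |ξ_{k-1}|) |a|} a X(ξ_1, …, ξ_k)` -/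
  leibniz : ∀ (δ : Fin k → ℤ) (ξ : Fin k → L), (∀ i, ξ i ∈ ℒ (δ i)) →
    ∀ (i : Fin k), (i : ℕ) + 1 = k → ∀ (p : ℤ) (a : A), a ∈ 𝒜 p →
      X.1 (Function.update ξ i (a • ξ i)) =
        X.2 (fun j => ξ (Fin.castLE (Nat.sub_le k 1) j)) a • ξ i +
          sgn K ((d + ∑ j ∈ Finset.Iio i, δ j) * p) • a • X.1 ξ

/-- `Der^k L` in degree `d`. -/
def multiderHom [IsScalarTower K A L] (k : ℕ) (d : ℤ) : Submodule K (RawPair K A L k) where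
  carrier := {X | IsMultiderivation 𝒜 ℒ k d X}
  zero_mem' :=
    { hasDegree := fun _ _ _ => by simp
      symmetric := fun _ _ _ _ _ _ => by simp
      symbol_zero := fun _ => rfl
      symbol_der := fun _ _ _ => Submodule.zero_mem _
      symbol_symmetric := fun _ _ _ _ _ _ => by simp
      symbol_multilinear := fun _ _ _ _ _ _ _ => by simp
      leibniz := fun _ _ _ _ _ _ _ _ => by simp }
  add_mem' := fun {X Y} hX hY =>
    { hasDegree := fun δ ξ h => Submodule.add_mem _ (hX.hasDegree δ ξ h) (hY.hasDegree δ ξ h)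
      symmetric := fun δ ξ h i j hij => by
        simp [hX.symmetric δ ξ h i j hij, hY.symmetric δ ξ h i j hij]
      symbol_zero := fun hk => by simp [hX.symbol_zero hk, hY.symbol_zero hk]
      symbol_der := fun δ ξ h => Submodule.add_mem _ (hX.symbol_der δ ξ h) (hY.symbol_der δ ξ h)
      symbol_symmetric := fun δ ξ h i j hij => by
        simp [hX.symbol_symmetric δ ξ h i j hij, hY.symbol_symmetric δ ξ h i j hij]
      symbol_multilinear := fun δ ξ h i p a ha => by
        simp [hX.symbol_multilinear δ ξ h i p a ha, hY.symbol_multilinear δ ξ h i p a ha]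
      leibniz := fun δ ξ h i hi p a ha => by
        simp only [Prod.fst_add, Prod.snd_add, add_apply, LinearMap.add_apply,
          hX.leibniz δ ξ h i hi p a ha, hY.leibniz δ ξ h i hi p a ha, add_smul, smul_add]
        abel }
  smul_mem' := fun c X hX =>
    { hasDegree := fun δ ξ h => Submodule.smul_mem _ c (hX.hasDegree δ ξ h)
      symmetric := fun δ ξ h i j hij => by
        simp [hX.symmetric δ ξ h i j hij, smul_comm c]
      symbol_zero := fun hk => by simp [hX.symbol_zero hk]
      symbol_der := fun δ ξ h => Submodule.smul_mem _ c (hX.symbol_der δ ξ h)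
      symbol_symmetric := fun δ ξ h i j hij => by
        simp [hX.symbol_symmetric δ ξ h i j hij, smul_comm c]
      symbol_multilinear := fun δ ξ h i p a ha => by
        simp [hX.symbol_multilinear δ ξ h i p a ha, smul_comm c]
      leibniz := fun δ ξ h i hi p a ha => by
        have h1 : ∀ x : L, c • a • x = a • c • x := fun x => by
          rw [← algebraMap_smul A c, ← algebraMap_smul A c, smul_smul, smul_smul,
            Algebra.commutes]
        simp only [Prod.smul_fst, Prod.smul_snd, smul_apply, LinearMap.smul_apply,
          hX.leibniz δ ξ h i hi p a ha, smul_add, smul_assoc, h1, smul_comm c] }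

variable (K A L) in
/-- The space of sums of pairs with varying number of entries. It contains
`Der^• L = ⨁_k Der^k L`. -/
abbrev RawPairs : Type _ := ⨁ k : ℕ, RawPair K A L k

variable (K A L) in
/-- The inclusion of the pairs with `k` entries. -/
def pairOf (k : ℕ) : RawPair K A L k →ₗ[K] RawPairs K A L :=
  DirectSum.lof K ℕ (fun k => RawPair K A L k) k

/-- `Der^• L = ⨁_k Der^k L` in degree `d`. -/
def multider [IsScalarTower K A L] (d : ℤ) : Submodule K (RawPairs K A L) where
  carrier := {X | ∀ k, X k ∈ multiderHom 𝒜 ℒ k d}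
  zero_mem' := fun _ => Submodule.zero_mem _
  add_mem' := fun hx hy k => Submodule.add_mem _ (hx k) (hy k)
  smul_mem' := fun c _ hx k => Submodule.smul_mem _ c (hx k)

theorem pairOf_mem [IsScalarTower K A L] {k : ℕ} {d : ℤ} {X : RawPair K A L k}
    (hX : X ∈ multiderHom 𝒜 ℒ k d) : pairOf K A L k X ∈ multider 𝒜 ℒ d := by
  intro j
  by_cases h : k = j
  · subst h
    simpa [pairOf] using hX
  · rw [pairOf, DirectSum.lof_eq_of, DirectSum.of_eq_of_ne _ _ _ (Ne.symm h)]
    exact Submodule.zero_mem _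

end Multiderivations

section Brackets

variable {K : Type*} [Field K] {A : Type*} [Ring A] [Algebra K A]
  {L : Type*} [AddCommGroup L] [Module K L] (ℒ : ℤ → Submodule K L) [DirectSum.Decomposition ℒ]

/-- For symbols `σ` of degree `d` and `τ` of degree `e`, with `m` and `n` entries, the map
`[σ, τ](ξ_1, …, ξ_N) = ∑ (-1)^{e (|ξ_{s(1)}| + ⋯ + |ξ_{s(m)}|)} α(s, ξ)
  [σ(ξ_{s(1)}, …, ξ_{s(m)}), τ(ξ_{s(m+1)}, …, ξ_{s(m+n)})]`,
the sum being over the `(m, n)`-unshuffles `s`. The bracket in each summand is the graded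
commutator `φ ψ - (-1)^{|φ| |ψ|} ψ φ`, where `φ` has degree `d + |ξ_{s(1)}| + ⋯ + |ξ_{s(m)}|` and
`ψ` has degree `e + |ξ_{s(m+1)}| + ⋯ + |ξ_{s(m+n)}|`. -/
def symbolBracket {m n : ℕ} (N : ℕ) (d e : ℤ) :
    Raw K L m (A →ₗ[K] A) →ₗ[K] Raw K L n (A →ₗ[K] A) →ₗ[K] Raw K L N (A →ₗ[K] A) :=
  LinearMap.mk₂ K
    (fun σ τ =>
      shuffleSum ℒ N (fun ν => e * degL ν) (pairing (LinearMap.llcomp K A A A) σ τ) -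
      shuffleSum ℒ N (fun ν => e * degL ν + (d + degL ν) * (e + degR ν))
        (pairing (LinearMap.llcomp K A A A).flip σ τ))
    (fun σ₁ σ₂ τ => by simp only [map_add, LinearMap.add_apply]; abel)
    (fun c σ τ => by simp only [map_smul, LinearMap.smul_apply]; exact MultilinearMap.ext fun ξ => by simp [smul_sub])
    (fun σ τ₁ τ₂ => by simp only [map_add]; abel)
    (fun c σ τ => by simp only [map_smul]; exact MultilinearMap.ext fun ξ => by simp [smul_sub])

/-- The bracket of the pairs `(X, σ_X)` of degree `d`, with `k` entries, and `(Y, σ_Y)` of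
degree `e`, with `l` entries:
`(X ∘ Y - (-1)^{d e} Y ∘ X, σ_X ∘ Y - (-1)^{d e} σ_Y ∘ X + [σ_X, σ_Y])`. -/
def pairBracket (k l : ℕ) (d e : ℤ) :
    RawPair K A L k →ₗ[K] RawPair K A L l →ₗ[K] RawPair K A L (k + l - 1) :=
  LinearMap.mk₂ K
    (fun X Y =>
      (insertion ℒ (k + l - 1) X.1 Y.1 - sgn K (d * e) • insertion ℒ (k + l - 1) Y.1 X.1,
       insertion ℒ (k + l - 1 - 1) X.2 Y.1 - sgn K (d * e) • insertion ℒ (k + l - 1 - 1) Y.2 X.1 +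
        symbolBracket ℒ (k + l - 1 - 1) d e X.2 Y.2))
    (fun X₁ X₂ Y => by
      simp only [Prod.fst_add, Prod.snd_add, map_add, LinearMap.add_apply, smul_add, Prod.mk_add_mk,
        Prod.mk.injEq]
      constructor <;> abel)
    (fun c X Y => by
      simp only [Prod.smul_fst, Prod.smul_snd, map_smul, LinearMap.smul_apply, Prod.smul_mk]
      refine Prod.ext ?_ ?_ <;> refine MultilinearMap.ext fun ξ => ?_ <;>
        simp [smul_sub, smul_comm c])
    (fun X Y₁ Y₂ => by
      simp only [Prod.fst_add, Prod.snd_add, map_add, LinearMap.add_apply, smul_add, Prod.mk_add_mk,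
        Prod.mk.injEq]
      constructor <;> abel)
    (fun c X Y => by
      simp only [Prod.smul_fst, Prod.smul_snd, map_smul, LinearMap.smul_apply, Prod.smul_mk]
      refine Prod.ext ?_ ?_ <;> refine MultilinearMap.ext fun ξ => ?_ <;>
        simp [smul_sub, smul_comm c])

variable (A) in
/-- The bilinear extension of the bracket of pairs of degrees `d` and `e` to sums of pairs with
varying number of entries. -/
def multiderBracket (d e : ℤ) :
    RawPairs K A L →ₗ[K] RawPairs K A L →ₗ[K] RawPairs K A L :=
  DirectSum.toModule K ℕ _ fun k => LinearMap.flip <|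
    DirectSum.toModule K ℕ _ fun l => LinearMap.flip <|
      (pairBracket ℒ k l d e).compr₂ (pairOf K A L (k + l - 1))

theorem multiderBracket_pairOf {k l : ℕ} (d e : ℤ) (X : RawPair K A L k) (Y : RawPair K A L l) :
    multiderBracket A ℒ d e (pairOf K A L k X) (pairOf K A L l Y) =
      pairOf K A L (k + l - 1) (pairBracket ℒ k l d e X Y) := by
  simp [multiderBracket, pairOf, DirectSum.toModule_lof]

/-- For a pair `(X, σ)` of degree `d` with `k` entries and a map `ω : L^{× l} → A` of degree `e`,
the map `σ ∘ ω - (-1)^{d e} ω ∘ X` with `n` entries, where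
`(σ ∘ ω)(ξ_1, …, ξ_n) = ∑ (-1)^{e (|ξ_{s(1)}| + ⋯ + |ξ_{s(k-1)}|)} α(s, ξ)
  σ(ξ_{s(1)}, …, ξ_{s(k-1)} | ω(ξ_{s(k)}, …, ξ_{s(n)}))`,
the sum being over the `(k - 1, l)`-unshuffles `s`. (On multiderivations it vanishes unless
`n = l + k - 1`.) -/
def etaForm {k l : ℕ} (n : ℕ) (d e : ℤ) (X : RawPair K A L k) (ω : Raw K L l A) :
    Raw K L n A :=
  shuffleSum ℒ n (fun ν => e * degL ν)
      (pairing (LinearMap.id : (A →ₗ[K] A) →ₗ[K] A →ₗ[K] A) X.2 ω) -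
    sgn K (d * e) • insertion ℒ n ω X.1

end Brackets

/-- A graded Lie algebra, given by the subspaces `𝔤 i` of elements of degree `i` of a vector space
`V` and bilinear maps `[-, -]_{i j}`, of which only the restrictions to `𝔤 i × 𝔤 j` matter. -/
structure IsGradedLieAlgebra {K : Type*} [Field K] {V : Type*} [AddCommGroup V] [Module K V]
    (𝔤 : ℤ → Submodule K V) (br : ℤ → ℤ → V →ₗ[K] V →ₗ[K] V) : Prop where
  bracket_mem : ∀ {i j : ℤ} {x y : V}, x ∈ 𝔤 i → y ∈ 𝔤 j → br i j x y ∈ 𝔤 (i + j)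
  skew : ∀ {i j : ℤ} {x y : V}, x ∈ 𝔤 i → y ∈ 𝔤 j → br i j x y = -(sgn K (i * j) • br j i y x)
  jacobi : ∀ {i j k : ℤ} {x y z : V}, x ∈ 𝔤 i → y ∈ 𝔤 j → z ∈ 𝔤 k →
    br i (j + k) x (br j k y z) =
      br (i + j) k (br i j x y) z + sgn K (i * j) • br j (i + k) y (br i k x z)

/-- A morphism `η : 𝔤 → 𝔥` of graded Lie algebras: linear maps `η_d : 𝔤 d → 𝔥 d` compatible with
the brackets. -/
def IsGradedLieMorphism {K : Type*} [Field K] {V : Type*} [AddCommGroup V] [Module K V]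
    {W : Type*} [AddCommGroup W] [Module K W]
    {𝔤 : ℤ → Submodule K V} {brV : ℤ → ℤ → V →ₗ[K] V →ₗ[K] V} (h𝔤 : IsGradedLieAlgebra 𝔤 brV)
    {𝔥 : ℤ → Submodule K W} {brW : ℤ → ℤ → W →ₗ[K] W →ₗ[K] W} (h𝔥 : IsGradedLieAlgebra 𝔥 brW)
    (η : ∀ d : ℤ, 𝔤 d →ₗ[K] 𝔥 d) : Prop :=
  ∀ (i j : ℤ) (x : 𝔤 i) (y : 𝔤 j),
    η (i + j) ⟨brV i j x y, h𝔤.bracket_mem x.2 y.2⟩ =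
      ⟨brW i j (η i x) (η j y), h𝔥.bracket_mem (η i x).2 (η j y).2⟩


end GradedMultider

end

open scoped DirectSum

noncomputable section

namespace GradedMultider

set_option linter.unusedSimpArgs false
set_option linter.unusedSectionVars false
set_option linter.unnecessarySeqFocus false

/-! ### Functions of words of homogeneous elements -/

/-! On homogeneous arguments a multilinear map is a function of words of homogeneous letters, and a
signed sum over unshuffles is a sum over the splittings of a word into two complementary subwords
(`shuf`), which has a recursion on the first letter. Consequently the product `wmul` and the
insertion `wins` obey a Leibniz rule for contraction with a letter (`contract_wmul`,
`contract_wins`): the letter goes into one of the two maps, whose degree then grows by that of the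
letter. Contracted maps satisfy the same hypotheses as the original ones. So each identity is proved
by induction on the word, with degrees and maps generalized: on the empty word it is an identity
between values, and on `x :: w` both sides are expanded and the induction hypothesis is applied to
the contracted maps. What is left is a comparison of signs.

Two such identities carry the Lie structure. Insertion is a derivation of products (`wins_wmul`),
and its associator is graded symmetric in the two inserted maps (`wins_assoc_symm`), that is,
insertion is a pre-Lie operation. The second gives the Jacobi identity for the maps `X`; both
together, with associativity of composition, show that the action `wordEta` on forms is a
representation (`wordEta_bracket`). The action on constants recovers the symbol, so the Jacobi
identity for symbols is that of commutators of operators.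

The same devices show that brackets of multiderivations are multiderivations
(`IsMultiderWord.bracket`). The action preserves graded `A`-multilinear functions
(`IsMultiderWord.isMultilinearWord_wordEta`); applied to constants this makes the symbol of a
bracket `A`-multilinear. Elements of `L` are multiderivations without entries, and the bracket with
them is contraction; so the Leibniz rule of a bracket follows from the Jacobi identity with third
argument `a x`.

If `L` is projective and finitely generated, it has homogeneous generators `b i` and `1`-forms `ε i`
that give coefficients. Euler's identity expresses `l ω`, for an `l`-form `ω`, as a signed sum of
the products of `ε i` with the contraction of `ω` by `b i`. In characteristic zero, a derivation
that shifts form degree by a fixed amount is thus zero if it vanishes on `A` and on all `ε i`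
(`DualBasis.symDerHom_eq_zero`). For injectivity of `η`, constants detect the symbol and the `ε i`
detect the coefficients of `X`. For surjectivity, the values of `D` on `A` define a symbol `σ`; on
`1`-forms the remainder `σ ∘ ω - D ω` is compatible with products by elements of `A`, hence up to
sign is the insertion into `ω` of the sum of the remainders of `ε i` times `b i`. This sum and `σ`
form a multiderivation whose action agrees with `D` on `A` and on `1`-forms, and therefore
everywhere. -/

/-- Comparing exponents in `ZMod 2` makes parity questions polynomial identities in characteristic
two. -/
theorem sgn_congr_mod (K : Type*) [Field K] {m n : ℤ} (h : (m : ZMod 2) = n) :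
    sgn K m = sgn K n := by
  apply sgn_congr
  rwa [← sub_eq_zero, ← Int.cast_sub, ZMod.intCast_eq_zero_iff_even] at h

@[simp] theorem sgn_zero (K : Type*) [Field K] : sgn K 0 = 1 := by simp [sgn]

/-- Once exponents are split by additivity, this is the relation that settles the recurrent
comparisons of coefficients (`match_scalars` followed by `grind`). -/
theorem sgn_mul_self (K : Type*) [Field K] (n : ℤ) : sgn K n * sgn K n = 1 := by
  rw [← sgn_add, ← sgn_zero K]
  exact sgn_congr K ⟨n, by ring⟩

theorem sgn_smul_sgn_smul {K : Type*} [Field K] {M : Type*} [AddCommGroup M] [Module K M] (n : ℤ)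
    (x : M) : sgn K n • sgn K n • x = x := by
  rw [smul_smul, sgn_mul_self, one_smul]

section Words

variable {K : Type*} [Field K] {L : Type*} [AddCommGroup L] [Module K L] (ℒ : ℤ → Submodule K L)
  {M : Type*} [AddCommGroup M] [Module K M] {M₁ : Type*} [AddCommGroup M₁] [Module K M₁]
  {M₂ : Type*} [AddCommGroup M₂] [Module K M₂] {M₃ : Type*} [AddCommGroup M₃] [Module K M₃]
  {M₁₂ : Type*} [AddCommGroup M₁₂] [Module K M₁₂] {M₂₃ : Type*} [AddCommGroup M₂₃] [Module K M₂₃]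

/-- Homogeneous elements together with their degree. -/
abbrev Letter : Type _ := Σ i : ℤ, ℒ i

/-- Functions of words of homogeneous elements. -/
abbrev WordFun (M : Type*) : Type _ := List (Letter ℒ) → M

variable {ℒ}

/-- The total degree of a word. -/
def wdeg : List (Letter ℒ) → ℤ
  | [] => 0
  | x :: w => x.1 + wdeg w

@[simp] theorem wdeg_nil : wdeg ([] : List (Letter ℒ)) = 0 := rfl

@[simp] theorem wdeg_cons (x : Letter ℒ) (w : List (Letter ℒ)) : wdeg (x :: w) = x.1 + wdeg w :=
  rfl

theorem wdeg_append (v w : List (Letter ℒ)) : wdeg (v ++ w) = wdeg v + wdeg w := by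
  induction v with
  | nil => simp
  | cons x v ih => simp [ih, add_assoc]

/-- Insertion of a letter in the first place. -/
def contract (x : Letter ℒ) : WordFun ℒ M →ₗ[K] WordFun ℒ M := LinearMap.funLeft K M (x :: ·)

@[simp] theorem contract_apply (x : Letter ℒ) (f : WordFun ℒ M) (w : List (Letter ℒ)) :
    contract x f w = f (x :: w) := rfl

/-- The sum over all ways to split a word into two complementary subwords, with Koszul signs. -/
def shuf : (List (Letter ℒ) → List (Letter ℒ) → M) → WordFun ℒ M
  | F, [] => F [] []
  | F, x :: w => shuf (fun p q => F (x :: p) q) w +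
      -- A first letter that joins the second subword has to pass all of `p`; in the first subword
      -- it passes nothing.
      shuf (fun p q => sgn K (x.1 * wdeg p) • F p (x :: q)) w

theorem shuf_cons (F : List (Letter ℒ) → List (Letter ℒ) → M) (x : Letter ℒ)
    (w : List (Letter ℒ)) : shuf F (x :: w) = shuf (fun p q => F (x :: p) q) w +
      shuf (fun p q => sgn K (x.1 * wdeg p) • F p (x :: q)) w := rfl

theorem shuf_add (F G : List (Letter ℒ) → List (Letter ℒ) → M) (w : List (Letter ℒ)) :
    shuf (fun p q => F p q + G p q) w = shuf F w + shuf G w := by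
  induction w generalizing F G with
  | nil => rfl
  | cons x w ih =>
    simp only [shuf_cons, smul_add, ih]
    abel

theorem shuf_map (φ : M →ₗ[K] M₁) (F : List (Letter ℒ) → List (Letter ℒ) → M)
    (w : List (Letter ℒ)) : shuf (fun p q => φ (F p q)) w = φ (shuf F w) := by
  induction w generalizing F with
  | nil => rfl
  | cons x w ih => simp only [shuf_cons, ← map_smul, ih, map_add]

theorem shuf_smul (c : K) (F : List (Letter ℒ) → List (Letter ℒ) → M) (w : List (Letter ℒ)) :
    shuf (fun p q => c • F p q) w = c • shuf F w :=
  shuf_map (c • LinearMap.id) F w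

theorem shuf_zero (w : List (Letter ℒ)) : shuf (fun _ _ => (0 : M)) w = 0 := by
  simpa using shuf_smul (0 : K) (fun _ _ => (0 : M)) w

theorem shuf_sub (F G : List (Letter ℒ) → List (Letter ℒ) → M) (w : List (Letter ℒ)) :
    shuf (fun p q => F p q - G p q) w = shuf F w - shuf G w := by
  have h := shuf_add F (fun p q => (-1 : K) • G p q) w
  rw [shuf_smul] at h
  simpa [sub_eq_add_neg] using h

/-- `shuf F` takes values in a graded subspace if `F` does, and depends only on the values of `F`
at subwords whose degrees and lengths add up. -/
theorem shuf_mem (ℳ : ℤ → Submodule K M) (c : ℤ) (F : List (Letter ℒ) → List (Letter ℒ) → M)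
    (w : List (Letter ℒ)) (hF : ∀ p q, F p q ∈ ℳ (c + wdeg p + wdeg q)) :
    shuf F w ∈ ℳ (c + wdeg w) := by
  induction w generalizing F c with
  | nil => simpa [shuf] using hF [] []
  | cons x w ih =>
    have e : c + wdeg (x :: w) = c + x.1 + wdeg w := by simp [add_assoc]
    rw [e]
    refine Submodule.add_mem _ (ih _ _ fun p q => ?_) (ih _ _ fun p q => Submodule.smul_mem _ _ ?_)
    · convert hF (x :: p) q using 2
      simp [add_assoc]
    · convert hF p (x :: q) using 2
      simp only [wdeg_cons]; ring

/-- Only pairs of subwords with complementary lengths occur, so this yields the supports of products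
and insertions. -/
theorem shuf_eq_zero (F : List (Letter ℒ) → List (Letter ℒ) → M) (w : List (Letter ℒ))
    (hF : ∀ p q, p.length + q.length = w.length → F p q = 0) : shuf F w = 0 := by
  induction w generalizing F with
  | nil => exact hF [] [] rfl
  | cons x w ih =>
    rw [shuf_cons, ih, ih, add_zero]
    · intro p q h
      rw [hF, smul_zero]
      simp only [List.length_cons]; omega
    · intro p q h
      apply hF
      simp only [List.length_cons]; omega

/-- Exchanging the two subwords moves every letter of one past every letter of the other. In the
recursion the two summands trade places. -/
theorem shuf_comm (F : List (Letter ℒ) → List (Letter ℒ) → M) (w : List (Letter ℒ)) :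
    shuf F w = shuf (fun p q => sgn K (wdeg p * wdeg q) • F q p) w := by
  induction w generalizing F with
  | nil => simp [shuf]
  | cons x w ih =>
    rw [shuf_cons, shuf_cons, add_comm, ih, ih (fun p q => F (x :: p) q)]
    congr 2 <;> funext p q <;> simp only [smul_smul, ← sgn_add, wdeg_cons] <;> congr 1 <;>
      apply sgn_congr_mod <;> push_cast <;> grind

/-- The product of functions of words along a bilinear map, where `e` is the degree of the second
factor. -/
def wmul (B : M₁ →ₗ[K] M₂ →ₗ[K] M) (e : ℤ) : WordFun ℒ M₁ →ₗ[K] WordFun ℒ M₂ →ₗ[K] WordFun ℒ M :=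
  LinearMap.mk₂ K (fun f g => shuf fun p q => sgn K (e * wdeg p) • B (f p) (g q))
    (fun f f' g => funext fun w => by simp [shuf_add])
    (fun c f g => funext fun w => by simp [smul_comm _ c, shuf_smul])
    (fun f g g' => funext fun w => by simp [shuf_add])
    (fun c f g => funext fun w => by simp [smul_comm _ c, shuf_smul])

theorem wmul_apply (B : M₁ →ₗ[K] M₂ →ₗ[K] M) (e : ℤ) (f : WordFun ℒ M₁) (g : WordFun ℒ M₂)
    (w : List (Letter ℒ)) :
    wmul B e f g w = shuf (fun p q => sgn K (e * wdeg p) • B (f p) (g q)) w := rfl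

@[simp] theorem wmul_nil (B : M₁ →ₗ[K] M₂ →ₗ[K] M) (e : ℤ) (f : WordFun ℒ M₁)
    (g : WordFun ℒ M₂) : wmul B e f g [] = B (f []) (g []) := by
  simp [wmul_apply, shuf]

/-- This recursion drives every induction about products: the new letter goes either into `f`,
passing `g` of degree `e`, or into `g`, whose degree becomes `e + x.1`. -/
theorem contract_wmul (B : M₁ →ₗ[K] M₂ →ₗ[K] M) (e : ℤ) (f : WordFun ℒ M₁) (g : WordFun ℒ M₂)
    (x : Letter ℒ) : contract x (wmul B e f g) =
      sgn K (e * x.1) • wmul B e (contract x f) g + wmul B (e + x.1) f (contract x g) := by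
  funext w
  simp only [contract_apply, wmul_apply, Pi.add_apply, Pi.smul_apply, shuf_cons, ← shuf_smul,
    smul_smul, ← sgn_add, wdeg_cons]
  congr 3 <;> funext p q
  · rw [mul_add]
  · rw [add_mul, add_comm]

theorem wmul_cons (B : M₁ →ₗ[K] M₂ →ₗ[K] M) (e : ℤ) (f : WordFun ℒ M₁) (g : WordFun ℒ M₂)
    (x : Letter ℒ) (w : List (Letter ℒ)) : wmul B e f g (x :: w) =
      sgn K (e * x.1) • wmul B e (contract x f) g w + wmul B (e + x.1) f (contract x g) w :=
  congrFun (contract_wmul B e f g x) w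

/-- Contraction distributes over the three factors in the same way for both bracketings, so the
induction uses `hB` only on the empty word. -/
theorem wmul_assoc {B : M₁₂ →ₗ[K] M₃ →ₗ[K] M} {B' : M₁ →ₗ[K] M₂ →ₗ[K] M₁₂}
    {C : M₁ →ₗ[K] M₂₃ →ₗ[K] M} {C' : M₂ →ₗ[K] M₃ →ₗ[K] M₂₃}
    (hB : ∀ x y z, B (B' x y) z = C x (C' y z)) (d e : ℤ) (f : WordFun ℒ M₁) (g : WordFun ℒ M₂)
    (h : WordFun ℒ M₃) : wmul B e (wmul B' d f g) h = wmul C (d + e) f (wmul C' e g h) := by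
  funext w
  induction w generalizing d e f g h with
  | nil => simp [hB]
  | cons x w ih =>
    simp only [wmul_cons, contract_wmul, map_add, map_smul, LinearMap.add_apply,
      LinearMap.smul_apply, Pi.add_apply, Pi.smul_apply, ih, smul_add, smul_smul, ← sgn_add,
      add_right_comm d x.1 e, add_assoc]
    congr 4
    ring

/-- The functions of degree `d`. -/
def HasWordDegree (ℳ : ℤ → Submodule K M) (d : ℤ) (f : WordFun ℒ M) : Prop :=
  ∀ w, f w ∈ ℳ (d + wdeg w)

theorem HasWordDegree.contract {ℳ : ℤ → Submodule K M} {d : ℤ} {f : WordFun ℒ M}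
    (hf : HasWordDegree ℳ d f) (x : Letter ℒ) : HasWordDegree ℳ (d + x.1) (contract x f) := by
  intro w
  simpa [add_assoc] using hf (x :: w)

theorem HasWordDegree.add {ℳ : ℤ → Submodule K M} {d : ℤ} {f g : WordFun ℒ M}
    (hf : HasWordDegree ℳ d f) (hg : HasWordDegree ℳ d g) : HasWordDegree ℳ d (f + g) :=
  fun w => Submodule.add_mem _ (hf w) (hg w)

theorem HasWordDegree.sub {ℳ : ℤ → Submodule K M} {d : ℤ} {f g : WordFun ℒ M}
    (hf : HasWordDegree ℳ d f) (hg : HasWordDegree ℳ d g) : HasWordDegree ℳ d (f - g) :=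
  fun w => Submodule.sub_mem _ (hf w) (hg w)

theorem HasWordDegree.smul {ℳ : ℤ → Submodule K M} {d : ℤ} {f : WordFun ℒ M} (c : K)
    (hf : HasWordDegree ℳ d f) : HasWordDegree ℳ d (c • f) :=
  fun w => Submodule.smul_mem _ c (hf w)

theorem HasWordDegree.wmul {ℳ : ℤ → Submodule K M} {ℳ₁ : ℤ → Submodule K M₁}
    {ℳ₂ : ℤ → Submodule K M₂} {B : M₁ →ₗ[K] M₂ →ₗ[K] M}
    (hB : ∀ i j x y, x ∈ ℳ₁ i → y ∈ ℳ₂ j → B x y ∈ ℳ (i + j)) {d e : ℤ} {f : WordFun ℒ M₁}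
    {g : WordFun ℒ M₂} (hf : HasWordDegree ℳ₁ d f) (hg : HasWordDegree ℳ₂ e g) :
    HasWordDegree ℳ (d + e) (wmul B e f g) := by
  intro w
  refine shuf_mem _ _ _ _ fun p q => Submodule.smul_mem _ _ ?_
  convert hB _ _ _ _ (hf p) (hg q) using 2
  ring

/-! ### Multilinear graded symmetric functions of words -/

/-- Multilinear, graded symmetric functions of words. -/
structure IsSymWord (f : WordFun ℒ M) : Prop where
  add : ∀ (v : List (Letter ℒ)) (i : ℤ) (x y : ℒ i) (w : List (Letter ℒ)),
    f (v ++ ⟨i, x + y⟩ :: w) = f (v ++ ⟨i, x⟩ :: w) + f (v ++ ⟨i, y⟩ :: w)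
  smul : ∀ (v : List (Letter ℒ)) (i : ℤ) (c : K) (x : ℒ i) (w : List (Letter ℒ)),
    f (v ++ ⟨i, c • x⟩ :: w) = c • f (v ++ ⟨i, x⟩ :: w)
  swap : ∀ (v : List (Letter ℒ)) (x y : Letter ℒ) (w : List (Letter ℒ)),
    f (v ++ y :: x :: w) = sgn K (x.1 * y.1) • f (v ++ x :: y :: w)

namespace IsSymWord

variable {f g : WordFun ℒ M}

theorem contract (hf : IsSymWord f) (x : Letter ℒ) : IsSymWord (contract x f) where
  add v i y z w := hf.add (x :: v) i y z w
  smul v i c y w := hf.smul (x :: v) i c y w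
  swap v y z w := hf.swap (x :: v) y z w

theorem zero : IsSymWord (0 : WordFun ℒ M) := by constructor <;> simp

theorem add' (hf : IsSymWord f) (hg : IsSymWord g) : IsSymWord (f + g) where
  add v i x y w := by simp only [Pi.add_apply, hf.add, hg.add]; abel
  smul v i c x w := by simp only [Pi.add_apply, hf.smul, hg.smul, smul_add]
  swap v x y w := by simp only [Pi.add_apply, hf.swap v x y, hg.swap v x y, smul_add]

theorem smul' (c : K) (hf : IsSymWord f) : IsSymWord (c • f) where
  add v i x y w := by simp only [Pi.smul_apply, hf.add, smul_add]
  smul v i b x w := by simp only [Pi.smul_apply, hf.smul, smul_comm c]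
  swap v x y w := by simp only [Pi.smul_apply, hf.swap v x y, smul_comm c]

theorem sub (hf : IsSymWord f) (hg : IsSymWord g) : IsSymWord (f - g) := by
  have := hf.add' (hg.smul' (-1 : K))
  simpa [sub_eq_add_neg] using this

theorem contract_add (hf : IsSymWord f) (i : ℤ) (x y : ℒ i) :
    GradedMultider.contract ⟨i, x + y⟩ f =
      GradedMultider.contract ⟨i, x⟩ f + GradedMultider.contract ⟨i, y⟩ f :=
  funext fun w => hf.add [] i x y w

theorem contract_smul (hf : IsSymWord f) (i : ℤ) (c : K) (x : ℒ i) :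
    GradedMultider.contract ⟨i, c • x⟩ f = c • GradedMultider.contract ⟨i, x⟩ f :=
  funext fun w => hf.smul [] i c x w

theorem contract_swap (hf : IsSymWord f) (x y : Letter ℒ) :
    GradedMultider.contract x (GradedMultider.contract y f) =
      sgn K (x.1 * y.1) • GradedMultider.contract y (GradedMultider.contract x f) :=
  funext fun w => hf.swap [] x y w

end IsSymWord

/-- The function with value `x` at the empty word and zero elsewhere. -/
def unitWord {M : Type*} [AddCommGroup M] (x : M) : WordFun ℒ M
  | [] => x
  | _ :: _ => 0

@[simp] theorem unitWord_nil {M : Type*} [AddCommGroup M] (x : M) :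
    (unitWord x : WordFun ℒ M) [] = x := rfl

@[simp] theorem unitWord_cons {M : Type*} [AddCommGroup M] (x : M) (y : Letter ℒ)
    (w : List (Letter ℒ)) :
    (unitWord x : WordFun ℒ M) (y :: w) = 0 := rfl

@[simp] theorem contract_unitWord (x : M) (y : Letter ℒ) :
    contract y (unitWord x : WordFun ℒ M) = 0 := rfl

theorem IsSymWord.unitWord (x : M) : IsSymWord (unitWord x : WordFun ℒ M) where
  add v i y z w := by cases v <;> simp
  smul v i c y w := by cases v <;> simp
  swap v y z w := by cases v <;> simp

theorem HasWordDegree.unitWord {ℳ : ℤ → Submodule K M} {d : ℤ} {x : M} (hx : x ∈ ℳ d) :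
    HasWordDegree ℳ d (unitWord x : WordFun ℒ M) := by
  intro w
  cases w with
  | nil => simpa using hx
  | cons y w => exact Submodule.zero_mem _

/-- Induction on the prefix brings the place in question to the front, where the contraction formula
reduces each property to that of the factors. -/
theorem IsSymWord.wmul (B : M₁ →ₗ[K] M₂ →ₗ[K] M) (e : ℤ) {f : WordFun ℒ M₁} {g : WordFun ℒ M₂}
    (hf : IsSymWord f) (hg : IsSymWord g) : IsSymWord (wmul B e f g) where
  add v i x y w := by
    induction v generalizing e f g with
    | nil =>
      simp only [List.nil_append, wmul_cons, hf.contract_add, hg.contract_add, map_add,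
        LinearMap.add_apply, Pi.add_apply, smul_add]
      abel
    | cons z v ih =>
      simp only [List.cons_append, wmul_cons, ih e (hf.contract z) hg,
        ih (e + z.1) hf (hg.contract z), smul_add]
      abel
  smul v i c x w := by
    induction v generalizing e f g with
    | nil =>
      simp only [List.nil_append, wmul_cons, hf.contract_smul, hg.contract_smul, map_smul,
        LinearMap.smul_apply, Pi.smul_apply, smul_add, smul_comm c]
    | cons z v ih =>
      simp only [List.cons_append, wmul_cons, ih e (hf.contract z) hg,
        ih (e + z.1) hf (hg.contract z), smul_add, smul_comm c]
  swap v x y w := by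
    induction v generalizing e f g with
    | nil =>
      simp only [List.nil_append, wmul_cons, hf.contract_swap x y,
        hg.contract_swap x y, map_smul, LinearMap.smul_apply, Pi.smul_apply, add_right_comm e y.1 x.1]
      match_scalars <;>
      simp only [mul_one, mul_add, add_mul, sgn_add, mul_comm (G := ℤ)] <;>
      grind [sgn_mul_self]
    | cons z v ih =>
      simp only [List.cons_append, wmul_cons, ih e (hf.contract z) hg,
        ih (e + z.1) hf (hg.contract z), smul_add, smul_comm (sgn K (x.1 * y.1))]

end Words

/-! ### Insertion of one function of words into another -/

section Insertion

variable {K : Type*} [Field K] {L : Type*} [AddCommGroup L] [Module K L] {ℒ : ℤ → Submodule K L}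
  [DirectSum.Decomposition ℒ]
  {M : Type*} [AddCommGroup M] [Module K M] {M₁ : Type*} [AddCommGroup M₁] [Module K M₁]
  {M₂ : Type*} [AddCommGroup M₂] [Module K M₂]

variable (ℒ) in
/-- The component of degree `e` of an element of `L`, as a letter. -/
def letter (e : ℤ) (x : L) : Letter ℒ := ⟨e, DirectSum.decompose ℒ x e⟩

@[simp] theorem letter_fst (e : ℤ) (x : L) : (letter ℒ e x).1 = e := rfl

theorem letter_of_mem {e : ℤ} {x : L} (hx : x ∈ ℒ e) : letter ℒ e x = ⟨e, x, hx⟩ := by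
  rw [letter]
  congr 1
  apply Subtype.ext
  exact DirectSum.decompose_of_mem_same ℒ hx

theorem letter_snd {e : ℤ} {x : L} (hx : x ∈ ℒ e) : ((letter ℒ e x).2 : L) = x := by
  rw [letter_of_mem hx]

@[simp] theorem letter_coe (x : Letter ℒ) : letter ℒ x.1 x.2 = x :=
  letter_of_mem x.2.2

theorem IsSymWord.contract_letter_add {f : WordFun ℒ M} (hf : IsSymWord f) (e : ℤ) (x y : L) :
    GradedMultider.contract (letter ℒ e (x + y)) f =
      GradedMultider.contract (letter ℒ e x) f + GradedMultider.contract (letter ℒ e y) f := by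
  rw [letter, DirectSum.decompose_add]
  exact hf.contract_add _ _ _

theorem IsSymWord.contract_letter_smul {f : WordFun ℒ M} (hf : IsSymWord f) (e : ℤ) (c : K)
    (x : L) : GradedMultider.contract (letter ℒ e (c • x)) f =
      c • GradedMultider.contract (letter ℒ e x) f := by
  rw [letter, DirectSum.decompose_smul]
  exact hf.contract_smul _ _ _

theorem IsSymWord.letter_add {f : WordFun ℒ M} (hf : IsSymWord f) (e : ℤ) (x y : L)
    (w : List (Letter ℒ)) :
    f (letter ℒ e (x + y) :: w) = f (letter ℒ e x :: w) + f (letter ℒ e y :: w) :=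
  congrFun (hf.contract_letter_add e x y) w

theorem IsSymWord.letter_smul {f : WordFun ℒ M} (hf : IsSymWord f) (e : ℤ) (c : K) (x : L)
    (w : List (Letter ℒ)) : f (letter ℒ e (c • x) :: w) = c • f (letter ℒ e x :: w) :=
  congrFun (hf.contract_letter_smul e c x) w

/-- The insertion of `g`, of degree `e`, into `f`. -/
def wins (e : ℤ) (f : WordFun ℒ M) (g : WordFun ℒ L) : WordFun ℒ M :=
  -- Projection to degree `e + wdeg p` makes the definition total; it changes nothing when `g` has
  -- degree `e`.
  shuf fun p q => f (letter ℒ (e + wdeg p) (g p) :: q)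

@[simp] theorem wins_nil (e : ℤ) (f : WordFun ℒ M) (g : WordFun ℒ L) :
    wins e f g [] = f [letter ℒ e (g [])] := by
  simp [wins, shuf]

theorem wins_add_left (e : ℤ) (f f' : WordFun ℒ M) (g : WordFun ℒ L) :
    wins e (f + f') g = wins e f g + wins e f' g :=
  funext fun w => shuf_add _ _ w

theorem wins_sub_left (e : ℤ) (f f' : WordFun ℒ M) (g : WordFun ℒ L) :
    wins e (f - f') g = wins e f g - wins e f' g :=
  funext fun w => shuf_sub _ _ w

theorem wins_smul_left (e : ℤ) (c : K) (f : WordFun ℒ M) (g : WordFun ℒ L) :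
    wins e (c • f) g = c • wins e f g :=
  funext fun w => shuf_smul c _ w

@[simp] theorem wins_zero_left (e : ℤ) (g : WordFun ℒ L) : wins e (0 : WordFun ℒ M) g = 0 :=
  funext fun w => shuf_zero w

section

variable {f : WordFun ℒ M} (hf : IsSymWord f)
include hf

theorem wins_add_right (e : ℤ) (g g' : WordFun ℒ L) :
    wins e f (g + g') = wins e f g + wins e f g' := by
  funext w
  rw [Pi.add_apply, wins, wins, wins, ← shuf_add]
  congr 1; funext p q
  exact hf.letter_add _ _ _ _

theorem wins_smul_right (e : ℤ) (c : K) (g : WordFun ℒ L) :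
    wins e f (c • g) = c • wins e f g := by
  funext w
  rw [Pi.smul_apply, wins, wins, ← shuf_smul]
  congr 1; funext p q
  exact hf.letter_smul _ _ _ _

theorem wins_zero_right (e : ℤ) : wins e f (0 : WordFun ℒ L) = 0 := by
  simpa using wins_smul_right hf e (0 : K) 0

theorem wins_sub_right (e : ℤ) (g g' : WordFun ℒ L) :
    wins e f (g - g') = wins e f g - wins e f g' := by
  have h := wins_add_right hf e g ((-1 : K) • g')
  rw [wins_smul_right hf] at h
  simpa [sub_eq_add_neg] using h

/-- The letter `x` goes into `g`, or it stays an argument of `f`. In the second case the symmetry of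
`f` moves it in front of the inserted letter of degree `e + wdeg p`; with the shuffle sign `x.1 *
wdeg p`, only `e * x.1` survives. -/
theorem contract_wins (e : ℤ) (g : WordFun ℒ L) (x : Letter ℒ) : contract x (wins e f g) =
    sgn K (e * x.1) • wins e (contract x f) g + wins (e + x.1) f (contract x g) := by
  funext w
  simp only [contract_apply, wins, Pi.add_apply, Pi.smul_apply, shuf_cons, ← shuf_smul]
  rw [add_comm]
  congr 3 <;> funext p q
  · have h := hf.swap [] x (letter ℒ (e + wdeg p) (g p)) q
    simp only [List.nil_append] at h
    rw [h, smul_smul, ← sgn_add, letter_fst]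
    congr 1
    apply sgn_congr_mod; push_cast; grind
  · simp [add_assoc]

theorem wins_cons (e : ℤ) (g : WordFun ℒ L) (x : Letter ℒ) (w : List (Letter ℒ)) :
    wins e f g (x :: w) =
      sgn K (e * x.1) • wins e (contract x f) g w + wins (e + x.1) f (contract x g) w :=
  congrFun (contract_wins hf e g x) w

/-- A constant absorbs no letters, so only the splitting with empty first subword contributes. -/
theorem wins_unitWord (e : ℤ) (x : L) :
    wins e f (unitWord x) = contract (letter ℒ e x) f := by
  funext w
  induction w generalizing f with
  | nil => simp
  | cons y w ih =>
    rw [wins_cons hf, ih (hf.contract y), contract_unitWord, wins_zero_right hf, Pi.zero_apply,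
      add_zero, hf.contract_swap (letter ℒ e x) y]
    rw [Pi.smul_apply, letter_fst, sgn_smul_sgn_smul]
    rfl

theorem IsSymWord.wins (e : ℤ) {g : WordFun ℒ L} (hg : IsSymWord g) : IsSymWord (wins e f g) where
  add v i x y w := by
    induction v generalizing e f g with
    | nil =>
      simp only [List.nil_append, wins_cons hf, hf.contract_add, hg.contract_add, wins_add_left,
        wins_add_right hf, Pi.add_apply, smul_add]
      abel
    | cons z v ih =>
      simp only [List.cons_append, wins_cons hf, ih (hf.contract z) e hg,
        ih hf (e + z.1) (hg.contract z), smul_add]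
      abel
  smul v i c x w := by
    induction v generalizing e f g with
    | nil =>
      simp only [List.nil_append, wins_cons hf, hf.contract_smul, hg.contract_smul, wins_smul_left,
        wins_smul_right hf, Pi.smul_apply, smul_add, smul_comm c]
    | cons z v ih =>
      simp only [List.cons_append, wins_cons hf, ih (hf.contract z) e hg,
        ih hf (e + z.1) (hg.contract z), smul_add, smul_comm c]
  swap v x y w := by
    induction v generalizing e f g with
    | nil =>
      simp only [List.nil_append, wins_cons hf, wins_cons (hf.contract _), hf.contract_swap x y,
        hg.contract_swap x y, wins_smul_left, wins_smul_right hf, Pi.smul_apply,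
        add_right_comm e y.1 x.1]
      match_scalars <;>
      (try simp only [mul_one, mul_add, add_mul, sgn_add, mul_comm (G := ℤ)]) <;>
      grind [sgn_mul_self]
    | cons z v ih =>
      simp only [List.cons_append, wins_cons hf, ih (hf.contract z) e hg,
        ih hf (e + z.1) (hg.contract z), smul_add, smul_comm (sgn K (x.1 * y.1))]

end

/-- No condition on `g` is needed because `letter` projects its values to the prescribed degree. -/
theorem HasWordDegree.wins {ℳ : ℤ → Submodule K M} {d : ℤ} (e : ℤ) {f : WordFun ℒ M}
    (hf : HasWordDegree ℳ d f) (g : WordFun ℒ L) : HasWordDegree ℳ (d + e) (wins e f g) := by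
  intro w
  refine shuf_mem _ _ _ _ fun p q => ?_
  have h := hf (letter ℒ (e + wdeg p) (g p) :: q)
  simpa [add_assoc] using h

/-- Insertion is a derivation of products. -/
theorem wins_wmul (B : M₁ →ₗ[K] M₂ →ₗ[K] M) (d e : ℤ) {f : WordFun ℒ M₁} {g : WordFun ℒ M₂}
    (hf : IsSymWord f) (hg : IsSymWord g) (X : WordFun ℒ L) :
    wins d (wmul B e f g) X =
      wmul B (e + d) f (wins d g X) + sgn K (e * d) • wmul B e (wins d f X) g := by
  funext w
  induction w generalizing d e f g X with
  | nil => simp [wmul_cons, add_comm]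
  | cons x w ih =>
    simp only [Pi.add_apply, Pi.smul_apply, wmul_cons, wins_cons (hf.wmul B e hg), contract_wmul,
      contract_wins hf, contract_wins hg, wins_add_left, wins_smul_left, ih _ _ (hf.contract x) hg,
      ih _ _ hf (hg.contract x), ih _ _ hf hg, map_add, map_smul, LinearMap.add_apply,
      LinearMap.smul_apply, add_right_comm e x.1 d, add_assoc]
    match_scalars <;>
    (try simp only [mul_one, mul_add, add_mul, sgn_add, mul_comm (G := ℤ)]) <;>
    grind [sgn_mul_self]

/-- The associator of insertion is graded symmetric in its last two arguments. -/
theorem wins_assoc_symm (d e : ℤ) {f : WordFun ℒ M} {X Y : WordFun ℒ L} (hf : IsSymWord f)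
    (hX : IsSymWord X) (hY : IsSymWord Y) :
    wins d (wins e f Y) X - wins (d + e) f (wins d Y X) =
      sgn K (d * e) • (wins e (wins d f X) Y - wins (d + e) f (wins e X Y)) := by
  funext w
  induction w generalizing d e f X Y with
  | nil =>
    -- On the empty word the nested insertion cancels on each side. What remains is `f` at the two
    -- values `X []` and `Y []`, in opposite orders.
    have h := hf.swap [] (letter ℒ d (X [])) (letter ℒ e (Y [])) []
    simp only [List.nil_append, letter_fst] at h
    simp only [Pi.sub_apply, Pi.smul_apply, wins_nil, wins_cons hf, contract_apply, letter_fst, h,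
      add_comm e d, add_sub_cancel_right, smul_smul, ← sgn_add]
    congr 1; apply sgn_congr_mod; push_cast; grind
  | cons x w ih =>
    -- The letter `x` may enter any of the three maps; each case is an instance of the induction
    -- hypothesis.
    have h1 := ih d e (hf.contract x) hX hY
    have h2 := ih (d + x.1) e hf (hX.contract x) hY
    have h3 := ih d (e + x.1) hf hX (hY.contract x)
    simp only [Pi.sub_apply, Pi.smul_apply] at h1 h2 h3
    rw [sub_eq_iff_eq_add] at h1 h2 h3
    simp only [Pi.sub_apply, Pi.smul_apply, wins_cons hf, wins_cons (hf.wins e hY),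
      wins_cons (hf.wins d hX), contract_wins hf, contract_wins hX, contract_wins hY, wins_add_left,
      wins_add_right hf, wins_smul_left, wins_smul_right hf, Pi.add_apply, h1, h2, h3]
    simp only [← add_assoc, add_right_comm d x.1 e]
    match_scalars <;>
    (try simp only [mul_one, mul_add, add_mul, sgn_add, mul_comm (G := ℤ)]) <;>
    grind [sgn_mul_self]

end Insertion

/-! ### The bracket and its representation on functions of words -/

section Representation

variable {K : Type*} [Field K] {L : Type*} [AddCommGroup L] [Module K L] {ℒ : ℤ → Submodule K L}
  {M : Type*} [AddCommGroup M] [Module K M] {M₁ : Type*} [AddCommGroup M₁] [Module K M₁]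
  {M₂ : Type*} [AddCommGroup M₂] [Module K M₂]

theorem wmul_unitWord_left (B : M₁ →ₗ[K] M₂ →ₗ[K] M) (e : ℤ) (x : M₁) (g : WordFun ℒ M₂) :
    wmul B e (unitWord x) g = fun w => B x (g w) := by
  funext w
  induction w generalizing e g with
  | nil => simp
  | cons y w ih => simp [wmul_cons, ih]

/-- All letters go into `f`, and all of them pass the constant of degree `e`. -/
theorem wmul_unitWord_right (B : M₁ →ₗ[K] M₂ →ₗ[K] M) (e : ℤ) (f : WordFun ℒ M₁) (x : M₂) :
    wmul B e f (unitWord x) = fun w => sgn K (e * wdeg w) • B (f w) x := by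
  funext w
  induction w generalizing e f with
  | nil => simp
  | cons y w ih =>
    simp only [wmul_cons, ih, contract_unitWord, map_zero, Pi.zero_apply, add_zero, smul_smul,
      ← sgn_add, ← mul_add, wdeg_cons, contract_apply]

variable [DirectSum.Decomposition ℒ]

/-- The bracket of functions of words, of degrees `d` and `e`, with values in `L`. -/
def wordBracket (d e : ℤ) (X Y : WordFun ℒ L) : WordFun ℒ L :=
  wins e X Y - sgn K (d * e) • wins d Y X

/-- The symbol of the bracket of functions of words. -/
def wordSymbol (d e : ℤ) (X : WordFun ℒ L) (σ : WordFun ℒ (M →ₗ[K] M)) (Y : WordFun ℒ L)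
    (τ : WordFun ℒ (M →ₗ[K] M)) : WordFun ℒ (M →ₗ[K] M) :=
  wins e σ Y - sgn K (d * e) • wins d τ X + (wmul (LinearMap.llcomp K M M M) e σ τ -
    sgn K (d * e) • wmul (LinearMap.llcomp K M M M) d τ σ)

/-- The action of a pair `(X, σ)` of degree `d` on a function of words of degree `e`. -/
def wordEta (d : ℤ) (X : WordFun ℒ L) (σ : WordFun ℒ (M →ₗ[K] M)) (e : ℤ) (ω : WordFun ℒ M) :
    WordFun ℒ M :=
  wmul LinearMap.id e σ ω - sgn K (d * e) • wins d ω X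

theorem IsSymWord.wordBracket {d e : ℤ} {X Y : WordFun ℒ L} (hX : IsSymWord X)
    (hY : IsSymWord Y) : IsSymWord (wordBracket d e X Y) :=
  (hX.wins e hY).sub ((hY.wins d hX).smul' _)

theorem IsSymWord.wordSymbol {d e : ℤ} {X Y : WordFun ℒ L} {σ τ : WordFun ℒ (M →ₗ[K] M)}
    (hX : IsSymWord X) (hσ : IsSymWord σ) (hY : IsSymWord Y) (hτ : IsSymWord τ) :
    IsSymWord (wordSymbol d e X σ Y τ) :=
  ((hσ.wins e hY).sub ((hτ.wins d hX).smul' _)).add'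
    ((hσ.wmul _ e hτ).sub ((hτ.wmul _ d hσ).smul' _))

theorem IsSymWord.wordEta {d : ℤ} {X : WordFun ℒ L} {σ : WordFun ℒ (M →ₗ[K] M)} {e : ℤ}
    {ω : WordFun ℒ M} (hX : IsSymWord X) (hσ : IsSymWord σ) (hω : IsSymWord ω) :
    IsSymWord (wordEta d X σ e ω) :=
  (hσ.wmul _ e hω).sub ((hω.wins d hX).smul' _)

/-- Combines the Leibniz rules of product and insertion: the letter enters the pair or the form.
Inductions about the action rest on it. -/
theorem contract_wordEta {d : ℤ} (X : WordFun ℒ L) (σ : WordFun ℒ (M →ₗ[K] M)) {e : ℤ}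
    {ω : WordFun ℒ M} (hω : IsSymWord ω) (x : Letter ℒ) :
    contract x (wordEta d X σ e ω) =
      sgn K (e * x.1) • wordEta (d + x.1) (contract x X) (contract x σ) e ω +
        wordEta d X σ (e + x.1) (contract x ω) := by
  simp only [wordEta, map_sub, map_smul, contract_wmul, contract_wins hω]
  match_scalars <;> (try simp only [mul_one, mul_add, add_mul, sgn_add, mul_comm (G := ℤ)]) <;>
    grind [sgn_mul_self]

theorem wordEta_add (d : ℤ) (X : WordFun ℒ L) (σ : WordFun ℒ (M →ₗ[K] M)) (e : ℤ)
    (ω ω' : WordFun ℒ M) : wordEta d X σ e (ω + ω') = wordEta d X σ e ω + wordEta d X σ e ω' := by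
  simp only [wordEta, map_add, wins_add_left, smul_add]
  abel

theorem wordEta_smul (d : ℤ) (X : WordFun ℒ L) (σ : WordFun ℒ (M →ₗ[K] M)) (e : ℤ)
    (c : K) (ω : WordFun ℒ M) : wordEta d X σ e (c • ω) = c • wordEta d X σ e ω := by
  simp only [wordEta, map_smul, wins_smul_left, smul_sub, smul_comm c]

theorem wordEta_sub (d : ℤ) (X : WordFun ℒ L) (σ : WordFun ℒ (M →ₗ[K] M)) (e : ℤ)
    (ω ω' : WordFun ℒ M) : wordEta d X σ e (ω - ω') = wordEta d X σ e ω - wordEta d X σ e ω' := by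
  simp only [wordEta, map_sub, wins_sub_left, smul_sub]
  abel

/-- The action on functions of words is a representation. -/
theorem wordEta_bracket (d d' e : ℤ) {X Y : WordFun ℒ L} {σ τ : WordFun ℒ (M →ₗ[K] M)}
    {ω : WordFun ℒ M} (hX : IsSymWord X) (hσ : IsSymWord σ) (hY : IsSymWord Y)
    (hτ : IsSymWord τ) (hω : IsSymWord ω) :
    wordEta (d + d') (wordBracket d d' X Y) (wordSymbol d d' X σ Y τ) e ω =
      wordEta d X σ (d' + e) (wordEta d' Y τ e ω) -
        sgn K (d * d') • wordEta d' Y τ (d + e) (wordEta d X σ e ω) := by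
  -- Applying a composite of endomorphisms is applying one after the other; this is needed in both
  -- orders of `σ` and `τ`.
  have h1 := wmul_assoc (B := (LinearMap.id : (M →ₗ[K] M) →ₗ[K] M →ₗ[K] M))
    (B' := LinearMap.llcomp K M M M) (C := LinearMap.id) (C' := LinearMap.id)
    (fun _ _ _ => rfl) d' e σ τ ω
  have h2 := wmul_assoc (B := (LinearMap.id : (M →ₗ[K] M) →ₗ[K] M →ₗ[K] M))
    (B' := LinearMap.llcomp K M M M) (C := LinearMap.id) (C' := LinearMap.id)
    (fun _ _ _ => rfl) d e τ σ ω
  -- The two iterated insertions into `ω` differ by insertions of `X ∘ Y` and `Y ∘ X`, that is, by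
  -- insertion of the bracket. The mixed terms are handled by `wins_wmul`.
  have h3 := wins_assoc_symm d d' hω hX hY
  rw [sub_eq_iff_eq_add] at h3
  simp only [wordEta, wordBracket, wordSymbol, map_add, map_sub, map_smul, LinearMap.add_apply,
    LinearMap.sub_apply, LinearMap.smul_apply, wins_add_left, wins_sub_left, wins_smul_left,
    wins_sub_right hω, wins_smul_right hω, wins_wmul _ _ _ hσ hω, wins_wmul _ _ _ hτ hω, h1, h2, h3,
    add_comm e d, add_comm e d']
  match_scalars <;> (try simp only [mul_one, mul_add, add_mul, sgn_add, mul_comm (G := ℤ)]) <;>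
    grind [sgn_mul_self]

/-- The graded Jacobi identity. -/
theorem wordBracket_jacobi (d d' e : ℤ) {X Y Z : WordFun ℒ L} (hX : IsSymWord X)
    (hY : IsSymWord Y) (hZ : IsSymWord Z) :
    wordBracket d (d' + e) X (wordBracket d' e Y Z) =
      wordBracket (d + d') e (wordBracket d d' X Y) Z +
        sgn K (d * d') • wordBracket d' (d + e) Y (wordBracket d e X Z) := by
  have h1 := wins_assoc_symm d d' hZ hX hY
  have h2 := wins_assoc_symm d e hY hX hZ
  have h3 := wins_assoc_symm d' e hX hY hZ
  rw [sub_eq_iff_eq_add] at h1 h2 h3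
  simp only [wordBracket, wins_sub_left, wins_smul_left, wins_sub_right hX, wins_smul_right hX,
    wins_sub_right hY, wins_smul_right hY, wins_sub_right hZ, wins_smul_right hZ, h1, h2, h3,
    add_comm e d, add_comm e d', add_comm d' d]
  match_scalars <;> (try simp only [mul_one, mul_add, add_mul, sgn_add, mul_comm (G := ℤ)]) <;>
    grind [sgn_mul_self]

theorem wordBracket_skew (d d' : ℤ) (X Y : WordFun ℒ L) :
    wordBracket d d' X Y = -(sgn K (d * d') • wordBracket d' d Y X) := by
  rw [wordBracket, wordBracket, smul_sub, mul_comm d' d, sgn_smul_sgn_smul, neg_sub]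

theorem wordSymbol_skew (d d' : ℤ) (X Y : WordFun ℒ L) (σ τ : WordFun ℒ (M →ₗ[K] M)) :
    wordSymbol d d' X σ Y τ = -(sgn K (d * d') • wordSymbol d' d Y τ X σ) := by
  rw [wordSymbol, wordSymbol, smul_add, smul_sub, smul_sub, mul_comm d' d, sgn_smul_sgn_smul,
    sgn_smul_sgn_smul]
  abel

/-- The action on constants recovers the symbol. -/
theorem wordEta_unitWord (d : ℤ) (X : WordFun ℒ L) (σ : WordFun ℒ (M →ₗ[K] M)) (e : ℤ) (x : M) :
    wordEta d X σ e (unitWord x) = fun w => sgn K (e * wdeg w) • σ w x := by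
  have h : wins d (unitWord x : WordFun ℒ M) X = 0 := by
    funext w
    exact shuf_zero w
  rw [wordEta, h, smul_zero, sub_zero, wmul_unitWord_right]
  rfl

/-- The symbol is determined by the action on constants. Since the action is a representation, the
identity becomes the Jacobi identity for graded commutators of operators. -/
theorem wordSymbol_jacobi (d d' e : ℤ) {X Y Z : WordFun ℒ L} {σ τ ρ : WordFun ℒ (M →ₗ[K] M)}
    (hX : IsSymWord X) (hσ : IsSymWord σ) (hY : IsSymWord Y) (hτ : IsSymWord τ)
    (hZ : IsSymWord Z) (hρ : IsSymWord ρ) :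
    wordSymbol d (d' + e) X σ (wordBracket d' e Y Z) (wordSymbol d' e Y τ Z ρ) =
      wordSymbol (d + d') e (wordBracket d d' X Y) (wordSymbol d d' X σ Y τ) Z ρ +
        sgn K (d * d') • wordSymbol d' (d + e) Y τ (wordBracket d e X Z)
          (wordSymbol d e X σ Z ρ) := by
  suffices h : ∀ x : M,
      wordEta (d + (d' + e)) (wordBracket d (d' + e) X (wordBracket d' e Y Z))
        (wordSymbol d (d' + e) X σ (wordBracket d' e Y Z) (wordSymbol d' e Y τ Z ρ)) 0
        (unitWord x) =
      wordEta (d + d' + e) (wordBracket (d + d') e (wordBracket d d' X Y) Z)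
        (wordSymbol (d + d') e (wordBracket d d' X Y) (wordSymbol d d' X σ Y τ) Z ρ) 0
        (unitWord x) +
      sgn K (d * d') • wordEta (d' + (d + e)) (wordBracket d' (d + e) Y (wordBracket d e X Z))
        (wordSymbol d' (d + e) Y τ (wordBracket d e X Z) (wordSymbol d e X σ Z ρ)) 0
        (unitWord x) by
    funext w
    ext x
    have := congrFun (h x) w
    simpa [wordEta_unitWord] using this
  intro x
  have hx : IsSymWord (unitWord x : WordFun ℒ M) := IsSymWord.unitWord x
  simp only [wordEta_bracket, hX, hσ, hY, hτ, hZ, hρ, hx, IsSymWord.wordBracket,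
    IsSymWord.wordSymbol, IsSymWord.wordEta, wordEta_sub, wordEta_smul]
  simp only [add_zero, add_comm e d, add_comm e d', add_comm d' d]
  match_scalars <;> (try simp only [mul_one, mul_add, add_mul, sgn_add, mul_comm (G := ℤ)]) <;>
    grind [sgn_mul_self]

end Representation

/-! ### Graded `A`-multilinearity and the Leibniz rule for functions of words -/

section Multilinear

variable {K : Type*} [Field K] {A : Type*} [Ring A] [Algebra K A] (𝒜 : ℤ → Submodule K A)
  {L : Type*} [AddCommGroup L] [Module K L] [Module A L] [IsScalarTower K A L]
  {ℒ : ℤ → Submodule K L} [DirectSum.Decomposition ℒ]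
  {M : Type*} [AddCommGroup M] [Module K M] [Module A M] [IsScalarTower K A M]

variable (K A M) in
/-- The action of `A`, as a bilinear map. -/
def actionMap : A →ₗ[K] M →ₗ[K] M := (Algebra.lsmul K K M).toLinearMap

@[simp] theorem actionMap_apply (a : A) (x : M) : actionMap K A M a x = a • x := rfl

theorem smul_smul_comm' (c : K) (a : A) (x : M) : a • c • x = c • a • x :=
  (actionMap K A M a).map_smul c x

/-- The product with an element of `A` on the left does not depend on the degree. -/
theorem wmul_unitWord_degree {ℒ : ℤ → Submodule K L} {M₁ M₂ : Type*} [AddCommGroup M₁]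
    [Module K M₁] [AddCommGroup M₂] [Module K M₂] (B : M₁ →ₗ[K] M₂ →ₗ[K] M) (e : ℤ) (x : M₁)
    (g : WordFun ℒ M₂) : wmul B e (unitWord x) g = wmul B 0 (unitWord x) g := by
  rw [wmul_unitWord_left, wmul_unitWord_left]

/-- The product of a homogeneous element of `A` and a letter. -/
def smulLetter (r : ℤ) (a : A) (x : Letter ℒ) : Letter ℒ := letter ℒ (r + x.1) (a • (x.2 : L))

@[simp] theorem smulLetter_fst (r : ℤ) (a : A) (x : Letter ℒ) :
    (smulLetter r a x).1 = r + x.1 := rfl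

/-- Graded `A`-multilinearity of a function of words of degree `d`. -/
def IsMultilinearWord (d : ℤ) (f : WordFun ℒ M) : Prop :=
  ∀ (v : List (Letter ℒ)) (r : ℤ) (a : A), a ∈ 𝒜 r → ∀ (x : Letter ℒ) (w : List (Letter ℒ)),
    f (v ++ smulLetter r a x :: w) = sgn K (r * (d + wdeg v)) • a • f (v ++ x :: w)

/-- The Leibniz rule in the first place, where `B` is the pairing of symbols with letters. -/
def LeibnizWord (B : A →ₗ[K] L →ₗ[K] M) (d : ℤ) (X : WordFun ℒ M)
    (σ : WordFun ℒ (A →ₗ[K] A)) : Prop :=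
  ∀ (r : ℤ) (a : A), a ∈ 𝒜 r → ∀ (x : Letter ℒ) (w : List (Letter ℒ)),
    X (smulLetter r a x :: w) =
      -- The first sign comes from rotating `a x` from the last place, where multiderivations have
      -- their Leibniz rule, to the first. Taking `B` to be zero covers `A`-multilinear maps as
      -- well.
      sgn K ((x.1 + r) * wdeg w) • B (σ w a) x.2 + sgn K (d * r) • a • X (x :: w)

variable {𝒜}

theorem IsMultilinearWord.contract {d : ℤ} {f : WordFun ℒ M} (hf : IsMultilinearWord 𝒜 d f)
    (x : Letter ℒ) : IsMultilinearWord 𝒜 (d + x.1) (contract x f) := by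
  intro v r a ha y w
  have := hf (x :: v) r a ha y w
  simpa [add_assoc] using this

theorem IsMultilinearWord.add {d : ℤ} {f g : WordFun ℒ M} (hf : IsMultilinearWord 𝒜 d f)
    (hg : IsMultilinearWord 𝒜 d g) : IsMultilinearWord 𝒜 d (f + g) := by
  intro v r a ha y w
  simp only [Pi.add_apply, hf v r a ha y w, hg v r a ha y w, smul_add]

theorem IsMultilinearWord.smul {d : ℤ} {f : WordFun ℒ M} (c : K) (hf : IsMultilinearWord 𝒜 d f) :
    IsMultilinearWord 𝒜 d (c • f) := by
  intro v r a ha y w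
  rw [Pi.smul_apply, Pi.smul_apply, hf v r a ha y w, smul_smul_comm', smul_comm c]

theorem IsMultilinearWord.sub {d : ℤ} {f g : WordFun ℒ M} (hf : IsMultilinearWord 𝒜 d f)
    (hg : IsMultilinearWord 𝒜 d g) : IsMultilinearWord 𝒜 d (f - g) := by
  have := hf.add (hg.smul (-1 : K))
  simpa [sub_eq_add_neg] using this

theorem IsMultilinearWord.unitWord (d : ℤ) (x : M) :
    IsMultilinearWord 𝒜 d (unitWord x : WordFun ℒ M) := by
  intro v r a ha y w
  cases v <;> simp

theorem IsMultilinearWord.contract_smulLetter {d : ℤ} {f : WordFun ℒ M}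
    (hf : IsMultilinearWord 𝒜 d f) {r : ℤ} {a : A} (ha : a ∈ 𝒜 r) (x : Letter ℒ) :
    GradedMultider.contract (smulLetter r a x) f =
      sgn K (r * d) • wmul (actionMap K A M) (d + x.1) (GradedMultider.unitWord a)
        (GradedMultider.contract x f) := by
  funext w
  simpa [wmul_unitWord_left] using hf [] r a ha x w

/-- Treats multilinear functions as the case without symbol, so that one lemma on insertion of
products serves for forms and for multiderivations. -/
theorem IsMultilinearWord.leibniz {d : ℤ} {f : WordFun ℒ M} (hf : IsMultilinearWord 𝒜 d f) :
    LeibnizWord 𝒜 0 d f 0 := by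
  intro r a ha x w
  have := hf [] r a ha x w
  simpa [mul_comm d r] using this

/-- Graded symmetry of `X` carries the letter `x` past the place where the rule applies and back.
This stability is what makes induction possible. -/
theorem LeibnizWord.contract {B : A →ₗ[K] L →ₗ[K] M} {d : ℤ} {X : WordFun ℒ M}
    {σ : WordFun ℒ (A →ₗ[K] A)} (hX : IsSymWord X) (h : LeibnizWord 𝒜 B d X σ) (x : Letter ℒ) :
    LeibnizWord 𝒜 B (d + x.1) (contract x X) (contract x σ) := by
  intro r a ha y w
  have h1 := hX.swap [] (smulLetter r a y) x w
  have h2 := hX.swap [] y x w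
  have h3 := h r a ha y (x :: w)
  simp only [List.nil_append] at h1 h2
  rw [contract_apply, contract_apply, contract_apply, h1, h3, h2, smul_smul_comm', smulLetter_fst,
    wdeg_cons]
  generalize a • X (y :: x :: w) = t
  match_scalars <;> (try simp only [mul_one, mul_add, add_mul, sgn_add, mul_comm (G := ℤ)]) <;>
    grind [sgn_mul_self]

variable [GradedAlgebra 𝒜] [SetLike.GradedSMul 𝒜 ℒ]

theorem smul_mem_graded {i j : ℤ} {a : A} {x : L} (ha : a ∈ 𝒜 i) (hx : x ∈ ℒ j) :
    a • x ∈ ℒ (i + j) := SetLike.GradedSMul.smul_mem ha hx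

theorem smulLetter_snd {r : ℤ} {a : A} (ha : a ∈ 𝒜 r) (x : Letter ℒ) :
    ((smulLetter r a x).2 : L) = a • (x.2 : L) :=
  letter_snd (smul_mem_graded ha x.2.2)

theorem HasWordDegree.actionMap {c z : ℤ} {φ : WordFun ℒ A} {Z : WordFun ℒ L}
    (hφ : HasWordDegree 𝒜 c φ) (hZ : HasWordDegree ℒ z Z) :
    HasWordDegree ℒ (c + z) (GradedMultider.wmul (actionMap K A L) z φ Z) :=
  hφ.wmul (fun _ _ _ _ ha hx => smul_mem_graded ha hx) hZ

/-- Insertion of a product into a function that satisfies the Leibniz rule. -/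
theorem wins_actionMap {B : A →ₗ[K] L →ₗ[K] M} {d : ℤ} {X : WordFun ℒ M}
    {σ : WordFun ℒ (A →ₗ[K] A)} (hX : IsSymWord X) (h : LeibnizWord 𝒜 B d X σ) {c z : ℤ}
    {φ : WordFun ℒ A} {Z : WordFun ℒ L} (hφ : HasWordDegree 𝒜 c φ) (hZ : HasWordDegree ℒ z Z) :
    wins (c + z) X (wmul (actionMap K A L) z φ Z) =
      wmul B z (wmul LinearMap.id c σ φ) Z +
        sgn K (d * c) • wmul (actionMap K A M) (z + d) φ (wins z X Z) := by
  funext w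
  induction w generalizing d X σ c z φ Z with
  | nil =>
    -- On the empty word the inserted element is a homogeneous scalar times a homogeneous element,
    -- and the Leibniz rule applies to it directly.
    have h1 : letter ℒ (c + z) (φ [] • Z []) = smulLetter c (φ []) (letter ℒ z (Z [])) := by
      rw [smulLetter, letter_snd (by simpa using hZ []), letter_fst]
    have h2 := h c (φ []) (by simpa using hφ []) (letter ℒ z (Z [])) []
    rw [letter_snd (by simpa using hZ [])] at h2
    simp [h1, h2]
  | cons x w ih =>
    have h1 := ih (hX.contract x) (h.contract hX x) hφ hZ
    have h2 := ih hX h (hφ.contract x) hZ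
    have h3 := ih hX h hφ (hZ.contract x)
    rw [add_right_comm c] at h2
    rw [← add_assoc c] at h3
    simp only [Pi.add_apply, Pi.smul_apply] at h1 h2 h3
    simp only [Pi.add_apply, Pi.smul_apply, wins_cons hX, wmul_cons, contract_wmul, wins_add_right hX,
      wins_smul_right hX, contract_wins hX, map_add, map_smul, LinearMap.add_apply,
      LinearMap.smul_apply, h1, h2, h3]
    simp only [← add_assoc, add_right_comm z d x.1]
    match_scalars <;> (try simp only [mul_one, mul_add, add_mul, sgn_add, mul_comm (G := ℤ)]) <;>
      grind [sgn_mul_self]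

/-- Insertion of a product into a graded `A`-multilinear function. -/
theorem IsMultilinearWord.wins_actionMap {e : ℤ} {ω : WordFun ℒ M} (hω : IsSymWord ω)
    (h : IsMultilinearWord 𝒜 e ω) {c z : ℤ} {φ : WordFun ℒ A} {Z : WordFun ℒ L}
    (hφ : HasWordDegree 𝒜 c φ) (hZ : HasWordDegree ℒ z Z) :
    wins (c + z) ω (wmul (actionMap K A L) z φ Z) =
      sgn K (e * c) • wmul (actionMap K A M) (z + e) φ (wins z ω Z) := by
  rw [GradedMultider.wins_actionMap hω h.leibniz hφ hZ]
  have : wmul (0 : A →ₗ[K] L →ₗ[K] M) z (wmul LinearMap.id c (0 : WordFun ℒ (A →ₗ[K] A)) φ) Z = 0 := by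
    simp
  rw [this, zero_add]

/-- Derivation-valued functions act as derivations on products. -/
theorem wmul_symbol_wmul {d : ℤ} {σ : WordFun ℒ (A →ₗ[K] A)} (hσ : HasWordDegree (algDer 𝒜) d σ)
    {e e' : ℤ} {ω ω' : WordFun ℒ A} (hω : HasWordDegree 𝒜 e ω) :
    wmul LinearMap.id (e + e') σ (wmul (actionMap K A A) e' ω ω') =
      wmul (actionMap K A A) e' (wmul LinearMap.id e σ ω) ω' +
        sgn K (d * e) • wmul (actionMap K A A) (e' + d) ω (wmul LinearMap.id e' σ ω') := by
  funext w
  induction w generalizing d σ e e' ω ω' with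
  | nil =>
    -- On the empty word this is the derivation property of the value of `σ`.
    have h1 := (hσ []).2 e (ω []) (ω' []) (by simpa using hω [])
    simpa using h1
  | cons x w ih =>
    have h1 := ih (hσ.contract x) hω (e' := e') (ω' := ω')
    have h2 := ih hσ (hω.contract x) (e' := e') (ω' := ω')
    have h3 := ih hσ hω (e' := e' + x.1) (ω' := contract x ω')
    rw [add_right_comm e] at h2
    rw [← add_assoc e] at h3
    simp only [Pi.add_apply, Pi.smul_apply] at h1 h2 h3
    simp only [Pi.add_apply, Pi.smul_apply, wmul_cons, contract_wmul, map_add, map_smul,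
      LinearMap.add_apply, LinearMap.smul_apply, h1, h2, h3]
    simp only [← add_assoc, add_right_comm e' d x.1]
    match_scalars <;> (try simp only [mul_one, mul_add, add_mul, sgn_add, mul_comm (G := ℤ)]) <;>
      grind [sgn_mul_self]

/-- The action of a pair is a derivation. -/
theorem wordEta_wmul {d : ℤ} {X : WordFun ℒ L} {σ : WordFun ℒ (A →ₗ[K] A)}
    (hσ : HasWordDegree (algDer 𝒜) d σ) {e e' : ℤ} {ω ω' : WordFun ℒ A}
    (hω : HasWordDegree 𝒜 e ω) (hω₁ : IsSymWord ω) (hω' : IsSymWord ω') :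
    wordEta d X σ (e + e') (wmul (actionMap K A A) e' ω ω') =
      wmul (actionMap K A A) e' (wordEta d X σ e ω) ω' +
        sgn K (d * e) • wmul (actionMap K A A) (d + e') ω (wordEta d X σ e' ω') := by
  simp only [wordEta, wmul_symbol_wmul hσ hω, wins_wmul _ _ _ hω₁ hω', map_sub, map_smul,
    LinearMap.sub_apply, LinearMap.smul_apply, add_comm e' d]
  match_scalars <;> (try simp only [mul_one, mul_add, add_mul, sgn_add, mul_comm (G := ℤ)]) <;>
    grind [sgn_mul_self]

/-! ### Multiderivations as functions of words -/

variable (𝒜) in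
/-- A multiderivation of degree `d`, as a pair of functions of words. -/
structure IsMultiderWord (d : ℤ) (X : WordFun ℒ L) (σ : WordFun ℒ (A →ₗ[K] A)) : Prop where
  sym : IsSymWord X
  deg : HasWordDegree ℒ d X
  symbol_sym : IsSymWord σ
  symbol_deg : HasWordDegree (algDer 𝒜) d σ
  symbol_multilinear : IsMultilinearWord 𝒜 d σ
  leibniz : LeibnizWord 𝒜 (actionMap K A L) d X σ

namespace IsMultiderWord

variable {d e : ℤ} {X Y : WordFun ℒ L} {σ τ : WordFun ℒ (A →ₗ[K] A)}

theorem contract (h : IsMultiderWord 𝒜 d X σ) (x : Letter ℒ) :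
    IsMultiderWord 𝒜 (d + x.1) (contract x X) (contract x σ) :=
  ⟨h.sym.contract x, h.deg.contract x, h.symbol_sym.contract x, h.symbol_deg.contract x,
    h.symbol_multilinear.contract x, h.leibniz.contract h.sym x⟩

theorem hasWordDegree_wordEta (h : IsMultiderWord 𝒜 d X σ) {ω : WordFun ℒ A}
    (hω : HasWordDegree 𝒜 e ω) : HasWordDegree 𝒜 (d + e) (wordEta d X σ e ω) := by
  refine HasWordDegree.sub (h.symbol_deg.wmul
    (fun i j (x : A →ₗ[K] A) y (hx : x ∈ algDer 𝒜 i) hy => hx.1 j y hy) hω) ?_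
  have := (hω.wins d X).smul (sgn K (d * e))
  rwa [add_comm e d] at this

/-- The contraction of `X` with the product of an element of `A` and a letter. -/
theorem contract_smulLetter (h : IsMultiderWord 𝒜 d X σ) {r : ℤ} {a : A} (ha : a ∈ 𝒜 r)
    (x : Letter ℒ) : GradedMultider.contract (smulLetter r a x) X =
      wmul (actionMap K A L) x.1 (wordEta d X σ r (unitWord a)) (unitWord (x.2 : L)) +
        sgn K (d * r) • wmul (actionMap K A L) (d + x.1) (unitWord a)
          (GradedMultider.contract x X) := by
  funext w
  simp only [wordEta_unitWord, Pi.add_apply, Pi.smul_apply, wmul_unitWord_left,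
    wmul_unitWord_right, contract_apply, h.leibniz r a ha x w, actionMap_apply, smul_assoc]
  rw [smul_smul, ← sgn_add, add_mul]

/-- The action of a multiderivation preserves graded `A`-multilinear functions. -/
theorem isMultilinearWord_wordEta (h : IsMultiderWord 𝒜 d X σ) {ω : WordFun ℒ A}
    (hω : IsSymWord ω) (hω₁ : HasWordDegree 𝒜 e ω) (hω₂ : IsMultilinearWord 𝒜 e ω) :
    IsMultilinearWord 𝒜 (d + e) (wordEta d X σ e ω) := by
  intro v
  induction v generalizing d X σ e ω with
  | nil =>
    intro r a ha x w
    have hu : IsSymWord (unitWord a : WordFun ℒ A) := IsSymWord.unitWord a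
    have hu₁ : HasWordDegree 𝒜 r (unitWord a : WordFun ℒ A) := HasWordDegree.unitWord ha
    -- The Leibniz rule of `X` produces the term `σ(a) x`. Its insertion into `ω` will cancel the
    -- term in `h3` where `σ` differentiates `a` in `a ω(x, …)`.
    have h1 : wins (r + d + x.1) ω (wmul (actionMap K A L) x.1
        (wordEta d X σ r (unitWord a)) (unitWord (x.2 : L))) = sgn K (e * (d + r)) •
          wmul (actionMap K A A) (x.1 + e) (wordEta d X σ r (unitWord a))
            (GradedMultider.contract x ω) := by
      rw [add_comm r d, hω₂.wins_actionMap hω (h.hasWordDegree_wordEta hu₁)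
        (HasWordDegree.unitWord x.2.2), wins_unitWord hω, letter_coe]
    have h2 : wins (r + d + x.1) ω (wmul (actionMap K A L) (d + x.1) (unitWord a)
        (GradedMultider.contract x X)) = sgn K (e * r) • wmul (actionMap K A A) (d + x.1 + e)
          (unitWord a) (wins (d + x.1) ω (GradedMultider.contract x X)) := by
      rw [add_assoc, hω₂.wins_actionMap hω hu₁ (h.deg.contract x)]
    -- The action is a derivation, applied to the product of the constant `a` and the contraction of
    -- `ω` with `x`.
    have h3 := wordEta_wmul (X := X) (e' := e + x.1) h.symbol_deg hu₁ hu (hω.contract x)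
    have key : GradedMultider.contract (smulLetter r a x) (wordEta d X σ e ω) =
        sgn K (r * (d + e)) • wmul (actionMap K A A) 0 (unitWord a)
          (GradedMultider.contract x (wordEta d X σ e ω)) := by
      have h4 := h.symbol_multilinear.contract_smulLetter ha x
      have h5 := hω₂.contract_smulLetter ha x
      have h6 : ∀ σ' : WordFun ℒ (A →ₗ[K] A), wmul LinearMap.id e
          (wmul (actionMap K A (A →ₗ[K] A)) (d + x.1) (unitWord a) σ') ω =
          wmul (actionMap K A A) (d + x.1 + e) (unitWord a) (wmul LinearMap.id e σ' ω) := fun σ' =>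
        wmul_assoc (fun _ _ _ => rfl) _ _ _ _ _
      rw [contract_wordEta X σ hω, contract_wordEta X σ hω, h5, wordEta_smul,
        smulLetter_fst, add_left_comm e r, h3, h4, h.contract_smulLetter ha x]
      generalize wordEta d X σ r (unitWord a) = P at h1 ⊢
      simp only [wordEta, map_sub, map_add, map_smul, LinearMap.add_apply, LinearMap.sub_apply,
        LinearMap.smul_apply, wins_add_right hω, wins_smul_right hω]
      have e1 : d + (r + x.1) = r + d + x.1 := by ring
      simp only [e1, h1, h2, h6, wmul_unitWord_degree (actionMap K A A) _ a, add_comm x.1 e]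
      match_scalars <;> (try simp only [mul_one, mul_add, add_mul, sgn_add, mul_comm (G := ℤ)]) <;>
        grind [sgn_mul_self]
    have := congrFun key w
    simpa [wmul_unitWord_left] using this
  | cons y v ih =>
    intro r a ha x w
    have h1 := ih (h.contract y) hω hω₁ hω₂ r a ha x w
    have h2 := ih h (hω.contract y) (hω₁.contract y) (hω₂.contract y) r a ha x w
    have h3 := contract_wordEta (d := d) X σ hω y (e := e)
    have h4 := congrFun h3 (v ++ smulLetter r a x :: w)
    have h5 := congrFun h3 (v ++ x :: w)
    simp only [contract_apply, Pi.add_apply, Pi.smul_apply] at h4 h5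
    rw [List.cons_append, List.cons_append, h4, h5, h1, h2, smul_add, smul_add,
      smul_smul_comm', smul_comm (sgn K (e * y.1)), wdeg_cons]
    congr 4 <;> ring

end IsMultiderWord

end Multilinear

/-! ### Brackets of multiderivations are multiderivations -/

section Closure

variable {K : Type*} [Field K] {A : Type*} [Ring A] [Algebra K A] {𝒜 : ℤ → Submodule K A}
  {L : Type*} [AddCommGroup L] [Module K L] [Module A L] [IsScalarTower K A L]
  {ℒ : ℤ → Submodule K L} [DirectSum.Decomposition ℒ]
  [GradedAlgebra 𝒜] [SetLike.GradedSMul 𝒜 ℒ]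

theorem wins_unitWord_left {M : Type*} [AddCommGroup M] [Module K M] (d : ℤ) (x : M)
    (X : WordFun ℒ L) : wins d (unitWord x) X = 0 :=
  funext fun w => shuf_zero w

theorem algDer_commutator {d e : ℤ} {D E : A →ₗ[K] A} (hD : D ∈ algDer 𝒜 d)
    (hE : E ∈ algDer 𝒜 e) : D ∘ₗ E - sgn K (d * e) • E ∘ₗ D ∈ algDer 𝒜 (d + e) := by
  refine ⟨fun i a ha => Submodule.sub_mem _ ?_ (Submodule.smul_mem _ _ ?_), fun i a b ha => ?_⟩
  · rw [add_assoc]; exact hD.1 _ _ (hE.1 _ _ ha)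
  · rw [add_comm d e, add_assoc]; exact hE.1 _ _ (hD.1 _ _ ha)
  · have h1 := hD.2 _ _ b (hE.1 _ _ ha)
    have h2 := hE.2 _ _ b (hD.1 _ _ ha)
    simp only [LinearMap.sub_apply, LinearMap.smul_apply, LinearMap.comp_apply, hD.2 _ _ _ ha,
      hE.2 _ _ _ ha, map_add, map_smul, h1, h2, sub_mul, mul_sub, smul_mul_assoc, mul_smul_comm]
    generalize D (E a) * b = t₁, E a * D b = t₂, D a * E b = t₃, a * D (E b) = t₄,
      E (D a) * b = t₅, a * E (D b) = t₆
    match_scalars <;> (try simp only [mul_one, mul_add, add_mul, sgn_add, mul_comm (G := ℤ)]) <;>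
      grind [sgn_mul_self]

variable (𝒜) in
theorem linearMap_ext_homogeneous {M : Type*} [AddCommGroup M] [Module K M] {f g : A →ₗ[K] M}
    (h : ∀ (i : ℤ) (a : A), a ∈ 𝒜 i → f a = g a) : f = g := by
  ext a
  induction a using DirectSum.Decomposition.inductionOn 𝒜 with
  | zero => simp
  | homogeneous a => exact h _ _ a.2
  | add a b ha hb => rw [map_add, map_add, ha, hb]

/-- The Leibniz rule in terms of contractions. -/
theorem leibniz_iff {d : ℤ} {X : WordFun ℒ L} {σ : WordFun ℒ (A →ₗ[K] A)} :
    LeibnizWord 𝒜 (actionMap K A L) d X σ ↔ ∀ (r : ℤ) (a : A), a ∈ 𝒜 r → ∀ x : Letter ℒ,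
      contract (smulLetter r a x) X =
        wmul (actionMap K A L) x.1 (wordEta d X σ r (unitWord a)) (unitWord (x.2 : L)) +
          sgn K (d * r) • wmul (actionMap K A L) (d + x.1) (unitWord a) (contract x X) := by
  have key : ∀ (r : ℤ) (a : A) (x : Letter ℒ) (w : List (Letter ℒ)),
      (wmul (actionMap K A L) x.1 (wordEta d X σ r (unitWord a)) (unitWord (x.2 : L)) +
        sgn K (d * r) • wmul (actionMap K A L) (d + x.1) (unitWord a) (contract x X)) w =
      sgn K ((x.1 + r) * wdeg w) • actionMap K A L (σ w a) x.2 + sgn K (d * r) • a • X (x :: w) := by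
    intro r a x w
    simp only [wordEta_unitWord, Pi.add_apply, Pi.smul_apply, wmul_unitWord_left,
      wmul_unitWord_right, contract_apply, actionMap_apply, smul_assoc]
    rw [smul_smul, ← sgn_add, add_mul]
  refine ⟨fun h r a ha x => funext fun w => ?_, fun h r a ha x w => ?_⟩
  · rw [key, contract_apply, h r a ha x w]
  · rw [← key, ← h r a ha x, contract_apply]

/-- The adjoint action of a multiderivation on products. -/
theorem IsMultiderWord.wordBracket_actionMap {d : ℤ} {X : WordFun ℒ L}
    {σ : WordFun ℒ (A →ₗ[K] A)} (h : IsMultiderWord 𝒜 d X σ) {c z : ℤ} {φ : WordFun ℒ A}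
    {Z : WordFun ℒ L} (hφ : HasWordDegree 𝒜 c φ) (hφ₁ : IsSymWord φ) (hZ : HasWordDegree ℒ z Z)
    (hZ₁ : IsSymWord Z) :
    wordBracket d (c + z) X (wmul (actionMap K A L) z φ Z) =
      wmul (actionMap K A L) z (wordEta d X σ c φ) Z +
        sgn K (d * c) • wmul (actionMap K A L) (d + z) φ (wordBracket d z X Z) := by
  simp only [wordBracket, wordEta, wins_actionMap h.sym h.leibniz hφ hZ, wins_wmul _ _ _ hφ₁ hZ₁,
    map_sub, map_smul, LinearMap.sub_apply, LinearMap.smul_apply, add_comm z d]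
  match_scalars <;> (try simp only [mul_one, mul_add, add_mul, sgn_add, mul_comm (G := ℤ)]) <;>
    grind [sgn_mul_self]

/-- Contraction is an adjoint action, so the Jacobi identity can be used to compute contractions of
brackets. -/
theorem wordBracket_unitWord {d : ℤ} {X : WordFun ℒ L} (hX : IsSymWord X) (x : Letter ℒ) :
    wordBracket d x.1 X (unitWord (x.2 : L)) = contract x X := by
  rw [wordBracket, wins_unitWord_left, smul_zero, sub_zero, wins_unitWord hX, letter_coe]

theorem wordBracket_add_right {d e : ℤ} {X : WordFun ℒ L} (hX : IsSymWord X)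
    (Y Z : WordFun ℒ L) : wordBracket d e X (Y + Z) = wordBracket d e X Y + wordBracket d e X Z := by
  simp only [wordBracket, wins_add_right hX, wins_add_left, smul_add]
  abel

theorem wordBracket_smul_right {d e : ℤ} {X : WordFun ℒ L} (hX : IsSymWord X) (c : K)
    (Y : WordFun ℒ L) : wordBracket d e X (c • Y) = c • wordBracket d e X Y := by
  simp only [wordBracket, wins_smul_right hX, wins_smul_left, smul_sub, smul_comm c]

/-- The two conditions that are hard to expand directly are obtained by testing: the symbol on
constants from `A`, through the representation property, and the Leibniz rule on elements of `L`,
through the Jacobi identity. -/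
theorem IsMultiderWord.bracket {d e : ℤ} {X Y : WordFun ℒ L} {σ τ : WordFun ℒ (A →ₗ[K] A)}
    (hX : IsMultiderWord 𝒜 d X σ) (hY : IsMultiderWord 𝒜 e Y τ) :
    IsMultiderWord 𝒜 (d + e) (wordBracket d e X Y) (wordSymbol d e X σ Y τ) where
  sym := hX.sym.wordBracket hY.sym
  deg := (hX.deg.wins e Y).sub (by
    have := (hY.deg.wins d X).smul (sgn K (d * e))
    rwa [add_comm e d] at this)
  symbol_sym := hX.sym.wordSymbol hX.symbol_sym hY.sym hY.symbol_sym
  symbol_deg := by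
    refine ((hX.symbol_deg.wins e Y).sub ?_).add ?_
    · have := (hY.symbol_deg.wins d X).smul (sgn K (d * e))
      rwa [add_comm e d] at this
    · intro w
      -- A composite of derivations is not a derivation. After the blocks of the second sum are
      -- exchanged, the two composites belonging to one splitting combine to a graded commutator.
      have h1 : wmul (LinearMap.llcomp K A A A) d τ σ w = shuf (fun p q =>
          sgn K (wdeg p * wdeg q + d * wdeg q) • (τ q ∘ₗ σ p)) w := by
        rw [wmul_apply, shuf_comm]
        simp only [smul_smul, ← sgn_add]
        rfl
      rw [Pi.sub_apply, Pi.smul_apply, h1, wmul_apply, ← shuf_smul, ← shuf_sub]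
      refine shuf_mem _ _ _ _ fun p q => ?_
      have h2 := Submodule.smul_mem _ (sgn K (e * wdeg p))
        (algDer_commutator (hX.symbol_deg p) (hY.symbol_deg q))
      convert h2 using 2
      · ring
      · rw [smul_sub, smul_smul, smul_smul, ← sgn_add, ← sgn_add]
        congr 2
        apply sgn_congr_mod; push_cast; grind
  symbol_multilinear := by
    intro v r a ha x w
    refine linearMap_ext_homogeneous 𝒜 fun s b hb => ?_
    have hu : IsSymWord (unitWord b : WordFun ℒ A) := IsSymWord.unitWord b
    have hu₁ : HasWordDegree 𝒜 s (unitWord b : WordFun ℒ A) := HasWordDegree.unitWord hb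
    have hu₂ : IsMultilinearWord 𝒜 s (unitWord b : WordFun ℒ A) := IsMultilinearWord.unitWord s b
    have h1 := wordEta_bracket d e s hX.sym hX.symbol_sym hY.sym hY.symbol_sym hu
    -- Both iterated actions on the constant `b` are multilinear, hence so is the action of the
    -- bracket on it, which is its symbol at `b` up to a sign.
    have h2 := hX.isMultilinearWord_wordEta (hY.sym.wordEta hY.symbol_sym hu)
      (hY.hasWordDegree_wordEta hu₁) (hY.isMultilinearWord_wordEta hu hu₁ hu₂)
    have h3 := hY.isMultilinearWord_wordEta (hX.sym.wordEta hX.symbol_sym hu)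
      (hX.hasWordDegree_wordEta hu₁) (hX.isMultilinearWord_wordEta hu hu₁ hu₂)
    rw [add_left_comm] at h3
    have h4 := (h2.sub (h3.smul (sgn K (d * e)))) v r a ha x w
    rw [← h1, wordEta_unitWord] at h4
    simp only [wdeg_append, wdeg_cons, smulLetter_fst] at h4
    rw [smul_smul_comm'] at h4
    have h5 := congrArg (sgn K (s * (wdeg v + (r + x.1 + wdeg w))) • ·) h4
    simp only [sgn_smul_sgn_smul] at h5
    rw [h5, LinearMap.smul_apply, LinearMap.smul_apply, smul_smul, smul_smul]
    congr 1
    rw [← sgn_add, ← sgn_add]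
    apply sgn_congr_mod; push_cast; grind
  leibniz := by
    rw [leibniz_iff]
    intro r a ha x
    have hu : IsSymWord (unitWord a : WordFun ℒ A) := IsSymWord.unitWord a
    have hu₁ : HasWordDegree 𝒜 r (unitWord a : WordFun ℒ A) := HasWordDegree.unitWord ha
    have hx : IsSymWord (unitWord (x.2 : L) : WordFun ℒ L) := IsSymWord.unitWord _
    have hx₁ : HasWordDegree ℒ x.1 (unitWord (x.2 : L) : WordFun ℒ L) :=
      HasWordDegree.unitWord x.2.2
    have hax : (unitWord ((smulLetter r a x).2 : L) : WordFun ℒ L) =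
        wmul (actionMap K A L) x.1 (unitWord a) (unitWord (x.2 : L)) := by
      rw [smulLetter_snd ha, wmul_unitWord_left]
      funext w
      cases w <;> simp
    have hax₁ : IsSymWord (unitWord ((smulLetter r a x).2 : L) : WordFun ℒ L) :=
      IsSymWord.unitWord _
    have h1 : ∀ {d : ℤ} {X : WordFun ℒ L} {σ : WordFun ℒ (A →ₗ[K] A)},
        IsMultiderWord 𝒜 d X σ → wordBracket d (smulLetter r a x).1 X
          (unitWord ((smulLetter r a x).2 : L)) =
          wmul (actionMap K A L) x.1 (wordEta d X σ r (unitWord a)) (unitWord (x.2 : L)) +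
          sgn K (d * r) • wmul (actionMap K A L) (d + x.1) (unitWord a) (GradedMultider.contract x X) := by
      intro d X σ h
      rw [hax, smulLetter_fst, h.wordBracket_actionMap hu₁ hu hx₁ hx, wordBracket_unitWord h.sym]
    have hb : ∀ {d : ℤ} {X : WordFun ℒ L}, IsSymWord X →
        wordBracket d x.1 X (unitWord (x.2 : L)) = GradedMultider.contract x X := fun h => wordBracket_unitWord h x
    -- The iterated adjoint action on `a x` has four terms. The two in which one map acts on `a` and
    -- the other on `x` will cancel in the graded commutator.
    have h2 : ∀ {d e : ℤ} {X Y : WordFun ℒ L} {σ τ : WordFun ℒ (A →ₗ[K] A)},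
        IsMultiderWord 𝒜 d X σ → IsMultiderWord 𝒜 e Y τ →
        wordBracket d (e + (smulLetter r a x).1) X (wordBracket e (smulLetter r a x).1 Y
          (unitWord ((smulLetter r a x).2 : L))) =
        wmul (actionMap K A L) x.1 (wordEta d X σ (e + r) (wordEta e Y τ r (unitWord a)))
            (unitWord (x.2 : L)) +
          sgn K (d * (e + r)) • wmul (actionMap K A L) (d + x.1) (wordEta e Y τ r (unitWord a))
            (GradedMultider.contract x X) +
          sgn K (e * r) • wmul (actionMap K A L) (e + x.1) (wordEta d X σ r (unitWord a))
            (GradedMultider.contract x Y) +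
          sgn K (e * r + d * r) • wmul (actionMap K A L) 0 (unitWord a)
            (wordBracket d (e + x.1) X (GradedMultider.contract x Y)) := by
      intro d e X Y σ τ hX hY
      have h3 := hX.wordBracket_actionMap (hY.hasWordDegree_wordEta hu₁)
        (hY.sym.wordEta hY.symbol_sym hu) hx₁ hx
      have h4 := hX.wordBracket_actionMap hu₁ hu (hY.deg.contract x) (hY.sym.contract x)
      rw [h1 hY, wordBracket_add_right hX.sym, wordBracket_smul_right hX.sym, smulLetter_fst,
        ← add_assoc, h3, hb hX.sym, add_assoc, add_comm e r, add_assoc r, h4, smul_add, smul_smul,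
        ← sgn_add, wmul_unitWord_degree _ (d + (e + x.1))]
      abel
    -- The Jacobi identity with third argument `a x` and with third argument `x`; comparing them is
    -- the Leibniz rule for the bracket.
    have h3 := wordBracket_jacobi d e (smulLetter r a x).1 hX.sym hY.sym hax₁
    have h4 := wordBracket_jacobi d e x.1 hX.sym hY.sym hx
    rw [hb hX.sym, hb hY.sym, hb (hX.sym.wordBracket hY.sym)] at h4
    rw [wordBracket_unitWord (hX.sym.wordBracket hY.sym), h2 hX hY, h2 hY hX] at h3
    rw [← sub_eq_iff_eq_add] at h3 h4
    rw [← h3, ← h4, wordEta_bracket d e r hX.sym hX.symbol_sym hY.sym hY.symbol_sym hu,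
      wmul_unitWord_degree _ (d + e + x.1)]
    simp only [map_sub, map_smul, LinearMap.sub_apply, LinearMap.smul_apply]
    match_scalars <;> (try simp only [mul_one, mul_add, add_mul, sgn_add, mul_comm (G := ℤ)]) <;>
      grind [sgn_mul_self]

end Closure

/-! ### Unshuffles and splittings of words -/

namespace Unshuffle

theorem card_eq {k m n : ℕ} (σ : Unshuffle k m n) : k + m = n := by
  simpa using Fintype.card_congr σ.1

theorem ext_iff' {k m n : ℕ} {σ τ : Unshuffle k m n} : σ = τ ↔ ∀ x, σ.1 x = τ.1 x :=
  ⟨fun h _ => h ▸ rfl, fun h => Subtype.ext (Equiv.ext h)⟩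

/-- Unshuffles from injective maps that are monotone on both blocks. -/
def ofInjective {k m n : ℕ} (h : k + m = n) (f : Fin k ⊕ Fin m → Fin n)
    (hf : Function.Injective f) (hl : StrictMono fun a => f (Sum.inl a))
    (hr : StrictMono fun b => f (Sum.inr b)) : Unshuffle k m n :=
  ⟨Equiv.ofBijective f ((Fintype.bijective_iff_injective_and_card f).2 ⟨hf, by simpa using h⟩),
    hl, hr⟩

/-- Adjoins a new smallest letter to the first block. -/
def consLeft {k m n : ℕ} (σ : Unshuffle k m n) : Unshuffle (k + 1) m (n + 1) :=
  ofInjective (by have := σ.card_eq; omega)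
    (Sum.elim (Fin.cons 0 fun a => (σ.1 (Sum.inl a)).succ) fun b => (σ.1 (Sum.inr b)).succ)
    (by
      rintro (a | b) (a' | b')
      · refine Fin.cases ?_ (fun a => ?_) a <;> refine Fin.cases ?_ (fun a' => ?_) a' <;>
          simp [Fin.succ_ne_zero, (Fin.succ_ne_zero _).symm]
      · refine Fin.cases ?_ (fun a => ?_) a <;>
          simp [Fin.succ_ne_zero, (Fin.succ_ne_zero _).symm]
      · refine Fin.cases ?_ (fun a => ?_) a' <;>
          simp [Fin.succ_ne_zero, (Fin.succ_ne_zero _).symm]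
      · simp)
    (by
      intro a a'
      refine Fin.cases ?_ (fun a => ?_) a <;> refine Fin.cases ?_ (fun a' => ?_) a'
      · simp
      · simp [Fin.succ_pos]
      · simp
      · simpa using fun h => σ.2.1 h)
    (by
      intro b b' h
      simpa using σ.2.2 h)

/-- Adjoins a new smallest letter to the second block. -/
def consRight {k m n : ℕ} (σ : Unshuffle k m n) : Unshuffle k (m + 1) (n + 1) :=
  ofInjective (by have := σ.card_eq; omega)
    (Sum.elim (fun b => (σ.1 (Sum.inl b)).succ) (Fin.cons 0 fun a => (σ.1 (Sum.inr a)).succ))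
    (by
      rintro (b | a) (b' | a')
      · simp
      · refine Fin.cases ?_ (fun a => ?_) a' <;>
          simp [Fin.succ_ne_zero, (Fin.succ_ne_zero _).symm]
      · refine Fin.cases ?_ (fun a => ?_) a <;>
          simp [Fin.succ_ne_zero, (Fin.succ_ne_zero _).symm]
      · refine Fin.cases ?_ (fun a => ?_) a <;> refine Fin.cases ?_ (fun a' => ?_) a' <;>
          simp [Fin.succ_ne_zero, (Fin.succ_ne_zero _).symm])
    (by
      intro b b' h
      simpa using σ.2.1 h)
    (by
      intro a a'
      refine Fin.cases ?_ (fun a => ?_) a <;> refine Fin.cases ?_ (fun a' => ?_) a'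
      · simp
      · simp [Fin.succ_pos]
      · simp
      · simpa using fun h => σ.2.2 h)

section

variable {k m n : ℕ} (σ : Unshuffle k m n)

@[simp] theorem consLeft_inl_zero : σ.consLeft.1 (Sum.inl 0) = 0 := rfl
@[simp] theorem consLeft_inl_succ (a : Fin k) :
    σ.consLeft.1 (Sum.inl a.succ) = (σ.1 (Sum.inl a)).succ := rfl
@[simp] theorem consLeft_inr (b : Fin m) :
    σ.consLeft.1 (Sum.inr b) = (σ.1 (Sum.inr b)).succ := rfl
@[simp] theorem consRight_inr_zero : σ.consRight.1 (Sum.inr 0) = 0 := rfl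
@[simp] theorem consRight_inr_succ (b : Fin m) :
    σ.consRight.1 (Sum.inr b.succ) = (σ.1 (Sum.inr b)).succ := rfl
@[simp] theorem consRight_inl (a : Fin k) :
    σ.consRight.1 (Sum.inl a) = (σ.1 (Sum.inl a)).succ := rfl

end

theorem consLeft_injective {k m n : ℕ} :
    Function.Injective (consLeft : Unshuffle k m n → Unshuffle (k + 1) m (n + 1)) := by
  intro σ τ h
  rw [ext_iff'] at h ⊢
  rintro (a | b)
  · simpa using h (Sum.inl a.succ)
  · simpa using h (Sum.inr b)

theorem consRight_injective {k m n : ℕ} :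
    Function.Injective (consRight : Unshuffle k m n → Unshuffle k (m + 1) (n + 1)) := by
  intro σ τ h
  rw [ext_iff'] at h ⊢
  rintro (a | b)
  · simpa using h (Sum.inl a)
  · simpa using h (Sum.inr b.succ)

/-- Monotonicity on the first block forces its first position to carry the smallest letter, which
can then be removed. -/
theorem exists_consLeft {k m n : ℕ} (σ : Unshuffle (k + 1) m (n + 1)) {a : Fin (k + 1)}
    (h : σ.1.symm 0 = Sum.inl a) : ∃ τ : Unshuffle k m n, consLeft τ = σ := by
  have h0 : σ.1 (Sum.inl 0) = 0 := by
    have h1 : σ.1 (Sum.inl a) = 0 := by rw [← h]; simp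
    have h2 := σ.2.1.monotone (Fin.zero_le a)
    simpa [h1] using h2
  have hl : ∀ a : Fin k, σ.1 (Sum.inl a.succ) ≠ 0 := fun a ha => by
    have := σ.1.injective (ha.trans h0.symm)
    simp at this
  have hr : ∀ b : Fin m, σ.1 (Sum.inr b) ≠ 0 := fun b hb => by
    have := σ.1.injective (hb.trans h0.symm)
    simp at this
  refine ⟨ofInjective (by have := σ.card_eq; omega)
    (Sum.elim (fun a => (σ.1 (Sum.inl a.succ)).pred (hl a)) fun b => (σ.1 (Sum.inr b)).pred (hr b))
    ?_ ?_ ?_, ?_⟩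
  · rintro (a | b) (a' | b') <;> simp [Fin.pred_inj]
  · intro a a' haa
    simpa using σ.2.1 (Fin.succ_lt_succ_iff.2 haa)
  · intro b b' hbb
    simpa using σ.2.2 hbb
  · rw [ext_iff']
    rintro (a | b)
    · refine Fin.cases ?_ (fun a => ?_) a
      · simpa using h0.symm
      · simp [ofInjective]
    · simp [ofInjective]

theorem exists_consRight {k m n : ℕ} (σ : Unshuffle k (m + 1) (n + 1)) {a : Fin (m + 1)}
    (h : σ.1.symm 0 = Sum.inr a) : ∃ τ : Unshuffle k m n, consRight τ = σ := by
  have h0 : σ.1 (Sum.inr 0) = 0 := by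
    have h1 : σ.1 (Sum.inr a) = 0 := by rw [← h]; simp
    have h2 := σ.2.2.monotone (Fin.zero_le a)
    simpa [h1] using h2
  have hl : ∀ a : Fin m, σ.1 (Sum.inr a.succ) ≠ 0 := fun a ha => by
    have := σ.1.injective (ha.trans h0.symm)
    simp at this
  have hr : ∀ b : Fin k, σ.1 (Sum.inl b) ≠ 0 := fun b hb => by
    have := σ.1.injective (hb.trans h0.symm)
    simp at this
  refine ⟨ofInjective (by have := σ.card_eq; omega)
    (Sum.elim (fun b => (σ.1 (Sum.inl b)).pred (hr b)) fun a => (σ.1 (Sum.inr a.succ)).pred (hl a))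
    ?_ ?_ ?_, ?_⟩
  · rintro (a | b) (a' | b') <;> simp [Fin.pred_inj]
  · intro b b' hbb
    simpa using σ.2.1 hbb
  · intro a a' haa
    simpa using σ.2.2 (Fin.succ_lt_succ_iff.2 haa)
  · rw [ext_iff']
    rintro (b | a)
    · simp [ofInjective]
    · refine Fin.cases ?_ (fun a => ?_) a
      · simpa using h0.symm
      · simp [ofInjective]

/-- A smallest letter in the first block is part of no inversion. -/
theorem koszulExp_consLeft {k m n : ℕ} (σ : Unshuffle k m n) (ν : Fin (k + 1) ⊕ Fin m → ℤ) :
    koszulExp σ.consLeft ν = koszulExp σ fun x => ν (Sum.map Fin.succ id x) := by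
  simp [koszulExp, Fin.sum_univ_succ]

/-- A smallest letter in the second block is inverted with every letter of the first; this is the
sign in the recursion of `shuf`. -/
theorem koszulExp_consRight {k m n : ℕ} (σ : Unshuffle k m n) (ν : Fin k ⊕ Fin (m + 1) → ℤ) :
    koszulExp σ.consRight ν = (∑ a, ν (Sum.inl a)) * ν (Sum.inr 0) +
      koszulExp σ fun x => ν (Sum.map id Fin.succ x) := by
  simp [koszulExp, Fin.sum_univ_succ, Fin.succ_pos, Finset.sum_add_distrib, Finset.sum_mul]

end Unshuffle

/-- Splits a sum over unshuffles according to the block that contains the first letter. -/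
theorem sum_unshuffle_succ {M : Type*} [AddCommMonoid M] {k m n : ℕ}
    (F : Unshuffle k m (n + 1) → M) :
    ∑ σ, F σ = (∑ σ, if (σ.1.symm 0).isLeft then F σ else 0) +
      ∑ σ, if (σ.1.symm 0).isLeft then 0 else F σ := by
  rw [← Finset.sum_add_distrib]
  refine Finset.sum_congr rfl fun σ _ => ?_
  split_ifs <;> simp

theorem sum_consLeft {M : Type*} [AddCommMonoid M] {k m n : ℕ}
    (F : Unshuffle (k + 1) m (n + 1) → M) :
    (∑ σ, if (σ.1.symm 0).isLeft then F σ else 0) = ∑ σ : Unshuffle k m n, F σ.consLeft := by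
  symm
  refine Fintype.sum_of_injective Unshuffle.consLeft Unshuffle.consLeft_injective _ _ ?_ ?_
  · intro σ hσ
    rcases h : σ.1.symm 0 with a | b
    · exact absurd (σ.exists_consLeft h) (by simpa using hσ)
    · simp
  · intro σ
    have : σ.consLeft.1.symm 0 = Sum.inl 0 := by rw [Equiv.symm_apply_eq]; simp
    simp [this]

theorem sum_consRight {M : Type*} [AddCommMonoid M] {k m n : ℕ}
    (F : Unshuffle k (m + 1) (n + 1) → M) :
    (∑ σ, if (σ.1.symm 0).isLeft then 0 else F σ) = ∑ σ : Unshuffle k m n, F σ.consRight := by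
  symm
  refine Fintype.sum_of_injective Unshuffle.consRight Unshuffle.consRight_injective _ _ ?_ ?_
  · intro σ hσ
    rcases h : σ.1.symm 0 with a | b
    · simp
    · exact absurd (σ.exists_consRight h) (by simpa using hσ)
  · intro σ
    have : σ.consRight.1.symm 0 = Sum.inr 0 := by rw [Equiv.symm_apply_eq]; simp
    simp [this]

/-! ### Multilinear maps as functions of words -/

section Letters

variable {K : Type*} [Field K] {L : Type*} [AddCommGroup L] [Module K L] {ℒ : ℤ → Submodule K L}
  {M : Type*} [AddCommGroup M] [Module K M]

/-- The first `n` letters of a word, continued by zero. -/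
def letters (n : ℕ) (w : List (Letter ℒ)) : Fin n → Letter ℒ := fun i => w.getD i ⟨0, 0⟩

@[simp] theorem letters_cons_zero {n : ℕ} (x : Letter ℒ) (w : List (Letter ℒ)) :
    letters (n + 1) (x :: w) 0 = x := rfl

@[simp] theorem letters_cons_succ {n : ℕ} (x : Letter ℒ) (w : List (Letter ℒ)) (i : Fin n) :
    letters (n + 1) (x :: w) i.succ = letters n w i := rfl

theorem letters_cons {n : ℕ} (x : Letter ℒ) (w : List (Letter ℒ)) :
    letters (n + 1) (x :: w) = Fin.cons x (letters n w) := by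
  funext i
  refine Fin.cases ?_ (fun i => ?_) i <;> simp

theorem letters_ofFn {n : ℕ} (ξ : Fin n → Letter ℒ) : letters n (List.ofFn ξ) = ξ := by
  funext i
  simp [letters, List.getD_eq_getElem?_getD]

theorem ofFn_letters {n : ℕ} {w : List (Letter ℒ)} (h : w.length = n) :
    List.ofFn (letters n w) = w := by
  subst h
  refine List.ext_getElem (by simp) fun i h1 h2 => ?_
  simp [letters, List.getD_eq_getElem?_getD, h2]

theorem wdeg_eq_sum {n : ℕ} {w : List (Letter ℒ)} (h : w.length = n) :
    wdeg w = ∑ i, (letters n w i).1 := by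
  induction w generalizing n with
  | nil => subst h; simp
  | cons x w ih =>
    subst h
    simp [Fin.sum_univ_succ, ih rfl]

/-- A signed sum over unshuffles as a sum over splittings of a word. -/
theorem sum_unshuffle_eq_shuf {k m n : ℕ} (G : (Fin k ⊕ Fin m → Letter ℒ) → M)
    (ξ : Fin n → Letter ℒ) :
    ∑ σ : Unshuffle k m n, sgn K (koszulExp σ fun x => (ξ (σ.1 x)).1) • G (fun x => ξ (σ.1 x)) =
      shuf (fun p q => if p.length = k ∧ q.length = m then
        G (Sum.elim (letters k p) (letters m q)) else 0) (List.ofFn ξ) := by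
  induction n generalizing k m with
  | zero =>
    by_cases h : k = 0 ∧ m = 0
    · obtain ⟨rfl, rfl⟩ := h
      let σ₀ : Unshuffle 0 0 0 := Unshuffle.ofInjective rfl (fun x => (isEmptyElim x))
        (fun x => isEmptyElim x) (fun x => isEmptyElim x) (fun x => isEmptyElim x)
      have : Unique (Unshuffle 0 0 0) := ⟨⟨σ₀⟩, fun σ => Unshuffle.ext_iff'.2 fun x => isEmptyElim x⟩
      rw [Fintype.sum_unique]
      simp only [koszulExp, Finset.univ_eq_empty, Finset.sum_empty, sgn_zero, one_smul, shuf,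
        List.ofFn_zero, List.length_nil, and_self, if_true]
      congr 1
      funext x
      exact isEmptyElim x
    · have : IsEmpty (Unshuffle k m 0) := ⟨fun σ => h (by have := σ.card_eq; omega)⟩
      rw [Finset.univ_eq_empty, Finset.sum_empty]
      simp only [shuf, List.ofFn_zero, List.length_nil]
      rw [if_neg fun h' => h ⟨h'.1.symm, h'.2.symm⟩]
  | succ n ih =>
    rw [sum_unshuffle_succ, List.ofFn_succ, shuf_cons]
    congr 1
    -- With an empty first block, no unshuffle has the letter `0` on the left and no splitting of
    -- the required lengths starts on the left, so both sides vanish.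
    · rcases k with _ | k
      · rw [Finset.sum_eq_zero, shuf_eq_zero]
        · simp
        · intro σ _
          rcases h : σ.1.symm 0 with a | b
          · exact isEmptyElim a
          · simp
      · rw [sum_consLeft]
        simp only [Unshuffle.koszulExp_consLeft]
        refine Eq.trans ?_ ((ih (fun z => G (Sum.elim (Fin.cons (ξ 0) fun a => z (Sum.inl a))
          fun b => z (Sum.inr b))) fun i => ξ i.succ).trans ?_)
        · refine Finset.sum_congr rfl fun σ _ => ?_
          have e1 : (fun x => (ξ (σ.consLeft.1 (Sum.map Fin.succ id x))).1) =
              fun x => (ξ (σ.1 x).succ).1 := by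
            funext x
            rcases x with a | b <;> simp
          have e2 : (fun x => ξ (σ.consLeft.1 x)) = Sum.elim
              (Fin.cons (ξ 0) fun a => ξ (σ.1 (Sum.inl a)).succ)
              fun b => ξ (σ.1 (Sum.inr b)).succ := by
            funext x
            rcases x with a | b
            · refine Fin.cases ?_ (fun a => ?_) a <;> simp
            · simp
          rw [e1, e2]
        · congr 1
          funext p q
          simp only [List.length_cons, Nat.add_right_cancel_iff, letters_cons, Sum.elim_inl,
            Sum.elim_inr]
    · rcases m with _ | m
      · rw [Finset.sum_eq_zero, shuf_eq_zero]
        · simp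
        · intro σ _
          rcases h : σ.1.symm 0 with a | b
          · simp
          · exact isEmptyElim b
      · rw [sum_consRight]
        simp only [Unshuffle.koszulExp_consRight]
        refine Eq.trans ?_ ((ih (fun z => sgn K ((ξ 0).1 * ∑ a, (z (Sum.inl a)).1) •
          G (Sum.elim (fun a => z (Sum.inl a)) (Fin.cons (ξ 0) fun b => z (Sum.inr b))))
          fun i => ξ i.succ).trans ?_)
        · refine Finset.sum_congr rfl fun σ _ => ?_
          have e1 : (fun x => (ξ (σ.consRight.1 (Sum.map id Fin.succ x))).1) =
              fun x => (ξ (σ.1 x).succ).1 := by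
            funext x
            rcases x with a | b <;> simp
          have e2 : (fun x => ξ (σ.consRight.1 x)) = Sum.elim
              (fun a => ξ (σ.1 (Sum.inl a)).succ)
              (Fin.cons (ξ 0) fun b => ξ (σ.1 (Sum.inr b)).succ) := by
            funext x
            rcases x with a | b
            · simp
            · refine Fin.cases ?_ (fun a => ?_) b <;> simp
          rw [e1, e2, smul_smul, ← sgn_add, add_comm]
          simp [mul_comm]
        · congr 1
          funext p q
          simp only [List.length_cons, Nat.add_right_cancel_iff, letters_cons, Sum.elim_inl,
            Sum.elim_inr]
          split_ifs with h
          · rw [wdeg_eq_sum h.1]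
          · rw [smul_zero]

/-- A multilinear map as a function of words. -/
def wordOf {k : ℕ} (f : Raw K L k M) : WordFun ℒ M := fun w =>
  if w.length = k then f (fun i => ((letters k w i).2 : L)) else 0

theorem wordOf_apply {k : ℕ} (f : Raw K L k M) {w : List (Letter ℒ)} (h : w.length = k) :
    wordOf f w = f (fun i => ((letters k w i).2 : L)) := if_pos h

theorem wordOf_eq_zero {k : ℕ} (f : Raw K L k M) {w : List (Letter ℒ)} (h : w.length ≠ k) :
    wordOf f w = 0 := if_neg h

theorem wordOf_ofFn {k : ℕ} (f : Raw K L k M) (ξ : Fin k → Letter ℒ) :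
    wordOf f (List.ofFn ξ) = f (fun i => ((ξ i).2 : L)) := by
  rw [wordOf_apply f (by simp), letters_ofFn]

variable [DirectSum.Decomposition ℒ]

/-- The additional sign depends only on the degrees in the two blocks, so it can be absorbed into
the summand before passing to splittings. -/
theorem wordOf_shuffleSum {k m n : ℕ} (c : (Fin k ⊕ Fin m → ℤ) → ℤ)
    (T : MultilinearMap K (fun _ : Fin k ⊕ Fin m => L) M) {w : List (Letter ℒ)}
    (h : w.length = n) :
    wordOf (shuffleSum ℒ n c T) w = shuf (fun p q => if p.length = k ∧ q.length = m then
      sgn K (c fun x => (Sum.elim (letters k p) (letters m q) x).1) •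
        T (fun x => ((Sum.elim (letters k p) (letters m q) x).2 : L)) else 0) w := by
  rw [wordOf_apply _ h, shuffleSum_apply ℒ c T (fun i => (letters n w i).1) _
    fun i => (letters n w i).2.2]
  conv_rhs => rw [← ofFn_letters h]
  refine Eq.trans ?_ (sum_unshuffle_eq_shuf
    (fun z : Fin k ⊕ Fin m → Letter ℒ => sgn K (c fun x => (z x).1) • T fun x => ((z x).2 : L)) _)
  refine Finset.sum_congr rfl fun σ _ => ?_
  rw [smul_smul, ← sgn_add]

variable {M₁ : Type*} [AddCommGroup M₁] [Module K M₁] {M₂ : Type*} [AddCommGroup M₂] [Module K M₂]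

theorem wmul_wordOf_eq_zero (B : M₁ →ₗ[K] M₂ →ₗ[K] M) (e : ℤ) {k m : ℕ} (f : Raw K L k M₁)
    (g : Raw K L m M₂) {w : List (Letter ℒ)} (h : w.length ≠ k + m) :
    wmul B e (wordOf f) (wordOf g) w = 0 := by
  refine shuf_eq_zero _ _ fun p q hpq => ?_
  by_cases hp : p.length = k
  · rw [wordOf_eq_zero g (by omega), map_zero, smul_zero]
  · rw [wordOf_eq_zero f hp, map_zero, LinearMap.zero_apply, smul_zero]

theorem wordOf_shuffleSum_pairing (B : M₁ →ₗ[K] M₂ →ₗ[K] M) (e : ℤ) {k m n : ℕ}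
    (f : Raw K L k M₁) (g : Raw K L m M₂) (w : List (Letter ℒ)) :
    wordOf (shuffleSum ℒ n (fun ν => e * degL ν) (pairing B f g)) w =
      if w.length = n then wmul B e (wordOf f) (wordOf g) w else 0 := by
  split_ifs with h
  · rw [wordOf_shuffleSum _ _ h, wmul_apply]
    congr 1
    funext p q
    split_ifs with hpq
    · rw [wordOf_apply f hpq.1, wordOf_apply g hpq.2, wdeg_eq_sum hpq.1]
      rfl
    · by_cases hp : p.length = k
      · rw [wordOf_eq_zero g (fun hq => hpq ⟨hp, hq⟩), map_zero, smul_zero]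
      · rw [wordOf_eq_zero f hp, map_zero, LinearMap.zero_apply, smul_zero]
  · exact wordOf_eq_zero _ h

/-- In each splitting either `f` gets a word of the wrong length, or the inserted value of `g` is
zero and multilinearity of `f` applies. If `k = 0`, the inserted letter already makes the word too
long. -/
theorem wins_wordOf_eq_zero (e : ℤ) {k m : ℕ} (f : Raw K L k M)
    (g : Raw K L m L) {w : List (Letter ℒ)} (h : w.length + 1 ≠ k + m ∨ k = 0) :
    wins e (wordOf f) (wordOf g) w = 0 := by
  refine shuf_eq_zero _ _ fun p q hpq => ?_
  by_cases hq : q.length + 1 = k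
  · rw [wordOf_eq_zero g (by omega)]
    rw [wordOf_apply f (by simpa using hq)]
    subst hq
    exact f.map_coord_zero 0 (by simp [letter])
  · exact wordOf_eq_zero f (by simpa using hq)

/-- The degree of `g` ensures that the projection built into `wins` keeps its values. -/
theorem wordOf_insertion (e : ℤ) {k m n : ℕ} (f : Raw K L k M) {g : Raw K L m L}
    (hg : HasDegree ℒ ℒ e g) (w : List (Letter ℒ)) :
    wordOf (insertion ℒ n f g) w =
      if w.length = n then wins e (wordOf f) (wordOf g) w else 0 := by
  split_ifs with h
  · rcases k with _ | k
    · rw [wins_wordOf_eq_zero e f g (Or.inr rfl)]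
      change wordOf (0 : Raw K L n M) w = 0
      rw [wordOf_apply _ h, zero_apply]
    · change wordOf (shuffleSum ℒ n (fun _ => 0) (insertFirst f g)) w = _
      rw [wordOf_shuffleSum _ _ h, wins]
      congr 1
      funext p q
      split_ifs with hpq
      · rw [wordOf_apply f (by simpa using hpq.2), wordOf_apply g hpq.1, sgn_zero, one_smul]
        have h1 : g (fun i => ((letters m p i).2 : L)) ∈ ℒ (e + wdeg p) := by
          rw [wdeg_eq_sum hpq.1]
          exact hg _ _ fun i => (letters m p i).2.2
        change f _ = f _
        congr 1
        funext i
        refine Fin.cases ?_ (fun i => ?_) i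
        · rw [letters_cons_zero, letter_snd h1]
          rfl
        · rfl
      · by_cases hq : q.length = k
        · rw [wordOf_eq_zero g (fun hp => hpq ⟨hp, hq⟩)]
          rw [wordOf_apply f (by simpa using hq)]
          exact (f.map_coord_zero 0 (by simp [letter])).symm
        · exact (wordOf_eq_zero f (by simpa using hq)).symm
  · exact wordOf_eq_zero _ h

end Letters

/-! ### Degree and symmetry conditions on maps and on words -/

section Dictionary

variable {K : Type*} [Field K] {L : Type*} [AddCommGroup L] [Module K L] {ℒ : ℤ → Submodule K L}
  {M : Type*} [AddCommGroup M] [Module K M]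

theorem letters_append_cons {n : ℕ} (v : List (Letter ℒ)) (x y : Letter ℒ) (w : List (Letter ℒ))
    (h : v.length < n) :
    letters n (v ++ y :: w) = Function.update (letters n (v ++ x :: w)) ⟨v.length, h⟩ y := by
  induction v generalizing n with
  | nil =>
    rcases n with _ | n
    · simp at h
    · funext i
      refine Fin.cases ?_ (fun i => ?_) i <;> simp [Fin.ext_iff]
  | cons z v ih =>
    rcases n with _ | n
    · simp at h
    · have h' : v.length < n := by simpa using h
      funext i
      refine Fin.cases ?_ (fun i => ?_) i
      · simp [Function.update_apply, Fin.ext_iff]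
      · have := congrFun (ih h') i
        simp only [List.cons_append, letters_cons_succ, this, Function.update_apply, Fin.ext_iff,
          Fin.val_succ, List.length_cons, Nat.add_right_cancel_iff]

@[simp] theorem letters_append_length {n : ℕ} (v : List (Letter ℒ)) (x : Letter ℒ)
    (w : List (Letter ℒ)) (h : v.length < n) : letters n (v ++ x :: w) ⟨v.length, h⟩ = x := by
  simp [letters, List.getD_eq_getElem?_getD]

/-- Links adjacent letters of a word with the transpositions `Equiv.swap` in the definition of
graded symmetry. -/
theorem letters_swap {n : ℕ} (v : List (Letter ℒ)) (x y : Letter ℒ) (w : List (Letter ℒ))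
    {i j : Fin n} (hi : (i : ℕ) = v.length) (hj : (j : ℕ) = v.length + 1) :
    letters n (v ++ y :: x :: w) = fun k => letters n (v ++ x :: y :: w) (Equiv.swap i j k) := by
  have hi' : i = ⟨v.length, hi ▸ i.2⟩ := Fin.ext hi
  have hj' : j = ⟨(v ++ [x]).length, by simp [← hj]⟩ := Fin.ext (by simpa using hj)
  have h1 : letters n (v ++ y :: x :: w) = Function.update (letters n (v ++ y :: y :: w)) j x := by
    have := letters_append_cons (n := n) (v ++ [y]) y x w (by simp [← hj])
    have e : (⟨(v ++ [y]).length, by simp [← hj]⟩ : Fin n) = j := Fin.ext (by simp [hj])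
    rw [e, List.append_assoc, List.append_assoc] at this
    exact this
  have h2 : letters n (v ++ y :: y :: w) = Function.update (letters n (v ++ x :: y :: w)) i y := by
    rw [hi']
    exact letters_append_cons (n := n) v x y (y :: w) (hi ▸ i.2)
  have h3 : letters n (v ++ x :: y :: w) i = x := by rw [hi', letters_append_length]
  have h4 : letters n (v ++ x :: y :: w) j = y := by
    rw [hj']
    have := letters_append_length (n := n) (v ++ [x]) y w (by simp [← hj])
    simpa using this
  have hij : i ≠ j := fun h => by rw [h] at hi; omega
  funext k
  rw [h1, h2, Equiv.swap_apply_def]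
  split_ifs with h5 h6
  · rw [h4, h5, Function.update_of_ne hij, Function.update_self]
  · rw [h3, h6, Function.update_self]
  · rw [Function.update_of_ne h6, Function.update_of_ne h5]

theorem sum_Iio_letters {n : ℕ} (v w : List (Letter ℒ)) (i : Fin n) (hi : (i : ℕ) = v.length) :
    ∑ j ∈ Finset.Iio i, (letters n (v ++ w) j).1 = wdeg v := by
  rw [sum_Iio]
  induction v generalizing n with
  | nil =>
    refine Finset.sum_eq_zero fun j _ => if_neg ?_
    rw [Fin.lt_def, hi]
    simp
  | cons x v ih =>
    rcases n with _ | n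
    · exact isEmptyElim i
    · rw [List.length_cons] at hi
      obtain ⟨i, rfl⟩ : ∃ i' : Fin n, i = i'.succ := by
        refine ⟨⟨v.length, by omega⟩, Fin.ext (by simpa using hi)⟩
      rw [Fin.sum_univ_succ, wdeg_cons, ← ih i (by simpa using hi)]
      simp

theorem exists_split {n : ℕ} (ξ : Fin n → Letter ℒ) (i : Fin n) :
    ∃ v w, List.ofFn ξ = v ++ ξ i :: w ∧ (i : ℕ) = v.length := by
  refine ⟨(List.ofFn ξ).take i, (List.ofFn ξ).drop (i + 1), ?_, by simp⟩
  have h : (i : ℕ) < (List.ofFn ξ).length := by simp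
  conv_lhs => rw [← List.take_append_drop i (List.ofFn ξ), List.drop_eq_getElem_cons h]
  simp

theorem exists_split₂ {n : ℕ} (ξ : Fin n → Letter ℒ) {i j : Fin n} (hij : (i : ℕ) + 1 = j) :
    ∃ v w, List.ofFn ξ = v ++ ξ i :: ξ j :: w ∧ (i : ℕ) = v.length := by
  refine ⟨(List.ofFn ξ).take i, (List.ofFn ξ).drop (j + 1), ?_, by simp⟩
  have h : (i : ℕ) < (List.ofFn ξ).length := by simp
  have h' : (i : ℕ) + 1 < (List.ofFn ξ).length := by simp [hij]
  conv_lhs => rw [← List.take_append_drop i (List.ofFn ξ), List.drop_eq_getElem_cons h,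
    List.drop_eq_getElem_cons h']
  simp [hij]

theorem update_letters_snd {n : ℕ} (ξ : Fin n → Letter ℒ) (i : Fin n) (y : Letter ℒ) :
    (fun k => ((Function.update ξ i y k).2 : L)) =
      Function.update (fun k => ((ξ k).2 : L)) i (y.2 : L) := by
  funext k
  by_cases h : k = i
  · subst h; rw [Function.update_self, Function.update_self]
  · rw [Function.update_of_ne h, Function.update_of_ne h]

theorem wordOf_append_cons {n : ℕ} (f : Raw K L n M) (v : List (Letter ℒ)) (x y : Letter ℒ)
    (w : List (Letter ℒ)) (h : (v ++ x :: w).length = n) {i : Fin n} (hi : (i : ℕ) = v.length) :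
    wordOf f (v ++ y :: w) =
      f (Function.update (fun k => ((letters n (v ++ x :: w) k).2 : L)) i y.2) := by
  have hi' : (⟨v.length, hi ▸ i.2⟩ : Fin n) = i := Fin.ext hi.symm
  rw [wordOf_apply f (by simpa using h), letters_append_cons v x y w (hi ▸ i.2),
    update_letters_snd, hi']

section

variable [DirectSum.Decomposition ℒ]

/-- Homogeneous elements span `L`, so a multilinear map is determined by its values on words of
letters. -/
theorem wordOf_injective {n : ℕ} :
    Function.Injective (wordOf : Raw K L n M → WordFun ℒ M) := by
  intro f g h
  have h1 : f.compLinearMap (fun _ : Fin n => (DirectSum.decomposeLinearEquiv ℒ).symm.toLinearMap) =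
      g.compLinearMap (fun _ => (DirectSum.decomposeLinearEquiv ℒ).symm.toLinearMap) := by
    refine MultilinearMap.directSum_ext fun δ => MultilinearMap.ext fun z => ?_
    have := congrFun h (List.ofFn fun i => ⟨δ i, z i⟩)
    rw [wordOf_ofFn, wordOf_ofFn] at this
    simpa using this
  ext ξ
  have := congrArg (fun F => F fun i => DirectSum.decomposeLinearEquiv ℒ (ξ i)) h1
  simpa using this

end

theorem hasWordDegree_wordOf {ℳ : ℤ → Submodule K M} {d : ℤ} {n : ℕ} {f : Raw K L n M} :
    HasWordDegree ℳ d (wordOf f : WordFun ℒ M) ↔ HasDegree ℒ ℳ d f := by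
  refine ⟨fun h δ ξ hξ => ?_, fun h w => ?_⟩
  · have := h (List.ofFn fun i => ⟨δ i, ξ i, hξ i⟩)
    rw [wordOf_ofFn, wdeg_eq_sum (n := n) (by simp), letters_ofFn] at this
    exact this
  · by_cases hw : w.length = n
    · rw [wordOf_apply f hw, wdeg_eq_sum hw]
      exact h _ _ fun i => (letters n w i).2.2
    · rw [wordOf_eq_zero f hw]
      exact Submodule.zero_mem _

theorem isSymWord_wordOf {n : ℕ} {f : Raw K L n M} :
    IsSymWord (wordOf f : WordFun ℒ M) ↔ IsGradedSymmetric ℒ f := by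
  refine ⟨fun h δ ξ hξ i j hij => ?_, fun h => ⟨fun v i x y w => ?_, fun v i c x w => ?_,
    fun v x y w => ?_⟩⟩
  · let ζ : Fin n → Letter ℒ := fun i => ⟨δ i, ξ i, hξ i⟩
    obtain ⟨v, w, h1, h2⟩ := exists_split₂ ζ hij
    have h3 := h.swap v (ζ i) (ζ j) w
    have h4 : (v ++ ζ i :: ζ j :: w).length = n := by rw [← h1]; simp
    rw [wordOf_apply f (by simpa using h4), letters_swap v (ζ i) (ζ j) w (i := i) (j := j) h2 (by omega),
      ← h1, letters_ofFn, wordOf_ofFn] at h3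
    exact h3
  · by_cases hw : (v ++ (⟨i, x⟩ : Letter ℒ) :: w).length = n
    · have hi : v.length < n := by rw [← hw]; simp
      rw [wordOf_append_cons f v ⟨i, x⟩ ⟨i, x + y⟩ w hw (i := ⟨v.length, hi⟩) rfl,
        wordOf_append_cons f v ⟨i, x⟩ ⟨i, x⟩ w hw (i := ⟨v.length, hi⟩) rfl,
        wordOf_append_cons f v ⟨i, x⟩ ⟨i, y⟩ w hw (i := ⟨v.length, hi⟩) rfl]
      exact f.map_update_add _ _ _ _
    · rw [wordOf_eq_zero f hw, wordOf_eq_zero f (by simpa using hw),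
        wordOf_eq_zero f (by simpa using hw), add_zero]
  · by_cases hw : (v ++ (⟨i, x⟩ : Letter ℒ) :: w).length = n
    · have hi : v.length < n := by rw [← hw]; simp
      rw [wordOf_append_cons f v ⟨i, x⟩ ⟨i, c • x⟩ w hw (i := ⟨v.length, hi⟩) rfl,
        wordOf_append_cons f v ⟨i, x⟩ ⟨i, x⟩ w hw (i := ⟨v.length, hi⟩) rfl]
      exact f.map_update_smul _ _ _ _
    · rw [wordOf_eq_zero f hw, wordOf_eq_zero f (by simpa using hw), smul_zero]
  · by_cases hw : (v ++ x :: y :: w).length = n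
    · have hi : v.length < n := by rw [← hw]; simp
      have hj : v.length + 1 < n := by rw [← hw]; simp
      rw [wordOf_apply f hw, wordOf_apply f (by simpa using hw),
        letters_swap v x y w (i := ⟨v.length, hi⟩) (j := ⟨v.length + 1, hj⟩) rfl rfl]
      have h1 := h (fun i => (letters n (v ++ x :: y :: w) i).1)
        (fun i => (letters n (v ++ x :: y :: w) i).2)
        (fun i => (letters n (v ++ x :: y :: w) i).2.2) ⟨v.length, hi⟩ ⟨v.length + 1, hj⟩ rfl
      have h2 : letters n (v ++ x :: y :: w) ⟨v.length + 1, hj⟩ = y := by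
        have := letters_append_length (n := n) (v ++ [x]) y w (by simpa using hj)
        simpa using this
      rw [letters_append_length, h2] at h1
      exact h1
    · rw [wordOf_eq_zero f hw, wordOf_eq_zero f (by simpa using hw), smul_zero]

end Dictionary

/-! ### Multilinearity over `A` on maps and on words -/

section Multilinear

variable {K : Type*} [Field K] {A : Type*} [Ring A] [Algebra K A] {𝒜 : ℤ → Submodule K A}
  [GradedAlgebra 𝒜]
  {L : Type*} [AddCommGroup L] [Module K L] [Module A L] [IsScalarTower K A L]
  {ℒ : ℤ → Submodule K L} [DirectSum.Decomposition ℒ] [SetLike.GradedSMul 𝒜 ℒ]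
  {M : Type*} [AddCommGroup M] [Module K M] [Module A M] [IsScalarTower K A M]

theorem isMultilinearWord_wordOf {d : ℤ} {n : ℕ} {f : Raw K L n M} :
    IsMultilinearWord 𝒜 d (wordOf f : WordFun ℒ M) ↔ IsGradedMultilinear 𝒜 ℒ d f := by
  refine ⟨fun h δ ξ hξ i r a ha => ?_, fun h v r a ha x w => ?_⟩
  · let ζ : Fin n → Letter ℒ := fun i => ⟨δ i, ξ i, hξ i⟩
    obtain ⟨v, w, h1, h2⟩ := exists_split ζ i
    have h3 := h v r a ha (ζ i) w
    have h4 : (v ++ ζ i :: w).length = n := by rw [← h1]; simp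
    have h5 : wdeg v = ∑ j ∈ Finset.Iio i, δ j := by
      rw [← sum_Iio_letters v (ζ i :: w) i h2, ← h1, letters_ofFn]
    rw [wordOf_append_cons f v (ζ i) _ w h4 h2, ← h1, wordOf_ofFn, letters_ofFn, smulLetter_snd ha, h5] at h3
    exact h3
  · by_cases hw : (v ++ x :: w).length = n
    · have hi : v.length < n := by rw [← hw]; simp
      rw [wordOf_append_cons f v x _ w hw (i := ⟨v.length, hi⟩) rfl, wordOf_apply f hw, smulLetter_snd ha]
      have h1 := h (fun i => (letters n (v ++ x :: w) i).1)
        (fun i => (letters n (v ++ x :: w) i).2)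
        (fun i => (letters n (v ++ x :: w) i).2.2) ⟨v.length, hi⟩ r a ha
      rw [sum_Iio_letters v (x :: w) _ rfl, letters_append_length] at h1
      exact h1
    · rw [wordOf_eq_zero f hw, wordOf_eq_zero f (by simpa using hw), smul_zero, smul_zero]

-- Adjacent interchanges carry a letter to the end; used to compare the Leibniz rules in the first
-- and in the last place.
omit [DirectSum.Decomposition ℒ] in
theorem IsSymWord.rotate {f : WordFun ℒ M} (hf : IsSymWord f) (v : List (Letter ℒ)) (x : Letter ℒ)
    (w : List (Letter ℒ)) : f (v ++ x :: w) = sgn K (x.1 * wdeg w) • f (v ++ w ++ [x]) := by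
  induction w generalizing v with
  | nil => simp
  | cons y w ih =>
    have h := ih (v ++ [y])
    simp only [List.append_assoc, List.singleton_append] at h
    rw [hf.swap v y x w, h, smul_smul, ← sgn_add, wdeg_cons, mul_comm y.1, mul_add]
    simp

end Multilinear

/-! ### Multilinear maps recovered from functions of words -/

section WordOf

variable {K : Type*} [Field K] {L : Type*} [AddCommGroup L] [Module K L] {ℒ : ℤ → Submodule K L}
  {M : Type*} [AddCommGroup M] [Module K M]

theorem letters_append_castLE {m n : ℕ} (w v : List (Letter ℒ)) (hw : w.length = m) (h : m ≤ n)
    (i : Fin m) : letters n (w ++ v) (Fin.castLE h i) = letters m w i := by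
  simp only [letters, List.getD_eq_getElem?_getD, Fin.val_castLE]
  rw [List.getElem?_append_left (by omega)]

variable (ℒ) in
/-- `wordOf` as a linear map. -/
def wordOfₗ (k : ℕ) : Raw K L k M →ₗ[K] WordFun ℒ M where
  toFun := wordOf
  map_add' f g := by
    funext w
    by_cases h : w.length = k
    · simp only [Pi.add_apply, wordOf_apply _ h, add_apply]
    · simp only [Pi.add_apply, wordOf_eq_zero _ h, add_zero]
  map_smul' c f := by
    funext w
    by_cases h : w.length = k
    · simp only [Pi.smul_apply, wordOf_apply _ h, smul_apply, RingHom.id_apply]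
    · simp only [Pi.smul_apply, wordOf_eq_zero _ h, smul_zero]

@[simp] theorem wordOfₗ_apply (k : ℕ) (f : Raw K L k M) : wordOfₗ ℒ k f = wordOf f := rfl

theorem wordOf_add {k : ℕ} (f g : Raw K L k M) :
    (wordOf (f + g) : WordFun ℒ M) = wordOf f + wordOf g := (wordOfₗ ℒ k).map_add f g

theorem wordOf_sub {k : ℕ} (f g : Raw K L k M) :
    (wordOf (f - g) : WordFun ℒ M) = wordOf f - wordOf g := (wordOfₗ ℒ k).map_sub f g

theorem wordOf_smul {k : ℕ} (c : K) (f : Raw K L k M) :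
    (wordOf (c • f) : WordFun ℒ M) = c • wordOf f := (wordOfₗ ℒ k).map_smul c f

@[simp] theorem wordOf_zero {k : ℕ} : (wordOf (0 : Raw K L k M) : WordFun ℒ M) = 0 :=
  (wordOfₗ ℒ k).map_zero

variable [DirectSum.Decomposition ℒ]

theorem exists_ofFn_update {n : ℕ} (ξ : Fin n → Letter ℒ) (i : Fin n) :
    ∃ v w, ∀ y, List.ofFn (Function.update ξ i y) = v ++ y :: w := by
  obtain ⟨v, w, h1, h2⟩ := exists_split ξ i
  refine ⟨v, w, fun y => ?_⟩
  have hi : v.length < n := h2 ▸ i.2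
  have hi' : (⟨v.length, hi⟩ : Fin n) = i := Fin.ext h2.symm
  have h3 := letters_append_cons v (ξ i) y w hi
  rw [← h1, letters_ofFn, hi'] at h3
  have h4 := congrArg List.length h1
  rw [← h3, ofFn_letters]
  simpa using h4.symm

theorem update_letter {n : ℕ} {δ : Fin n → ℤ} (z : ∀ i, ℒ (δ i)) (i : Fin n) (x : ℒ (δ i)) :
    (fun j => (⟨δ j, Function.update z i x j⟩ : Letter ℒ)) =
      Function.update (fun j => (⟨δ j, z j⟩ : Letter ℒ)) i ⟨δ i, x⟩ := by
  funext j
  by_cases h : j = i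
  · subst h; rw [Function.update_self, Function.update_self]
  · rw [Function.update_of_ne h, Function.update_of_ne h]

/-- A graded symmetric function of words comes from multilinear maps. -/
theorem IsSymWord.exists_wordOf {F : WordFun ℒ M} (hF : IsSymWord F) (n : ℕ) :
    ∃ f : Raw K L n M, ∀ w : List (Letter ℒ), w.length = n → wordOf f w = F w := by
  -- One multilinear map for each tuple of degrees; together they define a map on the direct sum of
  -- the graded pieces, which is `L`.
  let T : (δ : Fin n → ℤ) → MultilinearMap K (fun i => ℒ (δ i)) M := fun δ =>
    { toFun := fun z => F (List.ofFn fun i => ⟨δ i, z i⟩)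
      map_update_add' := by
        intro inst z i x y
        obtain rfl := Subsingleton.elim inst (instDecidableEqFin n)
        obtain ⟨v, w, h⟩ := exists_ofFn_update (fun j => (⟨δ j, z j⟩ : Letter ℒ)) i
        simp only [update_letter, h, hF.add]
      map_update_smul' := by
        intro inst z i c x
        obtain rfl := Subsingleton.elim inst (instDecidableEqFin n)
        obtain ⟨v, w, h⟩ := exists_ofFn_update (fun j => (⟨δ j, z j⟩ : Letter ℒ)) i
        simp only [update_letter, h, hF.smul] }
  refine ⟨(MultilinearMap.fromDirectSumEquiv (ι := Fin n) (κ := fun _ => ℤ) (M := fun _ j => ℒ j)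
      (R := K) (M' := M) T).compLinearMap
      fun _ => (DirectSum.decomposeLinearEquiv ℒ).toLinearMap, fun w hw => ?_⟩
  rw [wordOf_apply _ hw]
  conv_rhs => rw [← ofFn_letters hw]
  have h : (fun i => DirectSum.decomposeLinearEquiv ℒ ((letters n w i).2 : L)) =
      fun i => DirectSum.lof K ℤ (fun j => ℒ j) (letters n w i).1 (letters n w i).2 := by
    funext i
    exact DirectSum.decomposeLinearEquiv_apply_coe ℒ _ _
  rw [MultilinearMap.compLinearMap_apply]
  simp only [LinearEquiv.coe_coe]
  rw [h, MultilinearMap.fromDirectSumEquiv_lof]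
  rfl

end WordOf

/-! ### Multiderivations as pairs of functions of words -/

section Multiderivation

variable {K : Type*} [Field K] {A : Type*} [Ring A] [Algebra K A] {𝒜 : ℤ → Submodule K A}
  [GradedAlgebra 𝒜]
  {L : Type*} [AddCommGroup L] [Module K L] [Module A L] [IsScalarTower K A L]
  {ℒ : ℤ → Submodule K L} [DirectSum.Decomposition ℒ] [SetLike.GradedSMul 𝒜 ℒ]

/-- The Leibniz rule in the last place. -/
theorem leibnizWord_iff_last {d : ℤ} {X : WordFun ℒ L} (hX : IsSymWord X)
    {σ : WordFun ℒ (A →ₗ[K] A)} : LeibnizWord 𝒜 (actionMap K A L) d X σ ↔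
      ∀ (r : ℤ) (a : A), a ∈ 𝒜 r → ∀ (x : Letter ℒ) (w : List (Letter ℒ)),
        X (w ++ [smulLetter r a x]) =
          σ w a • (x.2 : L) + sgn K ((d + wdeg w) * r) • a • X (w ++ [x]) := by
  refine forall₃_congr fun r a ha => forall₂_congr fun x w => ?_
  have h1 := hX.rotate [] (smulLetter r a x) w
  have h2 := hX.rotate [] x w
  simp only [List.nil_append] at h1 h2
  rw [h1, h2, smulLetter_fst, smul_smul_comm', actionMap_apply]
  have h3 : sgn K ((x.1 + r) * wdeg w) • σ w a • (x.2 : L) +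
      sgn K (d * r) • sgn K (x.1 * wdeg w) • a • X (w ++ [x]) =
      sgn K ((r + x.1) * wdeg w) • (σ w a • (x.2 : L) +
        sgn K ((d + wdeg w) * r) • a • X (w ++ [x])) := by
    generalize a • X (w ++ [x]) = y
    generalize σ w a • (x.2 : L) = z
    match_scalars <;> (try simp only [mul_one, mul_add, add_mul, sgn_add, mul_comm (G := ℤ)]) <;>
      grind [sgn_mul_self]
  rw [h3]
  refine ⟨fun h => ?_, fun h => by rw [h]⟩
  have := congrArg (sgn K ((r + x.1) * wdeg w) • ·) h
  simpa only [sgn_smul_sgn_smul] using this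

/-- The vanishing condition remains separate because `k - 1` is truncated: for `k = 0` the symbol
would still be read on the empty word. -/
theorem isMultiderivation_iff {k : ℕ} {d : ℤ} {X : RawPair K A L k} :
    IsMultiderivation 𝒜 ℒ k d X ↔
      (k = 0 → X.2 = 0) ∧ IsMultiderWord 𝒜 d (wordOf X.1 : WordFun ℒ L) (wordOf X.2) := by
  have key : IsSymWord (wordOf X.1 : WordFun ℒ L) → (k = 0 → X.2 = 0) →
      ((∀ (δ : Fin k → ℤ) (ξ : Fin k → L), (∀ i, ξ i ∈ ℒ (δ i)) →
        ∀ (i : Fin k), (i : ℕ) + 1 = k → ∀ (p : ℤ) (a : A), a ∈ 𝒜 p →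
          X.1 (Function.update ξ i (a • ξ i)) =
            X.2 (fun j => ξ (Fin.castLE (Nat.sub_le k 1) j)) a • ξ i +
              sgn K ((d + ∑ j ∈ Finset.Iio i, δ j) * p) • a • X.1 ξ) ↔
        LeibnizWord 𝒜 (actionMap K A L) d (wordOf X.1 : WordFun ℒ L) (wordOf X.2)) := by
    intro hX hz
    rw [leibnizWord_iff_last hX]
    refine ⟨fun h r a ha x w => ?_, fun h δ ξ hξ i hi r a ha => ?_⟩
    · by_cases hw : (w ++ [x]).length = k
      · have hw' : w.length + 1 = k := by simpa using hw
        have hi : w.length < k := by omega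
        have h1 := h (fun i => (letters k (w ++ [x]) i).1) (fun i => (letters k (w ++ [x]) i).2)
          (fun i => (letters k (w ++ [x]) i).2.2) ⟨w.length, hi⟩ hw' r a ha
        rw [sum_Iio_letters w [x] _ rfl, letters_append_length] at h1
        rw [wordOf_append_cons X.1 w x _ [] hw (i := ⟨w.length, hi⟩) rfl, smulLetter_snd ha,
          wordOf_apply X.1 hw, wordOf_apply X.2 (by omega), h1]
        have h2 : (fun j : Fin (k - 1) =>
            ((letters k (w ++ [x]) (Fin.castLE (Nat.sub_le k 1) j)).2 : L)) =
            fun j => ((letters (k - 1) w j).2 : L) := by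
          funext j
          rw [letters_append_castLE w [x] (by omega) (Nat.sub_le k 1)]
        rw [h2]
      · rw [wordOf_eq_zero X.1 hw, wordOf_eq_zero X.1 (by simpa using hw)]
        -- On words of the wrong length the symbol term has to vanish too; for `k = 0` length alone
        -- does not give this, and `hz` is needed.
        have : (wordOf X.2 : WordFun ℒ (A →ₗ[K] A)) w = 0 := by
          rcases k.eq_zero_or_pos with hk | hk
          · rw [hz hk, wordOf_zero]; rfl
          · refine wordOf_eq_zero _ ?_
            rw [List.length_append, List.length_singleton] at hw
            omega
        rw [this, LinearMap.zero_apply, zero_smul, smul_zero, smul_zero, add_zero]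
    · let ζ : Fin k → Letter ℒ := fun i => ⟨δ i, ξ i, hξ i⟩
      obtain ⟨w, v, h1, h2⟩ := exists_split ζ i
      obtain rfl : v = [] := by
        have := congrArg List.length h1
        simp at this
        exact List.eq_nil_of_length_eq_zero (by omega)
      have h3 := h r a ha (ζ i) w
      have h4 : (w ++ [ζ i]).length = k := by rw [← h1]; simp
      have h5 : wdeg w = ∑ j ∈ Finset.Iio i, δ j := by
        rw [← sum_Iio_letters w [ζ i] i h2, ← h1, letters_ofFn]
      rw [wordOf_append_cons X.1 w (ζ i) _ [] h4 h2, wordOf_apply X.2 (by omega), h5,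
        smulLetter_snd ha, ← h1, wordOf_ofFn, letters_ofFn] at h3
      have h6 : (fun j : Fin (k - 1) => ((letters (k - 1) w j).2 : L)) =
          fun j => ξ (Fin.castLE (Nat.sub_le k 1) j) := by
        funext j
        rw [← letters_append_castLE w [ζ i] (by omega) (Nat.sub_le k 1), ← h1, letters_ofFn]
      rw [h6] at h3
      exact h3
  constructor
  · intro h
    have hX := isSymWord_wordOf.2 h.symmetric
    exact ⟨h.symbol_zero, hX, hasWordDegree_wordOf.2 h.hasDegree,
      isSymWord_wordOf.2 h.symbol_symmetric, hasWordDegree_wordOf.2 h.symbol_der,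
      isMultilinearWord_wordOf.2 h.symbol_multilinear, (key hX h.symbol_zero).1 h.leibniz⟩
  · rintro ⟨hz, h⟩
    exact ⟨hasWordDegree_wordOf.1 h.deg, isSymWord_wordOf.1 h.sym, hz,
      hasWordDegree_wordOf.1 h.symbol_deg, isSymWord_wordOf.1 h.symbol_sym,
      isMultilinearWord_wordOf.1 h.symbol_multilinear, (key h.sym hz).2 h.leibniz⟩

theorem mem_symForms_iff {l : ℕ} {e : ℤ} {ω : Raw K L l A} :
    ω ∈ symForms 𝒜 ℒ l e ↔ HasWordDegree 𝒜 e (wordOf ω : WordFun ℒ A) ∧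
      IsSymWord (wordOf ω : WordFun ℒ A) ∧ IsMultilinearWord 𝒜 e (wordOf ω : WordFun ℒ A) := by
  rw [hasWordDegree_wordOf, isSymWord_wordOf, isMultilinearWord_wordOf]
  rfl

end Multiderivation

/-! ### Products of forms and symbol brackets on words -/

section Operations

variable {K : Type*} [Field K] {A : Type*} [Ring A] [Algebra K A]
  {L : Type*} [AddCommGroup L] [Module K L]
  {ℒ : ℤ → Submodule K L} [DirectSum.Decomposition ℒ]

theorem wordOf_formMul {k l : ℕ} (e : ℤ) (ω : Raw K L k A) (ω' : Raw K L l A) :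
    (wordOf (formMul ℒ (k + l) e ω ω') : WordFun ℒ A) =
      wmul (actionMap K A A) e (wordOf ω) (wordOf ω') := by
  funext w
  refine (wordOf_shuffleSum_pairing (LinearMap.mul K A) e ω ω' w).trans ?_
  split_ifs with h
  · rfl
  · exact (wmul_wordOf_eq_zero _ e ω ω' h).symm

/-- The half of the commutators with `τ` applied after `σ` becomes, once the blocks are exchanged,
the product of `τ` and `σ` in the opposite order with the global sign `d * e`. -/
theorem wordOf_symbolBracket {m n N : ℕ} (d e : ℤ) (σ : Raw K L m (A →ₗ[K] A))
    (τ : Raw K L n (A →ₗ[K] A)) {w : List (Letter ℒ)} (h : w.length = N) :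
    wordOf (symbolBracket ℒ N d e σ τ) w =
      (wmul (LinearMap.llcomp K A A A) e (wordOf σ) (wordOf τ) -
        sgn K (d * e) • wmul (LinearMap.llcomp K A A A) d (wordOf τ) (wordOf σ) :
          WordFun ℒ (A →ₗ[K] A)) w := by
  change wordOf (shuffleSum ℒ N (fun ν => e * degL ν) (pairing (LinearMap.llcomp K A A A) σ τ) -
      shuffleSum ℒ N (fun ν => e * degL ν + (d + degL ν) * (e + degR ν))
        (pairing (LinearMap.llcomp K A A A).flip σ τ)) w = _
  rw [wordOf_sub, Pi.sub_apply, Pi.sub_apply, wordOf_shuffleSum_pairing, if_pos h]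
  congr 1
  rw [wordOf_shuffleSum _ _ h, Pi.smul_apply, wmul_apply, shuf_comm (fun p q =>
    sgn K (d * wdeg p) • LinearMap.llcomp K A A A (wordOf τ p) (wordOf σ q)), ← shuf_smul]
  congr 1
  funext p q
  split_ifs with hpq
  · rw [wordOf_apply σ hpq.1, wordOf_apply τ hpq.2, wdeg_eq_sum hpq.1, wdeg_eq_sum hpq.2]
    simp only [smul_smul, ← sgn_add]
    change sgn K (e * ∑ i, (letters m p i).1 + (d + ∑ i, (letters m p i).1) *
      (e + ∑ i, (letters n q i).1)) • _ = _
    congr 1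
    apply sgn_congr_mod
    push_cast
    grind
  · by_cases hp : p.length = m
    · rw [wordOf_eq_zero τ (fun hq => hpq ⟨hp, hq⟩), map_zero, LinearMap.zero_apply, smul_zero,
        smul_zero, smul_zero]
    · rw [wordOf_eq_zero σ hp, map_zero, smul_zero, smul_zero, smul_zero]

end Operations

/-! ### Brackets and actions of pairs with a fixed number of entries -/

section Pairs

variable {K : Type*} [Field K] {A : Type*} [Ring A] [Algebra K A] {𝒜 : ℤ → Submodule K A}
  [GradedAlgebra 𝒜]
  {L : Type*} [AddCommGroup L] [Module K L] [Module A L] [IsScalarTower K A L]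
  {ℒ : ℤ → Submodule K L} [DirectSum.Decomposition ℒ] [SetLike.GradedSMul 𝒜 ℒ]

namespace IsMultiderivation

variable {k : ℕ} {d : ℤ} {X : RawPair K A L k} (hX : IsMultiderivation 𝒜 ℒ k d X)
include hX

theorem isMultiderWord : IsMultiderWord 𝒜 d (wordOf X.1 : WordFun ℒ L) (wordOf X.2) :=
  (isMultiderivation_iff.1 hX).2

/-- Stated with `w.length + 1` to avoid the truncated `k - 1`; for `k = 0` the vanishing of the
symbol takes the place of the count of lengths. -/
theorem wmul_symbol_eq_zero {M₁ M₂ : Type*} [AddCommGroup M₁] [Module K M₁] [AddCommGroup M₂]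
    [Module K M₂] (B : (A →ₗ[K] A) →ₗ[K] M₁ →ₗ[K] M₂) (e : ℤ) {l : ℕ} (f : Raw K L l M₁)
    {w : List (Letter ℒ)} (h : w.length + 1 ≠ k + l ∨ k = 0) :
    wmul B e (wordOf X.2) (wordOf f) w = 0 := by
  rcases k.eq_zero_or_pos with hk | hk
  · rw [hX.symbol_zero hk, wordOf_zero, map_zero]; rfl
  · exact wmul_wordOf_eq_zero B e X.2 f (by omega)

theorem wins_symbol_eq_zero (e : ℤ) {l : ℕ} (Y : Raw K L l L) {w : List (Letter ℒ)}
    (h : w.length + 2 ≠ k + l ∨ k = 0) : wins e (wordOf X.2) (wordOf Y) w = 0 := by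
  rcases k.eq_zero_or_pos with hk | hk
  · rw [hX.symbol_zero hk, wordOf_zero, wins_zero_left]; rfl
  · exact wins_wordOf_eq_zero e X.2 Y (by omega)

theorem wordEta_eq_zero (e : ℤ) {l : ℕ} (ω : Raw K L l A) {w : List (Letter ℒ)}
    (h : w.length + 1 ≠ k + l) : wordEta d (wordOf X.1) (wordOf X.2) e (wordOf ω) w = 0 := by
  rw [wordEta, Pi.sub_apply, Pi.smul_apply, hX.wmul_symbol_eq_zero _ e ω (Or.inl h),
    wins_wordOf_eq_zero d ω X.1 (Or.inl (by omega)), smul_zero, sub_zero]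

theorem wordOf_etaForm (n : ℕ) (e : ℤ) {l : ℕ} (ω : Raw K L l A) (w : List (Letter ℒ)) :
    wordOf (etaForm ℒ n d e X ω) w =
      if w.length = n then wordEta d (wordOf X.1) (wordOf X.2) e (wordOf ω) w else 0 := by
  rw [etaForm, wordOf_sub, wordOf_smul, Pi.sub_apply, Pi.smul_apply, wordOf_shuffleSum_pairing,
    wordOf_insertion d ω hX.hasDegree]
  split_ifs
  · rfl
  · rw [smul_zero, sub_zero]

/-- For other lengths both sides vanish. In the truncated case `k = l = 0` the action itself is
zero. -/
theorem wordOf_etaForm_natural (e : ℤ) {l : ℕ} (ω : Raw K L l A) :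
    wordOf (etaForm ℒ (l + k - 1) d e X ω) = wordEta d (wordOf X.1 : WordFun ℒ L) (wordOf X.2) e
      (wordOf ω) := by
  funext w
  rw [hX.wordOf_etaForm]
  split_ifs with h
  · rfl
  · by_cases hkl : k + l = 0
    · obtain ⟨rfl, rfl⟩ : k = 0 ∧ l = 0 := by omega
      rw [hX.wordEta_eq_zero e ω (by omega)]
    · rw [hX.wordEta_eq_zero e ω (by omega)]

theorem etaForm_eq_zero {n : ℕ} (e : ℤ) {l : ℕ} (ω : Raw K L l A) (h : n ≠ l + k - 1) :
    etaForm ℒ n d e X ω = 0 := by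
  refine wordOf_injective (ℒ := ℒ) ?_
  rw [wordOf_zero]
  funext w
  rw [hX.wordOf_etaForm]
  split_ifs with h'
  · by_cases hkl : k + l = 0
    · rw [hX.wordEta_eq_zero e ω (by omega)]; rfl
    · rw [hX.wordEta_eq_zero e ω (by omega)]; rfl
  · rfl

theorem etaForm_mem {e : ℤ} {l : ℕ} {ω : Raw K L l A} (hω : ω ∈ symForms 𝒜 ℒ l e) :
    etaForm ℒ (l + k - 1) d e X ω ∈ symForms 𝒜 ℒ (l + k - 1) (d + e) := by
  rw [mem_symForms_iff] at hω ⊢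
  rw [hX.wordOf_etaForm_natural]
  exact ⟨hX.isMultiderWord.hasWordDegree_wordEta hω.1,
    hX.isMultiderWord.sym.wordEta hX.isMultiderWord.symbol_sym hω.2.1,
    hX.isMultiderWord.isMultilinearWord_wordEta hω.2.1 hω.1 hω.2.2⟩

variable {l : ℕ} {e : ℤ} {Y : RawPair K A L l} (hY : IsMultiderivation 𝒜 ℒ l e Y)
include hY

theorem wordOf_pairBracket_fst : (wordOf (pairBracket ℒ k l d e X Y).1 : WordFun ℒ L) =
    wordBracket d e (wordOf X.1) (wordOf Y.1) := by
  change wordOf (insertion ℒ (k + l - 1) X.1 Y.1 -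
    sgn K (d * e) • insertion ℒ (k + l - 1) Y.1 X.1) = _
  funext w
  rw [wordOf_sub, wordOf_smul, Pi.sub_apply, Pi.smul_apply, wordOf_insertion e X.1 hY.hasDegree,
    wordOf_insertion d Y.1 hX.hasDegree, wordBracket, Pi.sub_apply, Pi.smul_apply]
  split_ifs with h
  · rfl
  · rw [wins_wordOf_eq_zero e X.1 Y.1 (by omega), wins_wordOf_eq_zero d Y.1 X.1 (by omega)]

theorem pairBracket_snd_eq_zero (h : k + l - 1 = 0) : (pairBracket ℒ k l d e X Y).2 = 0 := by
  refine wordOf_injective (ℒ := ℒ) ?_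
  rw [wordOf_zero]
  change wordOf (insertion ℒ (k + l - 1 - 1) X.2 Y.1 -
    sgn K (d * e) • insertion ℒ (k + l - 1 - 1) Y.2 X.1 +
      symbolBracket ℒ (k + l - 1 - 1) d e X.2 Y.2) = _
  funext w
  by_cases hw : w.length = k + l - 1 - 1
  · rw [wordOf_add, wordOf_sub, wordOf_smul, Pi.add_apply, Pi.sub_apply, Pi.smul_apply,
      wordOf_insertion e X.2 hY.hasDegree, wordOf_insertion d Y.2 hX.hasDegree, if_pos hw,
      if_pos hw, wordOf_symbolBracket d e X.2 Y.2 hw, Pi.sub_apply, Pi.smul_apply,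
      hX.wins_symbol_eq_zero e Y.1 (by omega), hY.wins_symbol_eq_zero d X.1 (by omega)]
    -- A bracket without entries has at most one entry in its two arguments together, so one of the
    -- two symbols is absent.
    have h1 : k = 0 ∨ l = 0 := by omega
    have h2 : (wordOf X.2 : WordFun ℒ (A →ₗ[K] A)) = 0 ∨
        (wordOf Y.2 : WordFun ℒ (A →ₗ[K] A)) = 0 := by
      rcases h1 with h1 | h1
      · left; rw [hX.symbol_zero h1, wordOf_zero]
      · right; rw [hY.symbol_zero h1, wordOf_zero]
    rcases h2 with h2 | h2 <;> simp [h2]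
  · exact wordOf_eq_zero _ hw

/-- The support of the right side has to be known exactly, since `k + l - 1 - 1` may be truncated;
the absent symbols make it empty when `k + l < 2`. -/
theorem wordOf_pairBracket_snd : (wordOf (pairBracket ℒ k l d e X Y).2 : WordFun ℒ _) =
    wordSymbol d e (wordOf X.1) (wordOf X.2) (wordOf Y.1) (wordOf Y.2) := by
  have hz : ∀ w : List (Letter ℒ), w.length + 2 ≠ k + l →
      wordSymbol d e (wordOf X.1) (wordOf X.2) (wordOf Y.1) (wordOf Y.2) w = 0 := by
    intro w hw
    have h1 : wmul (LinearMap.llcomp K A A A) e (wordOf X.2) (wordOf Y.2) w = 0 := by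
      rcases l.eq_zero_or_pos with hl | hl
      · rw [hY.symbol_zero hl, wordOf_zero, map_zero]; rfl
      · exact hX.wmul_symbol_eq_zero _ e Y.2 (by omega)
    have h2 : wmul (LinearMap.llcomp K A A A) d (wordOf Y.2) (wordOf X.2) w = 0 := by
      rcases k.eq_zero_or_pos with hl | hl
      · rw [hX.symbol_zero hl, wordOf_zero, map_zero]; rfl
      · exact hY.wmul_symbol_eq_zero _ d X.2 (by omega)
    rw [wordSymbol, Pi.add_apply, Pi.sub_apply, Pi.sub_apply, Pi.smul_apply, Pi.smul_apply, h1, h2,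
      hX.wins_symbol_eq_zero e Y.1 (Or.inl hw), hY.wins_symbol_eq_zero d X.1 (by omega)]
    simp
  funext w
  by_cases hw : w.length + 2 = k + l
  · change wordOf (insertion ℒ (k + l - 1 - 1) X.2 Y.1 -
      sgn K (d * e) • insertion ℒ (k + l - 1 - 1) Y.2 X.1 +
        symbolBracket ℒ (k + l - 1 - 1) d e X.2 Y.2) w = _
    have hw' : w.length = k + l - 1 - 1 := by omega
    rw [wordOf_add, wordOf_sub, wordOf_smul, Pi.add_apply, Pi.sub_apply, Pi.smul_apply,
      wordOf_insertion e X.2 hY.hasDegree, wordOf_insertion d Y.2 hX.hasDegree, if_pos hw',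
      if_pos hw', wordOf_symbolBracket d e X.2 Y.2 hw']
    rfl
  · rw [hz w hw]
    by_cases h : k + l - 1 = 0
    · rw [hX.pairBracket_snd_eq_zero hY h, wordOf_zero]; rfl
    · exact wordOf_eq_zero _ (by omega)

theorem pairBracket : IsMultiderivation 𝒜 ℒ (k + l - 1) (d + e) (pairBracket ℒ k l d e X Y) := by
  refine isMultiderivation_iff.2 ⟨hX.pairBracket_snd_eq_zero hY, ?_⟩
  rw [hX.wordOf_pairBracket_fst hY, hX.wordOf_pairBracket_snd hY]
  exact hX.isMultiderWord.bracket hY.isMultiderWord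

end IsMultiderivation

end Pairs

/-! ### Additivity of brackets and actions -/

section Bilinear

variable {K : Type*} [Field K] {L : Type*} [AddCommGroup L] [Module K L] {ℒ : ℤ → Submodule K L}
  [DirectSum.Decomposition ℒ] {M : Type*} [AddCommGroup M] [Module K M]

theorem wordBracket_add_left {d e : ℤ} {Y : WordFun ℒ L} (hY : IsSymWord Y) (X X' : WordFun ℒ L) :
    wordBracket d e (X + X') Y = wordBracket d e X Y + wordBracket d e X' Y := by
  simp only [wordBracket, wins_add_right hY, wins_add_left, smul_add]
  abel

theorem wordSymbol_add_left {d e : ℤ} {Y : WordFun ℒ L} {τ : WordFun ℒ (M →ₗ[K] M)}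
    (hτ : IsSymWord τ) (X X' : WordFun ℒ L) (σ σ' : WordFun ℒ (M →ₗ[K] M)) :
    wordSymbol d e (X + X') (σ + σ') Y τ = wordSymbol d e X σ Y τ + wordSymbol d e X' σ' Y τ := by
  simp only [wordSymbol, wins_add_right hτ, wins_add_left, smul_add, map_add, LinearMap.add_apply]
  abel

theorem wordSymbol_add_right {d e : ℤ} {X : WordFun ℒ L} {σ : WordFun ℒ (M →ₗ[K] M)}
    (hσ : IsSymWord σ) (Y Y' : WordFun ℒ L) (τ τ' : WordFun ℒ (M →ₗ[K] M)) :
    wordSymbol d e X σ (Y + Y') (τ + τ') = wordSymbol d e X σ Y τ + wordSymbol d e X σ Y' τ' := by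
  simp only [wordSymbol, wins_add_right hσ, wins_add_left, smul_add, map_add, LinearMap.add_apply]
  abel

theorem wordEta_add_left {d e : ℤ} {ω : WordFun ℒ M} (hω : IsSymWord ω) (X X' : WordFun ℒ L)
    (σ σ' : WordFun ℒ (M →ₗ[K] M)) :
    wordEta d (X + X') (σ + σ') e ω = wordEta d X σ e ω + wordEta d X' σ' e ω := by
  simp only [wordEta, wins_add_right hω, smul_add, map_add, LinearMap.add_apply]
  abel

end Bilinear

/-! ### Words of pairs with a varying number of entries -/

section PairWord

variable {K : Type*} [Field K] {A : Type*} [Ring A] [Algebra K A]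
  {L : Type*} [AddCommGroup L] [Module K L] (ℒ : ℤ → Submodule K L)

variable (A) in
/-- The function of words given by the first entries of a sum of pairs. -/
def pairWord : RawPairs K A L →ₗ[K] WordFun ℒ L :=
  DirectSum.toModule K ℕ _ fun k => wordOfₗ ℒ k ∘ₗ LinearMap.fst K _ _

variable (A) in
/-- The function of words given by the symbols of a sum of pairs. -/
def pairSymbolWord : RawPairs K A L →ₗ[K] WordFun ℒ (A →ₗ[K] A) :=
  DirectSum.toModule K ℕ _ fun k => wordOfₗ ℒ (k - 1) ∘ₗ LinearMap.snd K _ _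

@[simp] theorem pairWord_pairOf {k : ℕ} (X : RawPair K A L k) :
    pairWord A ℒ (pairOf K A L k X) = wordOf X.1 := by
  simp [pairWord, pairOf, DirectSum.toModule_lof]

@[simp] theorem pairSymbolWord_pairOf {k : ℕ} (X : RawPair K A L k) :
    pairSymbolWord A ℒ (pairOf K A L k X) = wordOf X.2 := by
  simp [pairSymbolWord, pairOf, DirectSum.toModule_lof]

theorem rawPairs_induction {p : RawPairs K A L → Prop} (h0 : p 0)
    (h1 : ∀ k X, p (pairOf K A L k X)) (hadd : ∀ X Y, p X → p Y → p (X + Y)) (X) : p X :=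
  DirectSum.induction_on X h0 h1 fun X Y => hadd X Y

@[simp] theorem pairOf_apply_self {k : ℕ} (X : RawPair K A L k) : pairOf K A L k X k = X :=
  DirectSum.of_eq_same k X

theorem pairOf_apply_of_ne {k l : ℕ} (X : RawPair K A L k) (h : l ≠ k) :
    pairOf K A L k X l = 0 :=
  DirectSum.of_eq_of_ne k l X h

theorem pairWord_apply (X : RawPairs K A L) (w : List (Letter ℒ)) :
    pairWord A ℒ X w = wordOf (X w.length).1 w := by
  induction X using rawPairs_induction with
  | h0 => simp
  | h1 k X =>
    rw [pairWord_pairOf]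
    by_cases h : w.length = k
    · subst h; rw [pairOf_apply_self]
    · rw [pairOf_apply_of_ne X h, wordOf_eq_zero _ h, Prod.fst_zero, wordOf_zero]; rfl
  | hadd X Y hX hY =>
    rw [map_add, Pi.add_apply, hX, hY, DirectSum.add_apply, Prod.fst_add, wordOf_add]; rfl

/-- On the empty word, pairs with one entry and pairs without entries both contribute, because `0 -
1 = 0`. The second term disappears for multiderivations. -/
theorem pairSymbolWord_apply (X : RawPairs K A L) (w : List (Letter ℒ)) :
    pairSymbolWord A ℒ X w = wordOf (X (w.length + 1)).2 w + wordOf (X 0).2 w := by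
  induction X using rawPairs_induction with
  | h0 => simp
  | h1 k X =>
    rw [pairSymbolWord_pairOf]
    rcases k with _ | k
    · rw [pairOf_apply_self, pairOf_apply_of_ne X (by omega), Prod.snd_zero, wordOf_zero,
        Pi.zero_apply, zero_add]
    · rw [pairOf_apply_of_ne (l := 0) X (by omega), Prod.snd_zero, wordOf_zero,
        Pi.zero_apply, add_zero]
      by_cases h : w.length = k
      · subst h; rw [pairOf_apply_self]
      · rw [pairOf_apply_of_ne X (by omega), wordOf_eq_zero _ (by simpa using h), Prod.snd_zero,
          wordOf_zero]; rfl
  | hadd X Y hX hY =>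
    rw [map_add, Pi.add_apply, hX, hY, DirectSum.add_apply, DirectSum.add_apply, Prod.snd_add,
      Prod.snd_add, wordOf_add, wordOf_add, Pi.add_apply, Pi.add_apply]
    abel

end PairWord

/-! ### The graded Lie algebra of multiderivations -/

section Lie

variable {K : Type*} [Field K] {A : Type*} [Ring A] [Algebra K A] {𝒜 : ℤ → Submodule K A}
  [GradedAlgebra 𝒜]
  {L : Type*} [AddCommGroup L] [Module K L] [Module A L] [IsScalarTower K A L]
  {ℒ : ℤ → Submodule K L} [DirectSum.Decomposition ℒ] [SetLike.GradedSMul 𝒜 ℒ]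

theorem multider_induction {d : ℤ} {p : RawPairs K A L → Prop} (h0 : p 0)
    (h1 : ∀ k X, X ∈ multiderHom 𝒜 ℒ k d → p (pairOf K A L k X))
    (hadd : ∀ X ∈ multider 𝒜 ℒ d, ∀ Y ∈ multider 𝒜 ℒ d, p X → p Y → p (X + Y))
    {X : RawPairs K A L} (hX : X ∈ multider 𝒜 ℒ d) : p X := by
  classical
  have h : ∀ s : Finset ℕ, p (∑ k ∈ s, pairOf K A L k (X k)) ∧
      ∑ k ∈ s, pairOf K A L k (X k) ∈ multider 𝒜 ℒ d := by
    intro s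
    induction s using Finset.induction_on with
    | empty => exact ⟨by simpa using h0, by simp⟩
    | insert k s hk ih =>
      rw [Finset.sum_insert hk]
      have hm := pairOf_mem 𝒜 ℒ (hX k)
      exact ⟨hadd _ hm _ ih.2 (h1 k _ (hX k)) ih.1, Submodule.add_mem _ hm ih.2⟩
  have h2 := (h (DFinsupp.support X)).1
  have h3 : ∑ k ∈ DFinsupp.support X, pairOf K A L k (X k) = X := DirectSum.sum_support_of X
  rwa [h3] at h2

/-- The length of a word selects the number of entries, so nothing is lost in adding up the
components; the symbols of pairs without entries are zero and do not interfere. -/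
theorem multider_ext {d : ℤ} {X Y : RawPairs K A L} (hX : X ∈ multider 𝒜 ℒ d)
    (hY : Y ∈ multider 𝒜 ℒ d) (h1 : pairWord A ℒ X = pairWord A ℒ Y)
    (h2 : pairSymbolWord A ℒ X = pairSymbolWord A ℒ Y) : X = Y := by
  refine DFinsupp.ext fun k => Prod.ext (wordOf_injective (ℒ := ℒ) ?_)
    (wordOf_injective (ℒ := ℒ) ?_)
  · funext w
    by_cases hw : w.length = k
    · subst hw
      have := congrFun h1 w
      rwa [pairWord_apply, pairWord_apply] at this
    · rw [wordOf_eq_zero _ hw, wordOf_eq_zero _ hw]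
  · rcases k with _ | k
    · rw [(hX 0).symbol_zero rfl, (hY 0).symbol_zero rfl]
    · funext w
      by_cases hw : w.length = k
      · subst hw
        have := congrFun h2 w
        rw [pairSymbolWord_apply, pairSymbolWord_apply, (hX 0).symbol_zero rfl,
          (hY 0).symbol_zero rfl] at this
        exact add_right_cancel this
      · rw [wordOf_eq_zero _ (by simpa using hw), wordOf_eq_zero _ (by simpa using hw)]

theorem isSymWord_pairWord {d : ℤ} {X : RawPairs K A L} (hX : X ∈ multider 𝒜 ℒ d) :
    IsSymWord (pairWord A ℒ X) := by
  refine multider_induction (p := fun X => IsSymWord (pairWord A ℒ X)) ?_ (fun k X hX => ?_)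
    (fun X _ Y _ h h' => ?_) hX
  · rw [map_zero]; exact IsSymWord.zero
  · rw [pairWord_pairOf]; exact isSymWord_wordOf.2 hX.symmetric
  · rw [map_add]; exact h.add' h'

theorem isSymWord_pairSymbolWord {d : ℤ} {X : RawPairs K A L} (hX : X ∈ multider 𝒜 ℒ d) :
    IsSymWord (pairSymbolWord A ℒ X) := by
  refine multider_induction (p := fun X => IsSymWord (pairSymbolWord A ℒ X)) ?_ (fun k X hX => ?_)
    (fun X _ Y _ h h' => ?_) hX
  · rw [map_zero]; exact IsSymWord.zero
  · rw [pairSymbolWord_pairOf]; exact isSymWord_wordOf.2 hX.symbol_symmetric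
  · rw [map_add]; exact h.add' h'

/-- Transfers the bracket to words for arbitrary sums, after which skew symmetry and the Jacobi
identity are those of `wordBracket` and `wordSymbol`. -/
theorem multiderBracket_mem_and_words {d e : ℤ} {X Y : RawPairs K A L}
    (hX : X ∈ multider 𝒜 ℒ d) (hY : Y ∈ multider 𝒜 ℒ e) :
    multiderBracket A ℒ d e X Y ∈ multider 𝒜 ℒ (d + e) ∧
    pairWord A ℒ (multiderBracket A ℒ d e X Y) =
      wordBracket d e (pairWord A ℒ X) (pairWord A ℒ Y) ∧
    pairSymbolWord A ℒ (multiderBracket A ℒ d e X Y) =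
      wordSymbol d e (pairWord A ℒ X) (pairSymbolWord A ℒ X) (pairWord A ℒ Y)
        (pairSymbolWord A ℒ Y) := by
  have hz : ∀ {Y : WordFun ℒ L} {τ : WordFun ℒ (A →ₗ[K] A)} (d e : ℤ), IsSymWord Y → IsSymWord τ →
      wordBracket d e 0 Y = 0 ∧ wordSymbol d e 0 0 Y τ = 0 := by
    intro Y τ d e hY hτ
    constructor
    · simp [wordBracket, wins_zero_right hY]
    · simp [wordSymbol, wins_zero_right hτ]
  refine multider_induction (p := fun X => multiderBracket A ℒ d e X Y ∈ multider 𝒜 ℒ (d + e) ∧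
    pairWord A ℒ (multiderBracket A ℒ d e X Y) =
      wordBracket d e (pairWord A ℒ X) (pairWord A ℒ Y) ∧
    pairSymbolWord A ℒ (multiderBracket A ℒ d e X Y) =
      wordSymbol d e (pairWord A ℒ X) (pairSymbolWord A ℒ X) (pairWord A ℒ Y)
        (pairSymbolWord A ℒ Y)) ?_ (fun k X hX => ?_) (fun X _ X' _ h h' => ?_) hX
  · have := hz d e (isSymWord_pairWord hY) (isSymWord_pairSymbolWord hY)
    simp only [map_zero, LinearMap.zero_apply, this.1, this.2, Submodule.zero_mem, and_self]
  · have hsX := isSymWord_wordOf.2 hX.symmetric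
    have hsX' := isSymWord_wordOf.2 hX.symbol_symmetric
    refine multider_induction (p := fun Y =>
      multiderBracket A ℒ d e (pairOf K A L k X) Y ∈ multider 𝒜 ℒ (d + e) ∧
      pairWord A ℒ (multiderBracket A ℒ d e (pairOf K A L k X) Y) =
        wordBracket d e (pairWord A ℒ (pairOf K A L k X)) (pairWord A ℒ Y) ∧
      pairSymbolWord A ℒ (multiderBracket A ℒ d e (pairOf K A L k X) Y) =
        wordSymbol d e (pairWord A ℒ (pairOf K A L k X)) (pairSymbolWord A ℒ (pairOf K A L k X))
          (pairWord A ℒ Y) (pairSymbolWord A ℒ Y)) ?_ (fun l Y hY => ?_)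
          (fun Y _ Y' _ h h' => ?_) hY
    · have := hz e d hsX hsX'
      simp only [map_zero, LinearMap.zero_apply, pairWord_pairOf, pairSymbolWord_pairOf]
      rw [wordBracket_skew, wordSymbol_skew, this.1, this.2]
      simp
    · rw [multiderBracket_pairOf]
      refine ⟨pairOf_mem 𝒜 ℒ (hX.pairBracket hY), ?_, ?_⟩
      · simp only [pairWord_pairOf, IsMultiderivation.wordOf_pairBracket_fst hX hY]
      · simp only [pairWord_pairOf, pairSymbolWord_pairOf,
          IsMultiderivation.wordOf_pairBracket_snd hX hY]
    · simp only [pairWord_pairOf, pairSymbolWord_pairOf] at h h' ⊢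
      simp only [map_add, wordBracket_add_right hsX, wordSymbol_add_right hsX']
      exact ⟨Submodule.add_mem _ h.1 h'.1, by rw [h.2.1, h'.2.1], by rw [h.2.2, h'.2.2]⟩
  · simp only [map_add, LinearMap.add_apply, wordBracket_add_left (isSymWord_pairWord hY),
      wordSymbol_add_left (isSymWord_pairSymbolWord hY)]
    exact ⟨Submodule.add_mem _ h.1 h'.1, by rw [h.2.1, h'.2.1], by rw [h.2.2, h'.2.2]⟩

variable (𝒜 ℒ) in
/-- The multiderivations form a graded Lie algebra. -/
theorem isGradedLieAlgebra_multider :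
    IsGradedLieAlgebra (multider 𝒜 ℒ) (multiderBracket A ℒ) where
  bracket_mem hx hy := (multiderBracket_mem_and_words hx hy).1
  skew {i j x y} hx hy := by
    obtain ⟨h1, h2, h3⟩ := multiderBracket_mem_and_words hx hy
    obtain ⟨h1', h2', h3'⟩ := multiderBracket_mem_and_words hy hx
    rw [add_comm] at h1'
    refine multider_ext h1 (Submodule.neg_mem _ (Submodule.smul_mem _ _ h1')) ?_ ?_
    · rw [map_neg, map_smul, h2, h2', wordBracket_skew]
    · rw [map_neg, map_smul, h3, h3', wordSymbol_skew]
  jacobi {i j k x y z} hx hy hz := by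
    obtain ⟨a1, a2, a3⟩ := multiderBracket_mem_and_words hy hz
    obtain ⟨b1, b2, b3⟩ := multiderBracket_mem_and_words hx a1
    obtain ⟨c1, c2, c3⟩ := multiderBracket_mem_and_words hx hy
    obtain ⟨d1, d2, d3⟩ := multiderBracket_mem_and_words c1 hz
    obtain ⟨e1, e2, e3⟩ := multiderBracket_mem_and_words hx hz
    obtain ⟨f1, f2, f3⟩ := multiderBracket_mem_and_words hy e1
    rw [add_assoc] at d1
    rw [add_left_comm] at f1
    refine multider_ext b1 (Submodule.add_mem _ d1 (Submodule.smul_mem _ _ f1)) ?_ ?_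
    · rw [map_add, map_smul, b2, a2, d2, c2, f2, e2]
      exact wordBracket_jacobi i j k (isSymWord_pairWord hx) (isSymWord_pairWord hy)
        (isSymWord_pairWord hz)
    · rw [map_add, map_smul, b3, a2, a3, d3, c2, c3, f3, e2, e3]
      exact wordSymbol_jacobi i j k (isSymWord_pairWord hx) (isSymWord_pairSymbolWord hx)
        (isSymWord_pairWord hy) (isSymWord_pairSymbolWord hy) (isSymWord_pairWord hz)
        (isSymWord_pairSymbolWord hz)

end Lie

/-! ### The space of symmetric forms on words -/

section SymWord

variable {K : Type*} [Field K] {A : Type*} [Ring A] [Algebra K A] (𝒜 : ℤ → Submodule K A)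
  {L : Type*} [AddCommGroup L] [Module K L] [Module A L] (ℒ : ℤ → Submodule K L)

/-- The function of words given by the part of degree `e` of an element of `Sym_A(L, A)`. -/
def symWord (e : ℤ) : Sym 𝒜 ℒ →ₗ[K] WordFun ℒ A :=
  LinearMap.pi fun w => LinearMap.proj w ∘ₗ wordOfₗ ℒ w.length ∘ₗ
    (symForms 𝒜 ℒ w.length e).subtype ∘ₗ symComponent 𝒜 ℒ w.length e

variable {𝒜 ℒ}

theorem symWord_apply (e : ℤ) (θ : Sym 𝒜 ℒ) (w : List (Letter ℒ)) :
    symWord 𝒜 ℒ e θ w = wordOf (symComponent 𝒜 ℒ w.length e θ).1 w := rfl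

@[simp] theorem symComponent_symOf (l : ℕ) (e : ℤ) (ω : symForms 𝒜 ℒ l e) :
    symComponent 𝒜 ℒ l e (symOf 𝒜 ℒ l e ω) = ω :=
  DirectSum.component.lof_self K (M := fun p : ℕ × ℤ => symForms 𝒜 ℒ p.1 p.2) (l, e) ω

theorem symComponent_symOf_of_ne {l l' : ℕ} {e e' : ℤ} (h : ¬(l' = l ∧ e' = e))
    (ω : symForms 𝒜 ℒ l e) : symComponent 𝒜 ℒ l' e' (symOf 𝒜 ℒ l e ω) = 0 :=
  DirectSum.of_eq_of_ne (β := fun p : ℕ × ℤ => symForms 𝒜 ℒ p.1 p.2) (l, e) (l', e') ω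
    (by simpa using h)

theorem symWord_symOf {l : ℕ} {e : ℤ} (ω : symForms 𝒜 ℒ l e) :
    symWord 𝒜 ℒ e (symOf 𝒜 ℒ l e ω) = wordOf ω.1 := by
  funext w
  rw [symWord_apply]
  by_cases h : w.length = l
  · subst h; rw [symComponent_symOf]
  · rw [symComponent_symOf_of_ne (fun h' => h h'.1), wordOf_eq_zero _ h]
    exact congrFun wordOf_zero w

theorem symWord_symOf_of_ne {l : ℕ} {e e' : ℤ} (h : e' ≠ e) (ω : symForms 𝒜 ℒ l e) :
    symWord 𝒜 ℒ e' (symOf 𝒜 ℒ l e ω) = 0 := by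
  funext w
  rw [symWord_apply, symComponent_symOf_of_ne (fun h' => h h'.2)]
  exact congrFun wordOf_zero w

theorem sym_linearMap_ext {V : Type*} [AddCommGroup V] [Module K V] {f g : Sym 𝒜 ℒ →ₗ[K] V}
    (h : ∀ l e (ω : symForms 𝒜 ℒ l e), f (symOf 𝒜 ℒ l e ω) = g (symOf 𝒜 ℒ l e ω)) : f = g :=
  DirectSum.linearMap_ext K fun p => LinearMap.ext fun ω => h p.1 p.2 ω

theorem sym_induction {p : Sym 𝒜 ℒ → Prop} (h0 : p 0)
    (h1 : ∀ l e (ω : symForms 𝒜 ℒ l e), p (symOf 𝒜 ℒ l e ω))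
    (hadd : ∀ θ θ', p θ → p θ' → p (θ + θ')) (θ : Sym 𝒜 ℒ) : p θ :=
  DirectSum.induction_on (motive := p) θ h0 (fun i ω => h1 i.1 i.2 ω) fun θ θ' => hadd θ θ'

theorem isSymWord_symWord [GradedAlgebra 𝒜] [IsScalarTower K A L] [DirectSum.Decomposition ℒ]
    [SetLike.GradedSMul 𝒜 ℒ] (e : ℤ) (θ : Sym 𝒜 ℒ) : IsSymWord (symWord 𝒜 ℒ e θ) := by
  induction θ using sym_induction with
  | h0 => rw [map_zero]; exact IsSymWord.zero
  | h1 l e' ω =>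
    by_cases h : e = e'
    · subst h; rw [symWord_symOf]; exact isSymWord_wordOf.2 ω.2.2.1
    · rw [symWord_symOf_of_ne h]; exact IsSymWord.zero
  | hadd θ θ' h h' => rw [map_add]; exact h.add' h'

theorem sym_ext_component {θ θ' : Sym 𝒜 ℒ}
    (h : ∀ l e, symComponent 𝒜 ℒ l e θ = symComponent 𝒜 ℒ l e θ') : θ = θ' :=
  DFinsupp.ext fun p => h p.1 p.2

/-- Word length separates the form degrees, while the internal degree `e` is kept as a parameter,
since forms of different internal degree live on the same words. -/
theorem sym_ext [DirectSum.Decomposition ℒ] {θ θ' : Sym 𝒜 ℒ}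
    (h : ∀ e, symWord 𝒜 ℒ e θ = symWord 𝒜 ℒ e θ') : θ = θ' := by
  refine sym_ext_component fun l e => Subtype.ext (wordOf_injective (ℒ := ℒ) (funext fun w => ?_))
  by_cases hw : w.length = l
  · subst hw
    exact congrFun (h e) w
  · rw [wordOf_eq_zero _ hw, wordOf_eq_zero _ hw]

/-- An element of the part of form degree `m` and degree `e` is a form. -/
theorem exists_symOf_of_mem_symPart {l : ℕ} {e : ℤ} {θ : Sym 𝒜 ℒ} (h : θ ∈ symPart 𝒜 ℒ l e) :
    symOf 𝒜 ℒ l e (symComponent 𝒜 ℒ l e θ) = θ := by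
  refine sym_ext_component fun l' e' => ?_
  by_cases h' : l' = l ∧ e' = e
  · obtain ⟨rfl, rfl⟩ := h'
    rw [symComponent_symOf]
  · rw [symComponent_symOf_of_ne h', h l' e' (by simpa using h')]

theorem eq_zero_of_mem_symPart {m e : ℤ} (hm : m < 0) {θ : Sym 𝒜 ℒ} (h : θ ∈ symPart 𝒜 ℒ m e) :
    θ = 0 :=
  sym_ext_component fun l' e' => by rw [h l' e' (by omega), map_zero]

theorem symOf_mem_symPart {l : ℕ} {e : ℤ} (ω : symForms 𝒜 ℒ l e) {m e' : ℤ} (hm : (l : ℤ) = m)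
    (he : e = e') : symOf 𝒜 ℒ l e ω ∈ symPart 𝒜 ℒ m e' := by
  subst hm he
  intro l' e' h
  exact symComponent_symOf_of_ne (by simpa using h) ω

end SymWord

/-! ### The product of forms on words -/

section Mul

variable {K : Type*} [Field K] {A : Type*} [Ring A] [Algebra K A] {𝒜 : ℤ → Submodule K A}
  [GradedAlgebra 𝒜] [IsGradedCommutative 𝒜]
  {L : Type*} [AddCommGroup L] [Module K L] [Module A L] [IsScalarTower K A L]
  {ℒ : ℤ → Submodule K L} [DirectSum.Decomposition ℒ] [SetLike.GradedSMul 𝒜 ℒ]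

theorem symWord_symMul {l : ℕ} {e : ℤ} (ω : symForms 𝒜 ℒ l e) (e' : ℤ) (θ : Sym 𝒜 ℒ) :
    symWord 𝒜 ℒ (e + e') (symMul 𝒜 ℒ (symOf 𝒜 ℒ l e ω) θ) =
      wmul (actionMap K A A) e' (wordOf ω.1) (symWord 𝒜 ℒ e' θ) := by
  induction θ using sym_induction with
  | h0 => simp only [map_zero]
  | h1 l' d ω' =>
    rw [symMul_symOf]
    by_cases h : e' = d
    · subst h
      rw [symWord_symOf, symWord_symOf, wordOf_formMul]
    · rw [symWord_symOf_of_ne h, symWord_symOf_of_ne (by omega), map_zero]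
  | hadd θ θ' h h' => simp only [map_add, h, h']

end Mul

/-! ### The graded Lie algebra of derivations of forms -/

section Derivations

variable {K : Type*} [Field K] {A : Type*} [Ring A] [Algebra K A] {𝒜 : ℤ → Submodule K A}
  [GradedAlgebra 𝒜] [IsGradedCommutative 𝒜]
  {L : Type*} [AddCommGroup L] [Module K L] [Module A L]
  {ℒ : ℤ → Submodule K L} [DirectSum.Decomposition ℒ] [SetLike.GradedSMul 𝒜 ℒ]

/-- Extends the defining condition to integer form degrees, so that derivations can be composed even
when an intermediate form degree is negative; that part is zero. -/
theorem symDerHom_apply_mem {r d : ℤ} {D : Module.End K (Sym 𝒜 ℒ)} (hD : D ∈ symDerHom 𝒜 ℒ r d)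
    {m e : ℤ} {θ : Sym 𝒜 ℒ} (hθ : θ ∈ symPart 𝒜 ℒ m e) : D θ ∈ symPart 𝒜 ℒ (m + r) (d + e) := by
  rcases lt_or_ge m 0 with hm | hm
  · rw [eq_zero_of_mem_symPart hm hθ, map_zero]
    exact Submodule.zero_mem _
  · lift m to ℕ using hm
    rw [← exists_symOf_of_mem_symPart hθ]
    exact hD.1 m e _

theorem symDerHom_apply_mul {r d : ℤ} {D : Module.End K (Sym 𝒜 ℒ)} (hD : D ∈ symDerHom 𝒜 ℒ r d)
    {m e : ℤ} {ω : Sym 𝒜 ℒ} (hω : ω ∈ symPart 𝒜 ℒ m e) (θ : Sym 𝒜 ℒ) :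
    D (symMul 𝒜 ℒ ω θ) = symMul 𝒜 ℒ (D ω) θ + sgn K (d * e) • symMul 𝒜 ℒ ω (D θ) := by
  rcases lt_or_ge m 0 with hm | hm
  · rw [eq_zero_of_mem_symPart hm hω]
    simp only [map_zero, LinearMap.zero_apply, smul_zero, add_zero]
  · lift m to ℕ using hm
    rw [← exists_symOf_of_mem_symPart hω]
    exact hD.2 m e _ θ

theorem gradedCommutator_apply {V : Type*} [AddCommGroup V] [Module K V] (d e : ℤ)
    (D E : Module.End K V) (θ : V) :
    gradedCommutator d e D E θ = D (E θ) - sgn K (d * e) • E (D θ) := rfl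

theorem gradedCommutator_mem_symDerHom {r d s e : ℤ} {D E : Module.End K (Sym 𝒜 ℒ)}
    (hD : D ∈ symDerHom 𝒜 ℒ r d) (hE : E ∈ symDerHom 𝒜 ℒ s e) :
    gradedCommutator d e D E ∈ symDerHom 𝒜 ℒ (r + s) (d + e) := by
  refine ⟨fun l c ω => ?_, fun l c ω θ => ?_⟩
  · have hω := symOf_mem_symPart ω rfl rfl
    have h1 := symDerHom_apply_mem hD (symDerHom_apply_mem hE hω)
    have h2 := symDerHom_apply_mem hE (symDerHom_apply_mem hD hω)
    rw [gradedCommutator_apply]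
    rw [show (l : ℤ) + s + r = l + (r + s) by ring, show d + (e + c) = d + e + c by ring] at h1
    rw [show (l : ℤ) + r + s = l + (r + s) by ring, show e + (d + c) = d + e + c by ring] at h2
    exact Submodule.sub_mem _ h1 (Submodule.smul_mem _ _ h2)
  · have hω := symOf_mem_symPart ω rfl rfl
    have h1 := symDerHom_apply_mul hD (symDerHom_apply_mem hE hω) θ
    have h2 := symDerHom_apply_mul hE (symDerHom_apply_mem hD hω) θ
    simp only [gradedCommutator_apply, symDerHom_apply_mul hD hω, symDerHom_apply_mul hE hω,
      map_add, map_smul, map_sub, LinearMap.sub_apply, LinearMap.smul_apply, h1, h2]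
    match_scalars <;> (try simp only [mul_one, mul_add, add_mul, sgn_add, mul_comm (G := ℤ)]) <;>
      grind [sgn_mul_self]

variable (𝒜 ℒ) in
/-- The derivations of `Sym_A(L, A)` form a graded Lie algebra. -/
theorem isGradedLieAlgebra_symDer : IsGradedLieAlgebra (symDer 𝒜 ℒ) gradedCommutator where
  bracket_mem {d e D E} hD hE := by
    refine Submodule.iSup_induction (fun r => symDerHom 𝒜 ℒ r d)
      (motive := fun D => gradedCommutator d e D E ∈ symDer 𝒜 ℒ (d + e)) hD (fun r D hD => ?_)
      (by simp) (fun D D' h h' => ?_)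
    · refine Submodule.iSup_induction (fun r => symDerHom 𝒜 ℒ r e)
        (motive := fun E => gradedCommutator d e D E ∈ symDer 𝒜 ℒ (d + e)) hE (fun s E hE => ?_)
        (by simp) (fun E E' h h' => ?_)
      · exact Submodule.mem_iSup_of_mem (r + s) (gradedCommutator_mem_symDerHom hD hE)
      · rw [map_add]; exact Submodule.add_mem _ h h'
    · rw [map_add, LinearMap.add_apply]; exact Submodule.add_mem _ h h'
  -- Skew symmetry and the Jacobi identity are formal properties of graded commutators of
  -- endomorphisms.
  skew {d e D E} _ _ := by
    refine LinearMap.ext fun θ => ?_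
    rw [LinearMap.neg_apply, LinearMap.smul_apply, gradedCommutator_apply, gradedCommutator_apply]
    match_scalars <;> (try simp only [mul_one, mul_add, add_mul, sgn_add, mul_comm (G := ℤ)]) <;>
      grind [sgn_mul_self]
  jacobi {d e f D E F} _ _ _ := by
    refine LinearMap.ext fun θ => ?_
    simp only [LinearMap.add_apply, LinearMap.smul_apply, gradedCommutator_apply, map_sub, map_smul]
    match_scalars <;> (try simp only [mul_one, mul_add, add_mul, sgn_add, mul_comm (G := ℤ)]) <;>
      grind [sgn_mul_self]

end Derivations

/-! ### The morphism from multiderivations to derivations -/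

section Eta

variable {K : Type*} [Field K] {A : Type*} [Ring A] [Algebra K A] (𝒜 : ℤ → Submodule K A)
  [GradedAlgebra 𝒜] [IsGradedCommutative 𝒜]
  {L : Type*} [AddCommGroup L] [Module K L] [Module A L] [IsScalarTower K A L]
  (ℒ : ℤ → Submodule K L) [DirectSum.Decomposition ℒ] [SetLike.GradedSMul 𝒜 ℒ]

theorem etaForm_add_right {k l : ℕ} (n : ℕ) (d e : ℤ) (X : RawPair K A L k) (ω ω' : Raw K L l A) :
    etaForm ℒ n d e X (ω + ω') = etaForm ℒ n d e X ω + etaForm ℒ n d e X ω' := by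
  simp only [etaForm, map_add, LinearMap.add_apply, smul_add]
  abel

theorem etaForm_smul_right {k l : ℕ} (n : ℕ) (d e : ℤ) (X : RawPair K A L k) (c : K)
    (ω : Raw K L l A) : etaForm ℒ n d e X (c • ω) = c • etaForm ℒ n d e X ω := by
  simp only [etaForm, map_smul, LinearMap.smul_apply, smul_sub]
  rw [smul_comm c]

theorem etaForm_add_left {k l : ℕ} (n : ℕ) (d e : ℤ) (X Y : RawPair K A L k) (ω : Raw K L l A) :
    etaForm ℒ n d e (X + Y) ω = etaForm ℒ n d e X ω + etaForm ℒ n d e Y ω := by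
  simp only [etaForm, Prod.fst_add, Prod.snd_add, map_add, LinearMap.add_apply, smul_add]
  abel

theorem etaForm_smul_left {k l : ℕ} (n : ℕ) (d e : ℤ) (c : K) (X : RawPair K A L k)
    (ω : Raw K L l A) : etaForm ℒ n d e (c • X) ω = c • etaForm ℒ n d e X ω := by
  simp only [etaForm, Prod.smul_fst, Prod.smul_snd, map_smul, LinearMap.smul_apply, smul_sub]
  rw [smul_comm c]

/-- The action of multiderivations with `k` entries on `Sym_A(L, A)`. -/
def etaHom (k : ℕ) (d : ℤ) : multiderHom 𝒜 ℒ k d →ₗ[K] Module.End K (Sym 𝒜 ℒ) where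
  toFun X := symLift 𝒜 ℒ fun l e =>
    { toFun := fun ω => symOf 𝒜 ℒ (l + k - 1) (d + e)
        ⟨etaForm ℒ (l + k - 1) d e X.1 ω.1, IsMultiderivation.etaForm_mem X.2 ω.2⟩
      map_add' := fun ω ω' => by
        rw [← map_add]; congr 1; exact Subtype.ext (etaForm_add_right ℒ _ _ _ _ _ _)
      map_smul' := fun c ω => by
        rw [RingHom.id_apply, ← map_smul]; congr 1
        exact Subtype.ext (etaForm_smul_right ℒ _ _ _ _ _ _) }
  map_add' X Y := sym_linearMap_ext fun l e ω => by
    simp only [LinearMap.add_apply, symLift_symOf, LinearMap.coe_mk, AddHom.coe_mk]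
    rw [← map_add]; congr 1; exact Subtype.ext (etaForm_add_left ℒ _ _ _ _ _ _)
  map_smul' c X := sym_linearMap_ext fun l e ω => by
    simp only [LinearMap.smul_apply, symLift_symOf, LinearMap.coe_mk, AddHom.coe_mk,
      RingHom.id_apply]
    rw [← map_smul]; congr 1; exact Subtype.ext (etaForm_smul_left ℒ _ _ _ _ _ _)

variable {𝒜 ℒ}

theorem etaHom_symOf {k : ℕ} {d : ℤ} (X : multiderHom 𝒜 ℒ k d) {l : ℕ} {e : ℤ}
    (ω : symForms 𝒜 ℒ l e) : etaHom 𝒜 ℒ k d X (symOf 𝒜 ℒ l e ω) = symOf 𝒜 ℒ (l + k - 1) (d + e)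
        ⟨etaForm ℒ (l + k - 1) d e X.1 ω.1, IsMultiderivation.etaForm_mem X.2 ω.2⟩ := by
  simp only [etaHom, LinearMap.coe_mk, AddHom.coe_mk, symLift_symOf]

/-- On words the operator is `wordEta`, so its algebraic properties have already been established.
-/
theorem symWord_etaHom {k : ℕ} {d : ℤ} (X : multiderHom 𝒜 ℒ k d) (e : ℤ) (θ : Sym 𝒜 ℒ) :
    symWord 𝒜 ℒ (d + e) (etaHom 𝒜 ℒ k d X θ) =
      wordEta d (wordOf X.1.1) (wordOf X.1.2) e (symWord 𝒜 ℒ e θ) := by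
  have h0 : wordEta d (wordOf X.1.1 : WordFun ℒ L) (wordOf X.1.2) e 0 = 0 := by
    simp [wordEta]
  induction θ using sym_induction with
  | h0 => simp only [map_zero, h0]
  | h1 l e' ω =>
    rw [etaHom_symOf]
    by_cases h : e = e'
    · subst h
      rw [symWord_symOf, symWord_symOf, IsMultiderivation.wordOf_etaForm_natural X.2]
    · rw [symWord_symOf_of_ne h, symWord_symOf_of_ne (by omega), h0]
  | hadd θ θ' h h' => simp only [map_add, h, h', wordEta_add]

theorem etaHom_mem {k : ℕ} {d : ℤ} (X : multiderHom 𝒜 ℒ k d) :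
    etaHom 𝒜 ℒ k d X ∈ symDerHom 𝒜 ℒ ((k : ℤ) - 1) d := by
  refine ⟨fun l e ω => ?_, fun l e ω θ => sym_ext fun f => ?_⟩
  · rw [etaHom_symOf]
    -- Here `l + k - 1` is truncated to `0` while the true form degree is `-1`; membership holds
    -- because the form vanishes.
    by_cases h : l + k = 0
    · have : (⟨etaForm ℒ (l + k - 1) d e X.1 ω.1, IsMultiderivation.etaForm_mem X.2 ω.2⟩ :
          symForms 𝒜 ℒ (l + k - 1) (d + e)) = 0 := by
        refine Subtype.ext (wordOf_injective (ℒ := ℒ) ?_)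
        rw [IsMultiderivation.wordOf_etaForm_natural X.2]
        funext w
        rw [IsMultiderivation.wordEta_eq_zero X.2 e ω.1 (by omega)]
        exact (congrFun wordOf_zero w).symm
      rw [this, map_zero]
      exact Submodule.zero_mem _
    · exact symOf_mem_symPart _ (by omega) rfl
  -- In total degree `f` only the part of `θ` of degree `e' = f - d - e` contributes.
  · obtain ⟨e', rfl⟩ : ∃ e', f = d + (e + e') := ⟨f - d - e, by ring⟩
    have h1 := (mem_symForms_iff.1 ω.2).1
    have hX := (IsMultiderivation.isMultiderWord X.2)
    have h2 : symWord 𝒜 ℒ (d + (e + e')) (symMul 𝒜 ℒ (symOf 𝒜 ℒ l e ω) (etaHom 𝒜 ℒ k d X θ)) =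
        wmul (actionMap K A A) (d + e') (wordOf ω.1) (symWord 𝒜 ℒ (d + e') (etaHom 𝒜 ℒ k d X θ)) := by
      rw [add_left_comm, symWord_symMul]
    have h3 : symWord 𝒜 ℒ (d + (e + e')) (symMul 𝒜 ℒ (etaHom 𝒜 ℒ k d X (symOf 𝒜 ℒ l e ω)) θ) =
        wmul (actionMap K A A) e' (wordEta d (wordOf X.1.1) (wordOf X.1.2) e (wordOf ω.1))
          (symWord 𝒜 ℒ e' θ) := by
      rw [etaHom_symOf, ← add_assoc, symWord_symMul,
        IsMultiderivation.wordOf_etaForm_natural X.2]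
    rw [symWord_etaHom, symWord_symMul, map_add, map_smul, h2, h3, symWord_etaHom,
      wordEta_wmul hX.symbol_deg h1 (isSymWord_wordOf.2 ω.2.2.1) (isSymWord_symWord _ _)]

/-- The family of the parts of a multiderivation with a given number of entries. -/
def multiderParts {d : ℤ} (X : multider 𝒜 ℒ d) : ⨁ k : ℕ, multiderHom 𝒜 ℒ k d := by
  classical
  exact DFinsupp.mk (DFinsupp.support (X : RawPairs K A L)) fun k => ⟨X.1 k, X.2 k⟩

theorem multiderParts_apply {d : ℤ} (X : multider 𝒜 ℒ d) (k : ℕ) :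
    multiderParts X k = ⟨X.1 k, X.2 k⟩ := by
  classical
  refine (DFinsupp.mk_apply (β := fun k => multiderHom 𝒜 ℒ k d)).trans ?_
  split_ifs with h
  · rfl
  · exact Subtype.ext (DFinsupp.notMem_support_iff.1 h).symm

variable (𝒜 ℒ) in
/-- The decomposition of a multiderivation according to the number of entries. -/
def multiderSplit (d : ℤ) : multider 𝒜 ℒ d →ₗ[K] ⨁ k : ℕ, multiderHom 𝒜 ℒ k d where
  toFun := multiderParts
  map_add' X Y := DFinsupp.ext fun k => by
    rw [multiderParts_apply, DFinsupp.add_apply, multiderParts_apply, multiderParts_apply]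
    rfl
  map_smul' c X := DFinsupp.ext fun k => by
    rw [multiderParts_apply, DFinsupp.smul_apply, multiderParts_apply]
    rfl

theorem multiderSplit_apply {d : ℤ} (X : multider 𝒜 ℒ d) (k : ℕ) :
    multiderSplit 𝒜 ℒ d X k = ⟨X.1 k, X.2 k⟩ := multiderParts_apply X k

theorem multiderSplit_pairOf {k : ℕ} {d : ℤ} {X : RawPair K A L k}
    (hX : X ∈ multiderHom 𝒜 ℒ k d) : multiderSplit 𝒜 ℒ d ⟨pairOf K A L k X, pairOf_mem 𝒜 ℒ hX⟩ =
      DirectSum.lof K ℕ (fun k => multiderHom 𝒜 ℒ k d) k ⟨X, hX⟩ := by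
  refine DFinsupp.ext fun j => Subtype.ext ?_
  rw [multiderSplit_apply]
  by_cases h : j = k
  · subst h
    refine (pairOf_apply_self X).trans ?_
    exact congrArg Subtype.val
      (DirectSum.of_eq_same (β := fun k => multiderHom 𝒜 ℒ k d) j ⟨X, hX⟩).symm
  · refine (pairOf_apply_of_ne X h).trans ?_
    exact congrArg Subtype.val
      (DirectSum.of_eq_of_ne (β := fun k => multiderHom 𝒜 ℒ k d) k j ⟨X, hX⟩ h).symm

variable (𝒜 ℒ) in
/-- The action of multiderivations on `Sym_A(L, A)`. -/
def etaEnd (d : ℤ) : multider 𝒜 ℒ d →ₗ[K] Module.End K (Sym 𝒜 ℒ) :=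
  DirectSum.toModule K ℕ _ (fun k => etaHom 𝒜 ℒ k d) ∘ₗ multiderSplit 𝒜 ℒ d

theorem etaEnd_pairOf {k : ℕ} {d : ℤ} {X : RawPair K A L k} (hX : X ∈ multiderHom 𝒜 ℒ k d) :
    etaEnd 𝒜 ℒ d ⟨pairOf K A L k X, pairOf_mem 𝒜 ℒ hX⟩ = etaHom 𝒜 ℒ k d ⟨X, hX⟩ := by
  rw [etaEnd, LinearMap.comp_apply, multiderSplit_pairOf, DirectSum.toModule_lof]

theorem multider_induction' {d : ℤ} {p : multider 𝒜 ℒ d → Prop} (h0 : p 0)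
    (h1 : ∀ k X (hX : X ∈ multiderHom 𝒜 ℒ k d), p ⟨pairOf K A L k X, pairOf_mem 𝒜 ℒ hX⟩)
    (hadd : ∀ X Y, p X → p Y → p (X + Y)) (X : multider 𝒜 ℒ d) : p X := by
  obtain ⟨X, hX⟩ := X
  have : ∃ h : X ∈ multider 𝒜 ℒ d, p ⟨X, h⟩ :=
    multider_induction (p := fun X => ∃ h : X ∈ multider 𝒜 ℒ d, p ⟨X, h⟩)
      ⟨Submodule.zero_mem _, h0⟩ (fun k X hX => ⟨pairOf_mem 𝒜 ℒ hX, h1 k X hX⟩)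
      (fun X _ Y _ ⟨h, hp⟩ ⟨h', hp'⟩ => ⟨Submodule.add_mem _ h h', hadd ⟨X, h⟩ ⟨Y, h'⟩ hp hp'⟩) hX
  exact this.2

theorem etaEnd_mem {d : ℤ} (X : multider 𝒜 ℒ d) : etaEnd 𝒜 ℒ d X ∈ symDer 𝒜 ℒ d := by
  induction X using multider_induction' with
  | h0 => rw [map_zero]; exact Submodule.zero_mem _
  | h1 k X hX =>
    rw [etaEnd_pairOf hX]
    exact Submodule.mem_iSup_of_mem _ (etaHom_mem ⟨X, hX⟩)
  | hadd X Y h h' => rw [map_add]; exact Submodule.add_mem _ h h'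

theorem symWord_etaEnd {d : ℤ} (X : multider 𝒜 ℒ d) (e : ℤ) (θ : Sym 𝒜 ℒ) :
    symWord 𝒜 ℒ (d + e) (etaEnd 𝒜 ℒ d X θ) =
      wordEta d (pairWord A ℒ X.1) (pairSymbolWord A ℒ X.1) e (symWord 𝒜 ℒ e θ) := by
  have hs := isSymWord_symWord e θ
  induction X using multider_induction' with
  | h0 =>
    simp only [map_zero, LinearMap.zero_apply, ZeroMemClass.coe_zero]
    simp [wordEta, wins_zero_right hs]
  | h1 k X hX =>
    rw [etaEnd_pairOf hX, symWord_etaHom, pairWord_pairOf, pairSymbolWord_pairOf]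
  | hadd X Y h h' =>
    simp only [map_add, LinearMap.add_apply, Submodule.coe_add, h, h', wordEta_add_left hs]

variable (𝒜 ℒ) in
/-- The morphism from multiderivations to derivations of `Sym_A(L, A)`. -/
def eta (d : ℤ) : multider 𝒜 ℒ d →ₗ[K] symDer 𝒜 ℒ d := (etaEnd 𝒜 ℒ d).codRestrict _ etaEnd_mem

@[simp] theorem coe_eta {d : ℤ} (X : multider 𝒜 ℒ d) :
    (eta 𝒜 ℒ d X : Module.End K (Sym 𝒜 ℒ)) = etaEnd 𝒜 ℒ d X := rfl

theorem symComponent_eta {k : ℕ} {d : ℤ} {X : RawPair K A L k} (hX : X ∈ multiderHom 𝒜 ℒ k d)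
    {l : ℕ} {e : ℤ} (ω : symForms 𝒜 ℒ l e) (n : ℕ) :
    (symComponent 𝒜 ℒ n (d + e) (etaEnd 𝒜 ℒ d ⟨pairOf K A L k X, pairOf_mem 𝒜 ℒ hX⟩
      (symOf 𝒜 ℒ l e ω)) : Raw K L n A) = etaForm ℒ n d e X ω.1 := by
  rw [etaEnd_pairOf hX, etaHom_symOf]
  by_cases h : n = l + k - 1
  · subst h
    rw [symComponent_symOf]
  · rw [symComponent_symOf_of_ne (fun h' => h h'.1), IsMultiderivation.etaForm_eq_zero hX e _ h]
    rfl

/-- After evaluation on words this is the representation property `wordEta_bracket`. -/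
theorem isGradedLieMorphism_eta : IsGradedLieMorphism (isGradedLieAlgebra_multider 𝒜 ℒ)
    (isGradedLieAlgebra_symDer 𝒜 ℒ) (eta 𝒜 ℒ) := by
  intro i j X Y
  refine Subtype.ext (LinearMap.ext fun θ => sym_ext fun f => ?_)
  obtain ⟨e, rfl⟩ : ∃ e, f = i + j + e := ⟨f - (i + j), by ring⟩
  obtain ⟨-, h1, h2⟩ := multiderBracket_mem_and_words X.2 Y.2
  have h3 : symWord 𝒜 ℒ (i + j + e) (etaEnd 𝒜 ℒ i X (etaEnd 𝒜 ℒ j Y θ)) =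
      wordEta i (pairWord A ℒ X.1) (pairSymbolWord A ℒ X.1) (j + e)
        (wordEta j (pairWord A ℒ Y.1) (pairSymbolWord A ℒ Y.1) e (symWord 𝒜 ℒ e θ)) := by
    rw [add_assoc, symWord_etaEnd, symWord_etaEnd]
  have h4 : symWord 𝒜 ℒ (i + j + e) (etaEnd 𝒜 ℒ j Y (etaEnd 𝒜 ℒ i X θ)) =
      wordEta j (pairWord A ℒ Y.1) (pairSymbolWord A ℒ Y.1) (i + e)
        (wordEta i (pairWord A ℒ X.1) (pairSymbolWord A ℒ X.1) e (symWord 𝒜 ℒ e θ)) := by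
    rw [add_comm i j, add_assoc, symWord_etaEnd, symWord_etaEnd]
  simp only [coe_eta, gradedCommutator_apply, map_sub, map_smul, h3, h4]
  rw [symWord_etaEnd, h1, h2]
  exact wordEta_bracket i j e (isSymWord_pairWord X.2) (isSymWord_pairSymbolWord X.2)
    (isSymWord_pairWord Y.2) (isSymWord_pairSymbolWord Y.2) (isSymWord_symWord e θ)

end Eta

theorem sgn_neg (K : Type*) [Field K] (n : ℤ) : sgn K (-n) = sgn K n :=
  sgn_congr K ⟨-n, by ring⟩

/-! ### Functions supported on words of length one -/

section Support

variable {K : Type*} [Field K] {L : Type*} [AddCommGroup L] [Module K L] {ℒ : ℤ → Submodule K L}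
  {M : Type*} [AddCommGroup M] [Module K M]

theorem shuf_eq_left (F : List (Letter ℒ) → List (Letter ℒ) → M) (w : List (Letter ℒ))
    (hF : ∀ p x q, F p (x :: q) = 0) : shuf F w = F w [] := by
  induction w generalizing F with
  | nil => rfl
  | cons x w ih =>
    rw [shuf_cons, ih _ fun p y q => hF _ _ _]
    simp only [hF, smul_zero, shuf_zero, add_zero]

theorem contract_eq_unitWord {f : WordFun ℒ M} (hf : ∀ w : List (Letter ℒ), w.length ≠ 1 → f w = 0)
    (x : Letter ℒ) : contract x f = unitWord (f [x]) := by
  funext w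
  rcases w with _ | ⟨y, w⟩
  · rfl
  · exact hf _ (by simp)

/-- A one-letter argument is used up by the inserted value, so all of `w` must go into `Z`. -/
theorem wins_eq_of_support_one [DirectSum.Decomposition ℒ] {f : WordFun ℒ M}
    (hf : ∀ w : List (Letter ℒ), w.length ≠ 1 → f w = 0) (z : ℤ) (Z : WordFun ℒ L)
    (w : List (Letter ℒ)) : wins z f Z w = f [letter ℒ (z + wdeg w) (Z w)] :=
  shuf_eq_left _ w fun _ _ _ => hf _ (by simp)

theorem IsSymWord.letter_sum [DirectSum.Decomposition ℒ] {f : WordFun ℒ M} (hf : IsSymWord f)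
    (e : ℤ) {ι : Type*} (s : Finset ι) (x : ι → L) (w : List (Letter ℒ)) :
    f (letter ℒ e (∑ i ∈ s, x i) :: w) = ∑ i ∈ s, f (letter ℒ e (x i) :: w) := by
  let φ : L →+ M :=
    { toFun := fun y => f (letter ℒ e y :: w)
      map_zero' := by simpa using hf.letter_smul e 0 0 w
      map_add' := fun y z => hf.letter_add e y z w }
  exact map_sum φ x s

theorem wordOf_curryLeft {l : ℕ} (ω : Raw K L (l + 1) M) (b : Letter ℒ) :
    (wordOf (ω.curryLeft b.2) : WordFun ℒ M) = contract b (wordOf ω) := by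
  funext w
  rw [contract_apply]
  by_cases h : w.length = l
  · rw [wordOf_apply _ h, wordOf_apply _ (by simpa using h), MultilinearMap.curryLeft_apply]
    congr 1
    funext i
    refine Fin.cases ?_ (fun i => ?_) i <;> simp
  · rw [wordOf_eq_zero _ h, wordOf_eq_zero _ (by simpa using h)]

end Support

/-! ### Constants, contractions and dual bases of forms -/

section Forms

variable {K : Type*} [Field K] {A : Type*} [Ring A] [Algebra K A] {𝒜 : ℤ → Submodule K A}
  [GradedAlgebra 𝒜]
  {L : Type*} [AddCommGroup L] [Module K L] [Module A L] [IsScalarTower K A L]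
  {ℒ : ℤ → Submodule K L} [DirectSum.Decomposition ℒ] [SetLike.GradedSMul 𝒜 ℒ]

theorem hasWordDegree_symWord (e : ℤ) (θ : Sym 𝒜 ℒ) : HasWordDegree 𝒜 e (symWord 𝒜 ℒ e θ) :=
  fun w => (mem_symForms_iff.1 (symComponent 𝒜 ℒ w.length e θ).2).1 w

theorem isMultilinearWord_symWord (e : ℤ) (θ : Sym 𝒜 ℒ) :
    IsMultilinearWord 𝒜 e (symWord 𝒜 ℒ e θ) := by
  intro v r a ha x w
  rw [symWord_apply, symWord_apply]
  have h := (mem_symForms_iff.1 (symComponent 𝒜 ℒ (v ++ x :: w).length e θ).2).2.2 v r a ha x w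
  rw [show (v ++ smulLetter r a x :: w).length = (v ++ x :: w).length by simp]
  exact h

theorem symWord_eq_zero_of_mem_symPart {m e : ℤ} {θ : Sym 𝒜 ℒ} (h : θ ∈ symPart 𝒜 ℒ m e) (f : ℤ)
    (w : List (Letter ℒ)) (hw : ¬((w.length : ℤ) = m ∧ f = e)) : symWord 𝒜 ℒ f θ w = 0 := by
  rw [symWord_apply, h _ _ hw]
  exact congrFun wordOf_zero w

theorem exists_symForm {n : ℕ} {e : ℤ} {F : WordFun ℒ A} (hF : IsSymWord F)
    (hd : HasWordDegree 𝒜 e F) (hm : IsMultilinearWord 𝒜 e F)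
    (hs : ∀ w : List (Letter ℒ), w.length ≠ n → F w = 0) :
    ∃ ω : symForms 𝒜 ℒ n e, wordOf ω.1 = F := by
  obtain ⟨f, hf⟩ := hF.exists_wordOf n
  have h : wordOf f = F := funext fun w => by
    by_cases hw : w.length = n
    · exact hf w hw
    · rw [wordOf_eq_zero _ hw, hs w hw]
  exact ⟨⟨f, mem_symForms_iff.2 (by rw [h]; exact ⟨hd, hF, hm⟩)⟩, h⟩

/-- The contraction of a form with a homogeneous element. -/
def contractForm {l : ℕ} {e : ℤ} (b : Letter ℒ) (ω : symForms 𝒜 ℒ (l + 1) e) :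
    symForms 𝒜 ℒ l (e + b.1) :=
  ⟨ω.1.curryLeft b.2, mem_symForms_iff.2 <| by
    rw [wordOf_curryLeft]
    have h := mem_symForms_iff.1 ω.2
    exact ⟨h.1.contract b, h.2.1.contract b, h.2.2.contract b⟩⟩

theorem wordOf_contractForm {l : ℕ} {e : ℤ} (b : Letter ℒ) (ω : symForms 𝒜 ℒ (l + 1) e) :
    (wordOf (contractForm b ω).1 : WordFun ℒ A) = contract b (wordOf ω.1) :=
  wordOf_curryLeft ω.1 b

theorem wordOf_constOfIsEmpty (a : A) :
    (wordOf (MultilinearMap.constOfIsEmpty K (fun _ : Fin 0 => L) a) : WordFun ℒ A) =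
      unitWord a := by
  funext w
  rcases w with _ | ⟨x, w⟩
  · rfl
  · exact wordOf_eq_zero _ (by simp)

variable (𝒜 ℒ) in
/-- A homogeneous element of `A`, as a `0`-form. -/
def constForm (p : ℤ) : 𝒜 p →ₗ[K] symForms 𝒜 ℒ 0 p where
  toFun a := ⟨MultilinearMap.constOfIsEmpty K _ (a : A), mem_symForms_iff.2 <| by
    rw [wordOf_constOfIsEmpty]
    exact ⟨HasWordDegree.unitWord a.2, IsSymWord.unitWord _, IsMultilinearWord.unitWord _ _⟩⟩
  map_add' a b := rfl
  map_smul' c a := rfl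

theorem wordOf_constForm {p : ℤ} (a : 𝒜 p) :
    (wordOf (constForm 𝒜 ℒ p a).1 : WordFun ℒ A) = unitWord (a : A) := wordOf_constOfIsEmpty _

theorem exists_constForm {p : ℤ} (ω : symForms 𝒜 ℒ 0 p) : ∃ a, constForm 𝒜 ℒ p a = ω := by
  have h := (mem_symForms_iff.1 ω.2).1 []
  rw [wdeg_nil, add_zero] at h
  refine ⟨⟨_, h⟩, Subtype.ext (wordOf_injective (ℒ := ℒ) ?_)⟩
  rw [wordOf_constForm]
  funext w
  rcases w with _ | ⟨x, w⟩
  · rfl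
  · exact (wordOf_eq_zero _ (by simp)).symm

variable (𝒜 ℒ) in
/-- A finite family of homogeneous elements of `L` together with `1`-forms that give the
coefficients of all elements of `L`. -/
structure DualBasis (ι : Type*) [Fintype ι] where
  /-- the generators -/
  b : ι → Letter ℒ
  /-- the coefficients -/
  ε : ∀ i, symForms 𝒜 ℒ 1 (-(b i).1)
  -- The sign converts the graded linear `1`-form of degree `-(b i).1` back into an ordinary
  -- coordinate.
  expand : ∀ x : Letter ℒ,
    (x.2 : L) = ∑ i, sgn K ((b i).1 * x.1) • wordOf (ε i).1 [x] • ((b i).2 : L)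

namespace DualBasis

variable {ι : Type*} [Fintype ι] (β : DualBasis 𝒜 ℒ ι)

/-- The coefficients, as functions of words. -/
def coeff (i : ι) : WordFun ℒ A := wordOf (β.ε i).1

theorem coeff_support (i : ι) (w : List (Letter ℒ)) (hw : w.length ≠ 1) : β.coeff i w = 0 :=
  wordOf_eq_zero _ hw

theorem hasWordDegree_coeff (i : ι) : HasWordDegree 𝒜 (-(β.b i).1) (β.coeff i) :=
  (mem_symForms_iff.1 (β.ε i).2).1

theorem coeff_mem (i : ι) (x : Letter ℒ) : β.coeff i [x] ∈ 𝒜 (-(β.b i).1 + x.1) := by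
  simpa using β.hasWordDegree_coeff i [x]

/-- A function with values in `L` is determined by its coefficients. -/
theorem eq_zero_of_wins {z : ℤ} {Z : WordFun ℒ L} (hZ : HasWordDegree ℒ z Z)
    (h : ∀ i, wins z (β.coeff i) Z = 0) : Z = 0 := by
  funext w
  have h1 := β.expand (letter ℒ (z + wdeg w) (Z w))
  rw [letter_snd (hZ w)] at h1
  rw [h1]
  refine Finset.sum_eq_zero fun i _ => ?_
  have h2 := congrFun (h i) w
  rw [wins_eq_of_support_one (β.coeff_support i)] at h2
  change _ • β.coeff i _ • _ = _
  rw [h2, Pi.zero_apply, zero_smul, smul_zero]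

/-- Expands the first argument in the dual basis and pulls out the coefficients by
`A`-multilinearity. -/
theorem apply_cons {e : ℤ} {ω : WordFun ℒ A} (hω : IsSymWord ω) (hω₁ : IsMultilinearWord 𝒜 e ω)
    (x : Letter ℒ) (w : List (Letter ℒ)) : ω (x :: w) = ∑ i,
      sgn K ((β.b i).1 * x.1 + (-(β.b i).1 + x.1) * e) • (β.coeff i [x] * ω (β.b i :: w)) := by
  conv_lhs => rw [← letter_coe x, β.expand x]
  rw [hω.letter_sum]
  refine Finset.sum_congr rfl fun i _ => ?_
  have h1 : letter ℒ x.1 (β.coeff i [x] • ((β.b i).2 : L)) =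
      smulLetter (-(β.b i).1 + x.1) (β.coeff i [x]) (β.b i) := by
    rw [smulLetter]
    congr 1
    ring
  have h2 := hω₁ [] _ _ (β.coeff_mem i x) (β.b i) w
  rw [List.nil_append, List.nil_append, wdeg_nil, add_zero] at h2
  change ω (letter ℒ x.1 (_ • β.coeff i [x] • _) :: w) = _
  rw [hω.letter_smul, h1, h2, smul_smul, ← sgn_add, smul_eq_mul]

/-- Euler's identity. -/
theorem euler {e : ℤ} {ω : WordFun ℒ A} (hω : IsSymWord ω) (hω₁ : IsMultilinearWord 𝒜 e ω)
    (w : List (Letter ℒ)) : ∑ i, sgn K (e * (β.b i).1) •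
      wmul (actionMap K A A) (e + (β.b i).1) (β.coeff i) (contract (β.b i) ω) w =
        (w.length : K) • ω w := by
  induction w generalizing e ω with
  | nil =>
    simp only [List.length_nil, Nat.cast_zero, zero_smul]
    refine Finset.sum_eq_zero fun i _ => ?_
    rw [wmul_nil, β.coeff_support i [] (by simp), map_zero, LinearMap.zero_apply, smul_zero]
  | cons x w ih =>
    -- If the first letter enters the coefficient, `apply_cons` yields one copy of the value of `ω`;
    -- if it enters the contracted form, the induction hypothesis yields the remaining `w.length`
    -- copies.
    have h1 := ih (hω.contract x) (hω₁.contract x)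
    have h2 := β.apply_cons hω hω₁ x w
    rw [List.length_cons, Nat.cast_add, Nat.cast_one, add_smul, one_smul]
    rw [contract_apply] at h1
    rw [← h1, h2, ← Finset.sum_add_distrib]
    refine Finset.sum_congr rfl fun i _ => ?_
    rw [wmul_cons, contract_eq_unitWord (β.coeff_support i), wmul_unitWord_left,
      hω.contract_swap x (β.b i), map_smul, Pi.smul_apply, add_right_comm e, smul_add]
    change _ • _ • (β.coeff i [x] * ω (β.b i :: w)) + _ = _
    generalize β.coeff i [x] * ω (β.b i :: w) = y
    match_scalars <;>
      (try simp only [mul_one, mul_add, add_mul, neg_mul, mul_neg, sgn_add, sgn_neg,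
        mul_comm (G := ℤ)]) <;> grind [sgn_mul_self]

end DualBasis
end Forms

/-! ### Derivations determined on generators; injectivity of the morphism -/

section Injective

variable {K : Type*} [Field K] {A : Type*} [Ring A] [Algebra K A] {𝒜 : ℤ → Submodule K A}
  [GradedAlgebra 𝒜] [IsGradedCommutative 𝒜]
  {L : Type*} [AddCommGroup L] [Module K L] [Module A L] [IsScalarTower K A L]
  {ℒ : ℤ → Submodule K L} [DirectSum.Decomposition ℒ] [SetLike.GradedSMul 𝒜 ℒ]

theorem symWord_symMul_of_mem {m e : ℤ} {θ : Sym 𝒜 ℒ} (hθ : θ ∈ symPart 𝒜 ℒ m e) (e' : ℤ)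
    (θ' : Sym 𝒜 ℒ) : symWord 𝒜 ℒ (e + e') (symMul 𝒜 ℒ θ θ') =
      wmul (actionMap K A A) e' (symWord 𝒜 ℒ e θ) (symWord 𝒜 ℒ e' θ') := by
  rcases lt_or_ge m 0 with hm | hm
  · rw [eq_zero_of_mem_symPart hm hθ]
    simp only [map_zero, LinearMap.zero_apply]
  · lift m to ℕ using hm
    rw [← exists_symOf_of_mem_symPart hθ, symWord_symMul, symWord_symOf]

theorem hasWordDegree_pairWord {d : ℤ} {X : RawPairs K A L} (hX : X ∈ multider 𝒜 ℒ d) :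
    HasWordDegree ℒ d (pairWord A ℒ X) := fun w => by
  rw [pairWord_apply]
  exact hasWordDegree_wordOf.2 (hX w.length).hasDegree w

namespace DualBasis

variable {ι : Type*} [Fintype ι] (β : DualBasis 𝒜 ℒ ι)

/-- Writes a multiple of a form of positive form degree through `1`-forms of the dual basis and
forms with one entry less, as required for induction on the form degree. -/
theorem euler_symOf {l : ℕ} {e : ℤ} (ω : symForms 𝒜 ℒ (l + 1) e) :
    ((l + 1 : ℕ) : K) • symOf 𝒜 ℒ (l + 1) e ω = ∑ i, sgn K (e * (β.b i).1) •
      symMul 𝒜 ℒ (symOf 𝒜 ℒ 1 _ (β.ε i)) (symOf 𝒜 ℒ l _ (contractForm (β.b i) ω)) := by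
  refine sym_ext fun f => ?_
  have h1 : ∀ i, symWord 𝒜 ℒ f (symMul 𝒜 ℒ (symOf 𝒜 ℒ 1 _ (β.ε i))
      (symOf 𝒜 ℒ l _ (contractForm (β.b i) ω))) = wmul (actionMap K A A) (f + (β.b i).1) (β.coeff i)
        (symWord 𝒜 ℒ (f + (β.b i).1) (symOf 𝒜 ℒ l _ (contractForm (β.b i) ω))) := by
    intro i
    rw [coeff, ← symWord_symMul]
    congr 2
    ring
  simp only [map_smul, map_sum, h1]
  have h := mem_symForms_iff.1 ω.2
  by_cases hf : f = e
  · subst hf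
    funext w
    simp only [symWord_symOf, wordOf_contractForm, Finset.sum_apply, Pi.smul_apply,
      β.euler h.2.1 h.2.2]
    by_cases hw : w.length = l + 1
    · rw [hw]
    · rw [wordOf_eq_zero _ hw, smul_zero, smul_zero]
  · rw [symWord_symOf_of_ne hf, smul_zero]
    refine (Finset.sum_eq_zero fun i _ => ?_).symm
    rw [symWord_symOf_of_ne (by omega), map_zero, smul_zero]

include β in
/-- A derivation that vanishes on `A` and on the `1`-forms of a dual basis is zero. -/
theorem symDerHom_eq_zero [CharZero K] {r d : ℤ} {D : Module.End K (Sym 𝒜 ℒ)}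
    (hD : D ∈ symDerHom 𝒜 ℒ r d) (h0 : ∀ p (a : 𝒜 p), D (symOf 𝒜 ℒ 0 p (constForm 𝒜 ℒ p a)) = 0)
    (h1 : ∀ i, D (symOf 𝒜 ℒ 1 _ (β.ε i)) = 0) : D = 0 := by
  refine sym_linearMap_ext fun l e ω => ?_
  rw [LinearMap.zero_apply]
  induction l generalizing e with
  | zero =>
    obtain ⟨a, rfl⟩ := exists_constForm ω
    exact h0 e a
  | succ l ih =>
    -- Characteristic zero allows division by the factor in Euler's identity.
    have h2 : ((l + 1 : ℕ) : K) ≠ 0 := Nat.cast_ne_zero.2 (by omega)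
    have h3 : ((l + 1 : ℕ) : K) • D (symOf 𝒜 ℒ (l + 1) e ω) = 0 := by
      rw [← map_smul, β.euler_symOf ω, map_sum]
      refine Finset.sum_eq_zero fun i _ => ?_
      rw [map_smul, hD.2, h1, ih, map_zero, map_zero, LinearMap.zero_apply, smul_zero, add_zero,
        smul_zero]
    exact (smul_eq_zero.1 h3).resolve_left h2

-- Evaluation on constants gives the symbol. Once this vanishes, evaluation on a `1`-form of the
-- dual basis is, up to sign, a coefficient of the multiderivation.
include β in
theorem eta_injective (d : ℤ) : Function.Injective (eta 𝒜 ℒ d) := by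
  rw [injective_iff_map_eq_zero]
  intro X hX
  have h0 : etaEnd 𝒜 ℒ d X = 0 := congrArg Subtype.val hX
  have h : ∀ e θ, wordEta d (pairWord A ℒ X.1) (pairSymbolWord A ℒ X.1) e (symWord 𝒜 ℒ e θ) = 0 :=
    fun e θ => by rw [← symWord_etaEnd, h0, LinearMap.zero_apply, map_zero]
  have hσ : pairSymbolWord A ℒ X.1 = 0 := by
    funext w
    refine linearMap_ext_homogeneous 𝒜 fun p a ha => ?_
    have h1 := h p (symOf 𝒜 ℒ 0 p (constForm 𝒜 ℒ p ⟨a, ha⟩))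
    rw [symWord_symOf, wordOf_constForm, wordEta_unitWord] at h1
    have h2 := congrArg (sgn K (p * wdeg w) • ·) (congrFun h1 w)
    rw [Pi.zero_apply, LinearMap.zero_apply]
    simpa only [sgn_smul_sgn_smul, Pi.zero_apply, smul_zero] using h2
  have hw : pairWord A ℒ X.1 = 0 := by
    refine β.eq_zero_of_wins (hasWordDegree_pairWord X.2) fun i => ?_
    have h1 := h (-(β.b i).1) (symOf 𝒜 ℒ 1 _ (β.ε i))
    rw [symWord_symOf, wordEta, hσ, map_zero, LinearMap.zero_apply, zero_sub, neg_eq_zero] at h1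
    have h2 := congrArg (sgn K (d * -(β.b i).1) • ·) h1
    rw [coeff]
    simpa only [sgn_smul_sgn_smul, smul_zero] using h2
  refine Subtype.ext (multider_ext X.2 (Submodule.zero_mem _) ?_ ?_)
  · rw [hw, Submodule.coe_zero, map_zero]
  · rw [hσ, Submodule.coe_zero, map_zero]

end DualBasis
end Injective

/-! ### Finite sums, signs and supports of functions of words -/

section WordLemmas

variable {K : Type*} [Field K] {L : Type*} [AddCommGroup L] [Module K L] {ℒ : ℤ → Submodule K L}
  {M : Type*} [AddCommGroup M] [Module K M]

/-- The sign is produced by multiplying with the constant `1`, treated as having degree `p`, so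
symmetry is that of a product. -/
theorem IsSymWord.sgn_smul {f : WordFun ℒ M} (hf : IsSymWord f) (p : ℤ) :
    IsSymWord (fun w => sgn K (p * wdeg w) • f w) := by
  have := hf.wmul (LinearMap.lsmul K M).flip p (IsSymWord.unitWord (ℒ := ℒ) (1 : K))
  rw [wmul_unitWord_right] at this
  simpa using this

theorem IsSymWord.sum {ι : Type*} (s : Finset ι) {f : ι → WordFun ℒ M}
    (hf : ∀ i ∈ s, IsSymWord (f i)) : IsSymWord (∑ i ∈ s, f i) := by
  classical
  induction s using Finset.induction_on with
  | empty => exact IsSymWord.zero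
  | insert i s hi ih =>
    rw [Finset.sum_insert hi]
    exact (hf i (by simp)).add' (ih fun j hj => hf j (by simp [hj]))

theorem HasWordDegree.sum {ι : Type*} (s : Finset ι) {ℳ : ℤ → Submodule K M} {d : ℤ}
    {f : ι → WordFun ℒ M} (hf : ∀ i ∈ s, HasWordDegree ℳ d (f i)) :
    HasWordDegree ℳ d (∑ i ∈ s, f i) := fun w => by
  rw [Finset.sum_apply]
  exact Submodule.sum_mem _ fun i hi => hf i hi w

theorem wins_sum_right [DirectSum.Decomposition ℒ] {f : WordFun ℒ M} (hf : IsSymWord f) (e : ℤ)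
    {ι : Type*} (s : Finset ι) (g : ι → WordFun ℒ L) :
    wins e f (∑ i ∈ s, g i) = ∑ i ∈ s, wins e f (g i) := by
  let φ : WordFun ℒ L →+ WordFun ℒ M :=
    { toFun := wins e f
      map_zero' := wins_zero_right hf e
      map_add' := wins_add_right hf e }
  exact map_sum φ g s

theorem wmul_eq_zero_of_support {M₁ M₂ : Type*} [AddCommGroup M₁] [Module K M₁] [AddCommGroup M₂]
    [Module K M₂] (B : M₁ →ₗ[K] M₂ →ₗ[K] M) (e : ℤ) {f : WordFun ℒ M₁} {g : WordFun ℒ M₂} {m n : ℤ}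
    (hf : ∀ w : List (Letter ℒ), (w.length : ℤ) ≠ m → f w = 0)
    (hg : ∀ w : List (Letter ℒ), (w.length : ℤ) ≠ n → g w = 0) {w : List (Letter ℒ)}
    (hw : (w.length : ℤ) ≠ m + n) : wmul B e f g w = 0 := by
  refine shuf_eq_zero _ _ fun p q hpq => ?_
  by_cases hp : (p.length : ℤ) = m
  · rw [hg q (by omega), map_zero, smul_zero]
  · rw [hf p hp, map_zero, LinearMap.zero_apply, smul_zero]

end WordLemmas

/-! ### The symbol of a derivation -/

section Reconstruction

variable {K : Type*} [Field K] {A : Type*} [Ring A] [Algebra K A] {𝒜 : ℤ → Submodule K A}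
  [GradedAlgebra 𝒜]
  {L : Type*} [AddCommGroup L] [Module K L] [Module A L] [IsScalarTower K A L]
  {ℒ : ℤ → Submodule K L} [DirectSum.Decomposition ℒ] [SetLike.GradedSMul 𝒜 ℒ]

/-- The product of an element of `A` with the action of a symbol. -/
theorem wmul_smul_symbol (e : ℤ) (a : A) (σ : WordFun ℒ (A →ₗ[K] A)) (ω : WordFun ℒ A)
    (w : List (Letter ℒ)) :
    wmul LinearMap.id e (fun v => a • σ v) ω w = a * wmul LinearMap.id e σ ω w := by
  rw [wmul_apply, wmul_apply]
  refine Eq.trans ?_ (shuf_map (actionMap K A A a) _ w)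
  congr 1
  funext p q
  exact ((actionMap K A A a).map_smul _ _).symm

/-- The Leibniz rule for the action of a symbol on a `1`-form. -/
theorem wmul_symbol_smulLetter {d e : ℤ} {σ : WordFun ℒ (A →ₗ[K] A)}
    (hσ : HasWordDegree (algDer 𝒜) d σ) (hσ₁ : IsMultilinearWord 𝒜 d σ) {ω : WordFun ℒ A}
    (hω : IsMultilinearWord 𝒜 e ω) (hs : ∀ w : List (Letter ℒ), w.length ≠ 1 → ω w = 0) {r : ℤ}
    {a : A} (ha : a ∈ 𝒜 r) (x : Letter ℒ) (w : List (Letter ℒ)) :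
    wmul LinearMap.id e σ ω (smulLetter r a x :: w) =
      sgn K (r * (d + e)) • (a * wmul LinearMap.id e σ ω (x :: w)) +
        sgn K ((e + r + x.1) * wdeg w + r * e) • (σ w a * ω [x]) := by
  have h1 : contract (smulLetter r a x) σ = sgn K (r * d) • fun v => a • contract x σ v := by
    funext v
    simpa using hσ₁ [] r a ha x v
  have h2 : ω [smulLetter r a x] = sgn K (r * e) • (a * ω [x]) := by
    simpa using hω [] r a ha x []
  rw [wmul_cons, wmul_cons, contract_eq_unitWord hs, contract_eq_unitWord hs, h1, h2,
    wmul_unitWord_right, wmul_unitWord_right, map_smul, LinearMap.smul_apply, Pi.smul_apply,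
    wmul_smul_symbol, smulLetter_fst]
  simp only [LinearMap.id_apply, map_smul, (hσ w).2 r a _ ha, mul_add, mul_smul_comm]
  match_scalars <;>
    (try simp only [mul_one, mul_add, add_mul, neg_mul, mul_neg, sgn_add, sgn_neg,
      mul_comm (G := ℤ)]) <;> grind [sgn_mul_self]

variable (𝒜 ℒ) in
/-- The symbol of an endomorphism of degree `d` of `Sym_A(L, A)`. -/
def derSymbol (D : Module.End K (Sym 𝒜 ℒ)) (d : ℤ) : WordFun ℒ (A →ₗ[K] A) := fun w =>
  -- The sign undoes the one in `wordEta_unitWord`, so that the symbol acts on constants exactly as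
  -- `D` does.
  DirectSum.toModule K ℤ A (fun p => sgn K (p * wdeg w) •
    (LinearMap.proj w ∘ₗ symWord 𝒜 ℒ (d + p) ∘ₗ D ∘ₗ symOf 𝒜 ℒ 0 p ∘ₗ constForm 𝒜 ℒ p)) ∘ₗ
      (DirectSum.decomposeLinearEquiv 𝒜).toLinearMap

theorem derSymbol_apply (D : Module.End K (Sym 𝒜 ℒ)) (d : ℤ) (w : List (Letter ℒ)) {p : ℤ}
    (a : 𝒜 p) : derSymbol 𝒜 ℒ D d w a = sgn K (p * wdeg w) •
      symWord 𝒜 ℒ (d + p) (D (symOf 𝒜 ℒ 0 p (constForm 𝒜 ℒ p a))) w := by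
  rw [derSymbol, LinearMap.comp_apply, LinearEquiv.coe_coe,
    DirectSum.decomposeLinearEquiv_apply_coe, DirectSum.toModule_lof]
  rfl

theorem wmul_derSymbol_unitWord (D : Module.End K (Sym 𝒜 ℒ)) (d : ℤ) {p : ℤ} (a : 𝒜 p) :
    wmul LinearMap.id p (derSymbol 𝒜 ℒ D d) (unitWord (a : A)) =
      symWord 𝒜 ℒ (d + p) (D (symOf 𝒜 ℒ 0 p (constForm 𝒜 ℒ p a))) := by
  rw [wmul_unitWord_right]
  funext w
  rw [LinearMap.id_apply, derSymbol_apply, sgn_smul_sgn_smul]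

theorem isSymWord_of_apply {σ : WordFun ℒ (A →ₗ[K] A)}
    (h : ∀ p (a : 𝒜 p), IsSymWord fun w => σ w a) : IsSymWord σ where
  add v i x y w := linearMap_ext_homogeneous 𝒜 fun p a ha => (h p ⟨a, ha⟩).add v i x y w
  smul v i c x w := linearMap_ext_homogeneous 𝒜 fun p a ha => (h p ⟨a, ha⟩).smul v i c x w
  swap v x y w := linearMap_ext_homogeneous 𝒜 fun p a ha => (h p ⟨a, ha⟩).swap v x y w

theorem isSymWord_derSymbol (D : Module.End K (Sym 𝒜 ℒ)) (d : ℤ) :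
    IsSymWord (derSymbol 𝒜 ℒ D d) := by
  refine isSymWord_of_apply (𝒜 := 𝒜) fun p a => ?_
  simp only [derSymbol_apply]
  exact (isSymWord_symWord _ _).sgn_smul p

theorem isMultilinearWord_derSymbol (D : Module.End K (Sym 𝒜 ℒ)) (d : ℤ) :
    IsMultilinearWord 𝒜 d (derSymbol 𝒜 ℒ D d) := by
  intro v r a ha x w
  refine linearMap_ext_homogeneous 𝒜 fun p b hb => ?_
  have h := isMultilinearWord_symWord (d + p) (D (symOf 𝒜 ℒ 0 p (constForm 𝒜 ℒ p ⟨b, hb⟩)))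
    v r a ha x w
  rw [LinearMap.smul_apply, LinearMap.smul_apply, derSymbol_apply D d _ ⟨b, hb⟩,
    derSymbol_apply D d _ ⟨b, hb⟩, h]
  simp only [wdeg_append, wdeg_cons, smulLetter_fst, smul_eq_mul, mul_smul_comm]
  match_scalars <;>
    (try simp only [mul_one, mul_add, add_mul, neg_mul, mul_neg, sgn_add, sgn_neg,
      mul_comm (G := ℤ)]) <;> grind [sgn_mul_self]

variable [IsGradedCommutative 𝒜]

theorem symOf_constForm_mul {p q : ℤ} (a : 𝒜 p) (b : 𝒜 q) :
    symOf 𝒜 ℒ 0 (p + q) (constForm 𝒜 ℒ (p + q) ⟨a * b, SetLike.mul_mem_graded a.2 b.2⟩) =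
      symMul 𝒜 ℒ (symOf 𝒜 ℒ 0 p (constForm 𝒜 ℒ p a)) (symOf 𝒜 ℒ 0 q (constForm 𝒜 ℒ q b)) := by
  rw [symMul_symOf]
  refine congrArg (symOf 𝒜 ℒ 0 (p + q)) (Subtype.ext (wordOf_injective (ℒ := ℒ) ?_))
  refine (wordOf_constForm _).trans (Eq.trans ?_ (wordOf_formMul q _ _).symm)
  rw [wordOf_constForm, wordOf_constForm, wmul_unitWord_left]
  funext w
  cases w <;> simp

section

variable {r d : ℤ} {D : Module.End K (Sym 𝒜 ℒ)} (hD : D ∈ symDerHom 𝒜 ℒ r d)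
include hD

/-- Constants multiply as elements of `A`, so the Leibniz rule of `D` on a product of two constants
is the derivation rule for each value of the symbol. -/
theorem hasWordDegree_derSymbol : HasWordDegree (algDer 𝒜) d (derSymbol 𝒜 ℒ D d) := by
  intro w
  refine ⟨fun p a ha => ?_, fun p a b ha => ?_⟩
  · rw [derSymbol_apply D d w ⟨a, ha⟩, add_right_comm]
    exact Submodule.smul_mem _ _ (hasWordDegree_symWord _ _ w)
  · refine DFunLike.congr_fun (linearMap_ext_homogeneous 𝒜
      (f := derSymbol 𝒜 ℒ D d w ∘ₗ LinearMap.mulLeft K a)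
      (g := LinearMap.mulLeft K (derSymbol 𝒜 ℒ D d w a) + sgn K ((d + wdeg w) * p) •
        (LinearMap.mulLeft K a ∘ₗ derSymbol 𝒜 ℒ D d w)) fun q b hb => ?_) b
    have h1 := derSymbol_apply D d w (⟨a * b, SetLike.mul_mem_graded ha hb⟩ : 𝒜 (p + q))
    have h2 := symOf_constForm_mul (ℒ := ℒ) (⟨a, ha⟩ : 𝒜 p) (⟨b, hb⟩ : 𝒜 q)
    have h3 : symWord 𝒜 ℒ (d + (p + q)) (symMul 𝒜 ℒ
        (D (symOf 𝒜 ℒ 0 p (constForm 𝒜 ℒ p ⟨a, ha⟩)))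
        (symOf 𝒜 ℒ 0 q (constForm 𝒜 ℒ q ⟨b, hb⟩))) w = sgn K (q * wdeg w) •
          (symWord 𝒜 ℒ (d + p) (D (symOf 𝒜 ℒ 0 p (constForm 𝒜 ℒ p ⟨a, ha⟩))) w * b) := by
      rw [← add_assoc, symWord_symMul_of_mem (hD.1 0 p _), symWord_symOf, wordOf_constForm,
        wmul_unitWord_right]
      rfl
    have h4 : symWord 𝒜 ℒ (d + (p + q)) (symMul 𝒜 ℒ
        (symOf 𝒜 ℒ 0 p (constForm 𝒜 ℒ p ⟨a, ha⟩))
        (D (symOf 𝒜 ℒ 0 q (constForm 𝒜 ℒ q ⟨b, hb⟩)))) w =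
          a * symWord 𝒜 ℒ (d + q) (D (symOf 𝒜 ℒ 0 q (constForm 𝒜 ℒ q ⟨b, hb⟩))) w := by
      rw [add_left_comm, symWord_symMul, wordOf_constForm, wmul_unitWord_left]
      rfl
    rw [h2, hD.2, map_add, map_smul, Pi.add_apply, Pi.smul_apply, h3, h4] at h1
    simp only [LinearMap.comp_apply, LinearMap.add_apply, LinearMap.smul_apply,
      LinearMap.mulLeft_apply]
    refine h1.trans ?_
    rw [derSymbol_apply D d w ⟨a, ha⟩, derSymbol_apply D d w ⟨b, hb⟩, smul_mul_assoc, mul_smul_comm]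
    match_scalars <;>
      (try simp only [mul_one, mul_add, add_mul, neg_mul, mul_neg, sgn_add, sgn_neg,
        mul_comm (G := ℤ)]) <;> grind [sgn_mul_self]

theorem derSymbol_eq_zero {w : List (Letter ℒ)} (hw : (w.length : ℤ) ≠ r) :
    derSymbol 𝒜 ℒ D d w = 0 := by
  refine linearMap_ext_homogeneous 𝒜 fun p a ha => ?_
  rw [derSymbol_apply D d w ⟨a, ha⟩, symWord_eq_zero_of_mem_symPart (hD.1 0 p _) _ _ (by
    push_cast; omega), smul_zero, LinearMap.zero_apply]

end

end Reconstruction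

/-! ### Reconstruction of a multiderivation; surjectivity of the morphism -/

section Surjective

variable {K : Type*} [Field K] {A : Type*} [Ring A] [Algebra K A] {𝒜 : ℤ → Submodule K A}
  [GradedAlgebra 𝒜] [IsGradedCommutative 𝒜]
  {L : Type*} [AddCommGroup L] [Module K L] [Module A L] [IsScalarTower K A L]
  {ℒ : ℤ → Submodule K L} [DirectSum.Decomposition ℒ] [SetLike.GradedSMul 𝒜 ℒ]

/-- The difference of the symbol of `D` and of `D` itself on `1`-forms. -/
def derRemainder (D : Module.End K (Sym 𝒜 ℒ)) (d : ℤ) {e : ℤ} (ω : symForms 𝒜 ℒ 1 e) :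
    WordFun ℒ A :=
  -- Up to sign, this is what insertion of the sought `X` into `ω` has to give.
  wmul LinearMap.id e (derSymbol 𝒜 ℒ D d) (wordOf ω.1) - symWord 𝒜 ℒ (d + e) (D (symOf 𝒜 ℒ 1 e ω))

theorem isSymWord_derRemainder (D : Module.End K (Sym 𝒜 ℒ)) (d : ℤ) {e : ℤ}
    (ω : symForms 𝒜 ℒ 1 e) : IsSymWord (derRemainder D d ω) :=
  ((isSymWord_derSymbol D d).wmul _ e (mem_symForms_iff.1 ω.2).2.1).sub (isSymWord_symWord _ _)

section

variable {r d : ℤ} {D : Module.End K (Sym 𝒜 ℒ)} (hD : D ∈ symDerHom 𝒜 ℒ r d)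
include hD

theorem hasWordDegree_derRemainder {e : ℤ} (ω : symForms 𝒜 ℒ 1 e) :
    HasWordDegree 𝒜 (d + e) (derRemainder D d ω) :=
  ((hasWordDegree_derSymbol hD).wmul
    (fun i j (x : A →ₗ[K] A) y (hx : x ∈ algDer 𝒜 i) hy => hx.1 j y hy)
    (mem_symForms_iff.1 ω.2).1).sub (hasWordDegree_symWord _ _)

theorem derRemainder_eq_zero {e : ℤ} (ω : symForms 𝒜 ℒ 1 e) {w : List (Letter ℒ)}
    (hw : (w.length : ℤ) ≠ r + 1) : derRemainder D d ω w = 0 := by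
  rw [derRemainder, Pi.sub_apply, symWord_eq_zero_of_mem_symPart (hD.1 1 e ω) _ _ (by
    push_cast; omega), sub_zero]
  exact wmul_eq_zero_of_support _ e (fun w => derSymbol_eq_zero hD)
    (fun w (hw : (w.length : ℤ) ≠ 1) => wordOf_eq_zero _ (by omega)) hw

/-- The form `D ω` is `A`-multilinear, so the defect comes entirely from the derivation-valued
symbol. This becomes the Leibniz rule of the reconstructed map. -/
theorem derRemainder_smulLetter {e : ℤ} (ω : symForms 𝒜 ℒ 1 e) {p : ℤ} {a : A} (ha : a ∈ 𝒜 p)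
    (x : Letter ℒ) (w : List (Letter ℒ)) :
    derRemainder D d ω (smulLetter p a x :: w) =
      sgn K (p * (d + e)) • (a * derRemainder D d ω (x :: w)) +
        sgn K ((e + p + x.1) * wdeg w + p * e) • (derSymbol 𝒜 ℒ D d w a * wordOf ω.1 [x]) := by
  have h1 := wmul_symbol_smulLetter (hasWordDegree_derSymbol hD) (isMultilinearWord_derSymbol D d)
    (mem_symForms_iff.1 ω.2).2.2 (fun w => wordOf_eq_zero _) ha x w
  have h2 := isMultilinearWord_symWord (d + e) (D (symOf 𝒜 ℒ 1 e ω)) [] p a ha x w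
  rw [List.nil_append, List.nil_append, wdeg_nil, add_zero, smul_eq_mul] at h2
  rw [derRemainder, Pi.sub_apply, Pi.sub_apply, h1, h2, mul_sub, smul_sub]
  abel

variable {ι : Type*} [Fintype ι] (β : DualBasis 𝒜 ℒ ι)

/-- For a `1`-form, Euler's identity has factor one and expands `ω` in the forms `ε i` with constant
coefficients. The remainder respects this expansion since symbol and derivation agree on constants.
-/
theorem DualBasis.derRemainder_eq_sum {e : ℤ} (ω : symForms 𝒜 ℒ 1 e) :
    derRemainder D d ω = ∑ i, sgn K (e * (β.b i).1) • wmul (actionMap K A A) (e + (β.b i).1)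
      (derRemainder D d (β.ε i)) (contract (β.b i) (wordOf ω.1)) := by
  have hω := mem_symForms_iff.1 ω.2
  have h1 : (wordOf ω.1 : WordFun ℒ A) = ∑ i, sgn K (e * (β.b i).1) •
      wmul (actionMap K A A) (e + (β.b i).1) (β.coeff i) (contract (β.b i) (wordOf ω.1)) := by
    funext w
    simp only [Finset.sum_apply, Pi.smul_apply]
    rw [β.euler hω.2.1 hω.2.2]
    by_cases hw : w.length = 1
    · rw [hw, Nat.cast_one, one_smul]
    · rw [wordOf_eq_zero _ hw, smul_zero]
  have h2 : symOf 𝒜 ℒ 1 e ω = ∑ i, sgn K (e * (β.b i).1) •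
      symMul 𝒜 ℒ (symOf 𝒜 ℒ 1 _ (β.ε i)) (symOf 𝒜 ℒ 0 _ (contractForm (β.b i) ω)) := by
    have := β.euler_symOf ω
    rwa [Nat.cast_one, one_smul] at this
  rw [derRemainder, h2, map_sum, map_sum]
  conv_lhs => enter [1]; rw [h1, map_sum]
  rw [← Finset.sum_sub_distrib]
  refine Finset.sum_congr rfl fun i _ => ?_
  obtain ⟨a, ha⟩ := exists_constForm (contractForm (β.b i) ω)
  have h3 : contract (β.b i) (wordOf ω.1 : WordFun ℒ A) = unitWord (a : A) := by
    rw [← wordOf_contractForm, ← ha, wordOf_constForm]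
  -- In the Leibniz expansion of the symbol on `ε i` times `a`, the term that differentiates `a` is
  -- `D` on the constant; it cancels `h6`.
  have h4 := wmul_symbol_wmul (hasWordDegree_derSymbol hD) (e' := e + (β.b i).1)
    (ω' := unitWord (a : A)) (β.hasWordDegree_coeff i)
  rw [wmul_derSymbol_unitWord, neg_add_cancel_comm_assoc] at h4
  have h5 : symWord 𝒜 ℒ (d + e) (symMul 𝒜 ℒ (D (symOf 𝒜 ℒ 1 _ (β.ε i)))
      (symOf 𝒜 ℒ 0 _ (constForm 𝒜 ℒ _ a))) = wmul (actionMap K A A) (e + (β.b i).1)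
        (symWord 𝒜 ℒ (d + -(β.b i).1) (D (symOf 𝒜 ℒ 1 _ (β.ε i)))) (unitWord (a : A)) := by
    rw [← wordOf_constForm, ← symWord_symOf, ← symWord_symMul_of_mem (hD.1 1 _ _)]
    congr 2
    ring
  have h6 : symWord 𝒜 ℒ (d + e) (symMul 𝒜 ℒ (symOf 𝒜 ℒ 1 _ (β.ε i))
      (D (symOf 𝒜 ℒ 0 _ (constForm 𝒜 ℒ _ a)))) = wmul (actionMap K A A) (e + (β.b i).1 + d)
        (β.coeff i) (symWord 𝒜 ℒ (d + (e + (β.b i).1)) (D (symOf 𝒜 ℒ 0 _ (constForm 𝒜 ℒ _ a)))) := by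
    rw [DualBasis.coeff, add_comm _ d, ← symWord_symMul]
    congr 2
    ring
  rw [h3, ← ha, map_smul, map_smul, map_smul, h4, hD.2, map_add, map_smul, h5, h6, derRemainder,
    map_sub, LinearMap.sub_apply, ← smul_sub]
  rw [DualBasis.coeff]
  abel_nf

variable (D d) in
omit hD in
/-- The multiderivation that corresponds to a derivation. -/
def DualBasis.derWord : WordFun ℒ L :=
  ∑ i, wmul (actionMap K A L) (β.b i).1 (derRemainder D d (β.ε i)) (unitWord ((β.b i).2 : L))

omit hD in
theorem DualBasis.derWord_apply (w : List (Letter ℒ)) : β.derWord d D w =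
    ∑ i, sgn K ((β.b i).1 * wdeg w) • derRemainder D d (β.ε i) w • ((β.b i).2 : L) := by
  simp only [derWord, Finset.sum_apply, wmul_unitWord_right, actionMap_apply]

theorem DualBasis.isMultiderWord_derWord :
    IsMultiderWord 𝒜 d (β.derWord d D) (derSymbol 𝒜 ℒ D d) where
  sym := IsSymWord.sum _ fun i _ =>
    (isSymWord_derRemainder D d _).wmul _ _ (IsSymWord.unitWord _)
  deg := HasWordDegree.sum _ fun i _ => by
    have := (hasWordDegree_derRemainder hD (β.ε i)).actionMap
      (HasWordDegree.unitWord (β.b i).2.2)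
    rwa [neg_add_cancel_right] at this
  symbol_sym := isSymWord_derSymbol D d
  symbol_deg := hasWordDegree_derSymbol hD
  symbol_multilinear := isMultilinearWord_derSymbol D d
  -- The symbol term contains the letter `x` itself; expanding it in the dual basis matches the
  -- defects of the coefficients one by one.
  leibniz p a ha x w := by
    rw [β.derWord_apply, β.derWord_apply]
    conv_rhs => rw [actionMap_apply, β.expand x]
    rw [Finset.smul_sum, Finset.smul_sum, Finset.smul_sum, Finset.smul_sum,
      ← Finset.sum_add_distrib]
    refine Finset.sum_congr rfl fun i _ => ?_
    rw [derRemainder_smulLetter hD _ ha, smul_smul_comm' _ (derSymbol 𝒜 ℒ D d w a),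
      smul_smul_comm' _ a, add_smul, smul_assoc, smul_assoc, mul_smul, mul_smul]
    generalize a • derRemainder D d (β.ε i) (x :: w) • ((β.b i).2 : L) = y
    generalize derSymbol 𝒜 ℒ D d w a • wordOf (β.ε i).1 [x] • ((β.b i).2 : L) = z
    simp only [wdeg_cons, smulLetter_fst]
    match_scalars <;>
      (try simp only [mul_one, mul_add, add_mul, neg_mul, mul_neg, sgn_add, sgn_neg,
        mul_comm (G := ℤ)]) <;> grind [sgn_mul_self]

/-- Inserting the generators contracts `ω` with them, and multilinearity pulls out their
coefficients; the result is the expansion of the remainder. -/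
theorem DualBasis.wins_derWord {e : ℤ} (ω : symForms 𝒜 ℒ 1 e) :
    wins d (wordOf ω.1) (β.derWord d D) = sgn K (d * e) • derRemainder D d ω := by
  have hω := mem_symForms_iff.1 ω.2
  rw [derRemainder_eq_sum hD β, derWord, wins_sum_right hω.2.1, Finset.smul_sum]
  refine Finset.sum_congr rfl fun i _ => ?_
  have h := IsMultilinearWord.wins_actionMap hω.2.1 hω.2.2
    (hasWordDegree_derRemainder hD (β.ε i)) (HasWordDegree.unitWord (β.b i).2.2)
  rw [neg_add_cancel_right, wins_unitWord hω.2.1, letter_coe, add_comm _ e] at h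
  rw [h, smul_smul, ← sgn_add]
  congr 1
  apply sgn_congr_mod
  push_cast
  grind

theorem DualBasis.wordEta_derWord_one {e : ℤ} (ω : symForms 𝒜 ℒ 1 e) :
    wordEta d (β.derWord d D) (derSymbol 𝒜 ℒ D d) e (wordOf ω.1) =
      symWord 𝒜 ℒ (d + e) (D (symOf 𝒜 ℒ 1 e ω)) := by
  rw [wordEta, β.wins_derWord hD, sgn_smul_sgn_smul, derRemainder, sub_sub_cancel]

omit hD in
theorem DualBasis.wordEta_derWord_const {p : ℤ} (a : 𝒜 p) :
    wordEta d (β.derWord d D) (derSymbol 𝒜 ℒ D d) p (unitWord (a : A)) =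
      symWord 𝒜 ℒ (d + p) (D (symOf 𝒜 ℒ 0 p (constForm 𝒜 ℒ p a))) := by
  rw [wordEta, wins_unitWord_left, smul_zero, sub_zero, wmul_derSymbol_unitWord]

theorem DualBasis.exists_multiderivation {k : ℕ} (hk : (k : ℤ) = r + 1) :
    ∃ X : multiderHom 𝒜 ℒ k d, (wordOf X.1.1 : WordFun ℒ L) = β.derWord d D ∧
      (wordOf X.1.2 : WordFun ℒ (A →ₗ[K] A)) = derSymbol 𝒜 ℒ D d := by
  have h := β.isMultiderWord_derWord hD
  have hX : ∃ f : Raw K L k L, (wordOf f : WordFun ℒ L) = β.derWord d D := by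
    obtain ⟨f, hf⟩ := h.sym.exists_wordOf k
    refine ⟨f, funext fun w => ?_⟩
    by_cases hw : w.length = k
    · exact hf w hw
    · rw [wordOf_eq_zero _ hw, β.derWord_apply]
      refine (Finset.sum_eq_zero fun i _ => ?_).symm
      rw [derRemainder_eq_zero hD _ (by omega), zero_smul, smul_zero]
  have hσ : ∃ g : Raw K L (k - 1) (A →ₗ[K] A),
      (wordOf g : WordFun ℒ (A →ₗ[K] A)) = derSymbol 𝒜 ℒ D d ∧ (k = 0 → g = 0) := by
    rcases k with _ | k
    -- Here `r = -1`, so constants are sent to form degree `-1` and the symbol vanishes on every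
    -- word.
    · refine ⟨0, ?_, fun _ => rfl⟩
      rw [wordOf_zero]
      funext w
      rw [derSymbol_eq_zero hD (by omega)]
      rfl
    · obtain ⟨g, hg⟩ := h.symbol_sym.exists_wordOf k
      refine ⟨g, funext fun w => ?_, fun h => absurd h (by omega)⟩
      by_cases hw : w.length = k
      · exact hg w hw
      · rw [wordOf_eq_zero _ hw, derSymbol_eq_zero hD (by omega)]
  obtain ⟨f, hf⟩ := hX
  obtain ⟨g, hg, hg₀⟩ := hσ
  refine ⟨⟨(f, g), isMultiderivation_iff.2 ⟨hg₀, ?_⟩⟩, hf, hg⟩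
  rw [hf, hg]
  exact h

-- The action of the reconstructed multiderivation and `D` agree on constants and on the `1`-forms
-- of the dual basis, so their difference is a derivation that must vanish.
include β in
theorem DualBasis.exists_etaHom [CharZero K] {k : ℕ} (hk : (k : ℤ) = r + 1) :
    ∃ X : multiderHom 𝒜 ℒ k d, etaHom 𝒜 ℒ k d X = D := by
  obtain ⟨X, h1, h2⟩ := β.exists_multiderivation hD hk
  have hE : etaHom 𝒜 ℒ k d X ∈ symDerHom 𝒜 ℒ r d := by
    have := etaHom_mem X
    rwa [hk, add_sub_cancel_right] at this
  have key : ∀ {l : ℕ} {e : ℤ} (ω : symForms 𝒜 ℒ l e),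
      wordEta d (β.derWord d D) (derSymbol 𝒜 ℒ D d) e (wordOf ω.1) =
        symWord 𝒜 ℒ (d + e) (D (symOf 𝒜 ℒ l e ω)) →
      (etaHom 𝒜 ℒ k d X - D) (symOf 𝒜 ℒ l e ω) = 0 := by
    intro l e ω h
    have hmem := (Submodule.sub_mem _ hE hD).1 l e ω
    refine sym_ext fun f => ?_
    rw [map_zero]
    by_cases hf : f = d + e
    · subst hf
      rw [LinearMap.sub_apply, map_sub, symWord_etaHom, symWord_symOf, h1, h2, h, sub_self]
    · exact funext fun w => symWord_eq_zero_of_mem_symPart hmem _ _ fun h => hf h.2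
  refine ⟨X, sub_eq_zero.1 (β.symDerHom_eq_zero (Submodule.sub_mem _ hE hD) (fun p a => ?_)
    fun i => key _ (β.wordEta_derWord_one hD _))⟩
  refine key _ ?_
  rw [wordOf_constForm, β.wordEta_derWord_const]

end

variable {ι : Type*} [Fintype ι] (β : DualBasis 𝒜 ℒ ι)
include β

theorem DualBasis.eta_surjective [CharZero K] (d : ℤ) : Function.Surjective (eta 𝒜 ℒ d) := by
  rintro ⟨D, hD⟩
  suffices h : symDer 𝒜 ℒ d ≤ LinearMap.range (etaEnd 𝒜 ℒ d) by
    obtain ⟨X, hX⟩ := h hD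
    exact ⟨X, Subtype.ext hX⟩
  refine iSup_le fun r D hD => ?_
  -- A shift below `-1` sends constants and `1`-forms to negative form degree, so the derivation is
  -- zero; otherwise `r + 1` is the number of entries.
  rcases lt_or_ge (r + 1) 0 with hr | hr
  · have hz : D = 0 := β.symDerHom_eq_zero hD
      (fun p a => eq_zero_of_mem_symPart (by push_cast; omega) (hD.1 0 p _))
      fun i => eq_zero_of_mem_symPart (by push_cast; omega) (hD.1 1 _ _)
    rw [hz]
    exact Submodule.zero_mem _
  · obtain ⟨X, hX⟩ := β.exists_etaHom hD (Int.toNat_of_nonneg hr)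
    exact ⟨_, (etaEnd_pairOf X.2).trans hX⟩

end Surjective

/-! ### Homogeneous dual bases of projective modules -/

section DualBasisExists

variable {K : Type*} [Field K] {A : Type*} [Ring A] [Algebra K A] (𝒜 : ℤ → Submodule K A)
  [GradedAlgebra 𝒜]
  {L : Type*} [AddCommGroup L] [Module K L] [Module A L] [IsScalarTower K A L]
  (ℒ : ℤ → Submodule K L) [DirectSum.Decomposition ℒ] [SetLike.GradedSMul 𝒜 ℒ]

theorem decompose_smul_of_mem (a : A) {i : ℤ} {y : L} (hy : y ∈ ℒ i) (p : ℤ) :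
    (DirectSum.decompose ℒ (a • y) (p + i) : L) = (DirectSum.decompose 𝒜 a p : A) • y := by
  induction a using DirectSum.Decomposition.inductionOn 𝒜 with
  | zero => simp
  | @homogeneous j a =>
    have h := smul_mem_graded a.2 hy
    by_cases hj : j = p
    · subst hj
      rw [DirectSum.decompose_of_mem_same _ h, DirectSum.decompose_of_mem_same _ a.2]
    · rw [DirectSum.decompose_of_mem_ne _ h (by omega), DirectSum.decompose_of_mem_ne _ a.2 hj,
        zero_smul]
  | add a b ha hb =>
    rw [add_smul, DirectSum.decompose_add, DirectSum.decompose_add, DirectSum.add_apply,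
      DirectSum.add_apply, Submodule.coe_add, Submodule.coe_add, ha, hb, add_smul]

omit [GradedAlgebra 𝒜] [IsScalarTower K A L] [SetLike.GradedSMul 𝒜 ℒ] in
variable (A) in
theorem exists_homogeneous_generators [Module.Finite A L] :
    ∃ T : Finset (Letter ℒ), Submodule.span A (Set.range fun t : T => (t.1.2 : L)) = ⊤ := by
  classical
  obtain ⟨s, hs⟩ := Module.Finite.fg_top (R := A) (M := L)
  refine ⟨s.biUnion fun x => (DirectSum.decompose ℒ x).support.image fun i => letter ℒ i x, ?_⟩
  rw [← top_le_iff, ← hs]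
  refine Submodule.span_le.2 fun x hx => ?_
  rw [← DirectSum.sum_support_decompose ℒ x]
  refine Submodule.sum_mem _ fun i hi => Submodule.subset_span ?_
  exact ⟨⟨letter ℒ i x, Finset.mem_biUnion.2 ⟨x, hx, Finset.mem_image_of_mem _ hi⟩⟩, rfl⟩

variable {ℒ} in
/-- The homogeneous part of degree `-c` of a linear form, as a function of words. -/
def linearFormWord (φ : L →ₗ[A] A) (c : ℤ) : WordFun ℒ A
  -- The sign turns ordinary `A`-linearity into graded `A`-linearity of degree `-c`.
  | [x] => sgn K (c * x.1) • (DirectSum.decompose 𝒜 (φ x.2) (-c + x.1) : A)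
  | _ => 0

/-- Left multiplication by an element of degree `r` shifts homogeneous components by `r`, so a
homogeneous part of a linear form is again linear. -/
theorem exists_linearForm (φ : L →ₗ[A] A) (c : ℤ) :
    ∃ ω : symForms 𝒜 ℒ 1 (-c), (wordOf ω.1 : WordFun ℒ A) = linearFormWord 𝒜 φ c := by
  refine exists_symForm ⟨fun v i x y w => ?_, fun v i k x w => ?_, fun v x y w => ?_⟩
    (fun w => ?_) (fun v r a ha x w => ?_) (fun w hw => ?_)
  · rcases v with _ | ⟨z, _ | ⟨z', v⟩⟩ <;> rcases w with _ | ⟨u, w⟩ <;>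
      simp [linearFormWord, DirectSum.decompose_add]
  · have h : φ (k • (x : L)) = k • φ x := by
      rw [← algebraMap_smul A k, map_smul, algebraMap_smul]
    have h2 (p : ℤ) : (DirectSum.decompose 𝒜 (k • φ x) p : A)
        = k • (DirectSum.decompose 𝒜 (φ x) p : A) := by
      rw [DirectSum.decompose_smul]
      rfl
    rcases v with _ | ⟨z, _ | ⟨z', v⟩⟩ <;> rcases w with _ | ⟨u, w⟩ <;>
      simp [linearFormWord, h, h2, smul_comm k, -DirectSum.decompose_smul]
  · rcases v with _ | ⟨z, v⟩ <;> simp [linearFormWord]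
  · rcases w with _ | ⟨x, _ | ⟨y, w⟩⟩
    · exact Submodule.zero_mem _
    · rw [wdeg_cons, wdeg_nil, add_zero]
      exact Submodule.smul_mem _ _ (Subtype.prop _)
    · exact Submodule.zero_mem _
  · rcases v with _ | ⟨z, _ | ⟨z', v⟩⟩ <;> rcases w with _ | ⟨u, w⟩ <;>
      simp only [linearFormWord, List.nil_append, List.cons_append, smul_zero, smul_eq_mul,
        mul_zero]
    rw [smulLetter_snd ha, map_smul, smulLetter_fst, wdeg_nil, add_left_comm, smul_eq_mul,
      DirectSum.coe_decompose_mul_add_of_left_mem 𝒜 ha, mul_smul_comm, smul_smul, ← sgn_add]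
    congr 1
    apply sgn_congr_mod
    push_cast
    grind
  · rcases w with _ | ⟨x, _ | ⟨y, w⟩⟩ <;> simp_all [linearFormWord]

/-- A finitely generated projective graded module has a homogeneous dual basis. -/
theorem exists_dualBasis [Module.Projective A L] [Module.Finite A L] :
    ∃ T : Finset (Letter ℒ), Nonempty (DualBasis 𝒜 ℒ T) := by
  obtain ⟨T, hT⟩ := exists_homogeneous_generators A ℒ
  -- Projectivity splits the surjection from the free module on the homogeneous generators. The
  -- splitting need not be graded, so homogeneous parts of its coordinates are taken.
  obtain ⟨s, hs⟩ := Module.projective_lifting_property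
    (Fintype.linearCombination A fun t : T => (t.1.2 : L)) LinearMap.id
    (LinearMap.range_eq_top.1 (by rw [Fintype.range_linearCombination, hT]))
  choose ω hω using fun t : T => exists_linearForm 𝒜 ℒ (LinearMap.proj t ∘ₗ s) t.1.1
  refine ⟨T, ⟨⟨fun t => t.1, ω, fun x => ?_⟩⟩⟩
  have h1 : (x.2 : L) = ∑ t : T, s x.2 t • (t.1.2 : L) := by
    have := LinearMap.congr_fun hs (x.2 : L)
    rw [LinearMap.comp_apply, Fintype.linearCombination_apply] at this
    exact this.symm
  -- As `x` is homogeneous, only the degree `x.1` part of its expansion matters, and this involves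
  -- just the selected components of the coordinates.
  have h2 : (x.2 : L) = ∑ t : T, (DirectSum.decompose ℒ (s x.2 t • (t.1.2 : L)) x.1 : L) := by
    conv_lhs => rw [← DirectSum.decompose_of_mem_same ℒ x.2.2, h1]
    rw [DirectSum.decompose_sum, DFinsupp.finsetSum_apply, Submodule.coe_sum]
  conv_lhs => rw [h2]
  refine Finset.sum_congr rfl fun t _ => ?_
  have h3 := decompose_smul_of_mem 𝒜 ℒ (s x.2 t) t.1.2.2 (-t.1.1 + x.1)
  rw [neg_add_cancel_comm] at h3
  rw [h3, hω]
  simp only [linearFormWord, LinearMap.comp_apply, LinearMap.proj_apply, smul_assoc,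
    sgn_smul_sgn_smul]

end DualBasisExists

end GradedMultider

end

theorem mainTheorem5 {K : Type*} [Field K] [CharZero K]
    {A : Type*} [Ring A] [Algebra K A] (𝒜 : ℤ → Submodule K A) [GradedAlgebra 𝒜]
    [GradedMultider.IsGradedCommutative 𝒜]
    {L : Type*} [AddCommGroup L] [Module K L] [Module A L] [IsScalarTower K A L]
    (ℒ : ℤ → Submodule K L) [DirectSum.Decomposition ℒ] [SetLike.GradedSMul 𝒜 ℒ] :
    ∃ (hMultider : GradedMultider.IsGradedLieAlgebra (GradedMultider.multider 𝒜 ℒ)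
        (GradedMultider.multiderBracket A ℒ))
      (hSymDer : GradedMultider.IsGradedLieAlgebra (GradedMultider.symDer 𝒜 ℒ)
        GradedMultider.gradedCommutator)
      (η : ∀ d : ℤ, GradedMultider.multider 𝒜 ℒ d →ₗ[K] GradedMultider.symDer 𝒜 ℒ d),
      -- `η(X)(ω) = σ_X ∘ ω - (-1)^{|X| |ω|} ω ∘ X`
      (∀ (k : ℕ) (d : ℤ) (X : GradedMultider.RawPair K A L k)
        (hX : X ∈ GradedMultider.multiderHom 𝒜 ℒ k d)
        (l : ℕ) (e : ℤ) (ω : GradedMultider.symForms 𝒜 ℒ l e) (n : ℕ),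
        (GradedMultider.symComponent 𝒜 ℒ n (d + e)
          ((η d ⟨GradedMultider.pairOf K A L k X, GradedMultider.pairOf_mem 𝒜 ℒ hX⟩ :
              Module.End K (GradedMultider.Sym 𝒜 ℒ)) (GradedMultider.symOf 𝒜 ℒ l e ω)) :
            GradedMultider.Raw K L n A) =
          GradedMultider.etaForm ℒ n d e X ω.1) ∧
      -- `η` is a morphism of graded Lie algebras
      GradedMultider.IsGradedLieMorphism hMultider hSymDer η ∧
      -- `η` maps multiderivations with `k` entries to derivations raising form degree by `k - 1`
      (∀ (k : ℕ) (d : ℤ) (X : GradedMultider.RawPair K A L k)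
        (hX : X ∈ GradedMultider.multiderHom 𝒜 ℒ k d),
        (η d ⟨GradedMultider.pairOf K A L k X, GradedMultider.pairOf_mem 𝒜 ℒ hX⟩ :
            Module.End K (GradedMultider.Sym 𝒜 ℒ)) ∈
          GradedMultider.symDerHom 𝒜 ℒ ((k : ℤ) - 1) d) ∧
      -- `η` is an isomorphism if `L` is projective and finitely generated
      (Module.Projective A L → Module.Finite A L → ∀ d : ℤ, Function.Bijective (η d)) := by
  refine ⟨GradedMultider.isGradedLieAlgebra_multider 𝒜 ℒ,
    GradedMultider.isGradedLieAlgebra_symDer 𝒜 ℒ, GradedMultider.eta 𝒜 ℒ,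
    fun k d X hX l e ω n => GradedMultider.symComponent_eta hX ω n,
    GradedMultider.isGradedLieMorphism_eta, fun k d X hX => ?_, fun _ _ d => ?_⟩
  · rw [GradedMultider.coe_eta, GradedMultider.etaEnd_pairOf hX]
    exact GradedMultider.etaHom_mem ⟨X, hX⟩
  · obtain ⟨T, ⟨β⟩⟩ := GradedMultider.exists_dualBasis 𝒜 ℒ
    exact ⟨β.eta_injective d, β.eta_surjective d⟩
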